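/- Let Alice and Bob hold a finite-dimensional bipartite main system $\mathbb{C}^{a}\otimes\mathbb{C}^{b}$. An LOCC map is a map $T$ obtained in finitely many steps, in each of which one of the parties performs a measurement with Kraus operators $K_i$, $\sum_i K_i^\dagger K_i=1$, on its part and announces the outcome; all choices may depend on all earlier outcomes, and the outcomes are finally discarded. A classical dissipative channel consists of a register at each party with basis $|0\rangle,\dots,|n\rangle$ and contributes $\Gamma(\mathcal C(\rho)-\rho)$ to the master equation, where $\mathcal C(\rho)=\sum_i \langle i|\,\mathrm{tr}_{\rm receiver}\rho\,|i\rangle_{\rm sender}\otimes |0\rangle\langle 0|_{\rm sender}\otimes|i\rangle\langle i|_{\rm receiver}$; it may run in either direction. A Lindblad generator is a map $X\mapsto -i[H,X]+\sum_k\bigl(L_kXL_k^\dagger-\tfrac12\{L_k^\dagger L_k,X\}\bigr)$ with $H=H^\dagger$. Write $\|\cdot\|_1$ for the trace norm. **Lemma.** For every LOCC map $T$ there are a finite family of classical channels and constants $C,\tau,\alpha_0>0$ such that the following holds. For all rates $\delta,\Gamma>0$ there are Lindblad generators $\mathfrak L_A$ (acting on Alice's part of the main system and her registers) and $\mathfrak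 L_B$ (acting on Bob's part and his registers), and a completely positive linear map $\Phi$ from operators on the total system to operators on the main system, such that for every $\gamma\ge 0$ with $\alpha:=(\gamma+\delta)/\Gamma\le\alpha_0$, every Lindblad generator $\mathfrak L$ on the main system with $\max_\sigma\|\mathfrak L(\sigma)\|_1\le 1$ over density matrices $\sigma$, and every solution $\rho(t)$, $t\ge 0$, of $$\dot\rho=\gamma\,\mathfrak L(\rho)+\Gamma\sum_c(\mathcal C_c(\rho)-\rho)+\mathfrak L_A(\rho)+\mathfrak L_B(\rho)$$ starting from an arbitrary density matrix of the total system, one has for all $t\ge\tau/\delta$: 1. The reduced state $\rho_M=\mathrm{tr}_{\rm registers}\,\rho$ of the main system satisfies $\dot\rho_M=\gamma\,\mathfrak L(\rho_M)+\delta\,(T'(\rho_M)-\rho_M)$ at time $t$, where $T'(\rho_M)=T(\rho_M)+E$ with a (time and state dependent) Hermitian operator $E$, $\|E\|_1\le C\sqrt\alpha$. 2. The part $\rho_0=\langle 0\cdots0|\rho|0\cdots0\rangle$ of the state in which all registers are empty satisfies $\|\rho_M-\rho_0\|_1\le C\alpha$ and $\dot\rho_0=\gamma\,\mathfrak L(\rho_0)+\delta\,(T'(\rho_0)-\rho_0)$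 at time $t$, where now $T'(\rho_0):=\Phi(\rho(t))$ depends completely positively on the total state and $\|T'(\rho_0)-T(\rho_0)\|_1\le C\sqrt\alpha$. -/

import Mathlib

open scoped Kronecker Matrix ComplexOrder

noncomputable section

namespace DissipativeLOCC

/-! ### States, norms and superoperators on finite-dimensional systems -/

/-- Linear maps from operators on `ℂ^m` to operators on `ℂ^n`. -/
abbrev SuperOp (m n : Type*) := Matrix m m ℂ →ₗ[ℂ] Matrix n n ℂ

/-- Density matrices. -/
def IsDensity {n : Type*} [Fintype n] (ρ : Matrix n n ℂ) : Prop :=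
  ρ.PosSemidef ∧ ρ.trace = 1

/-- The trace norm `tr √(M† M)`, i.e. the sum of the singular values of `M`. -/
def traceNorm {n : Type*} [Fintype n] [DecidableEq n] (M : Matrix n n ℂ) : ℝ :=
  ∑ i, √((Matrix.isHermitian_conjTranspose_mul_self M).eigenvalues i)

/-- The map `X ↦ K X K†`. -/
def conjBy {m n : Type*} [Fintype m] (K : Matrix n m ℂ) : SuperOp m n where
  toFun X := K * X * Kᴴ
  map_add' X Y := by rw [Matrix.mul_add, Matrix.add_mul]
  map_smul' c X := by simp

/-- `𝔏` is a Lindblad (GKSL) generator: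
`𝔏 X = -i [H, X] + ∑ₖ (Lₖ X Lₖ† - ½ (Lₖ† Lₖ X + X Lₖ† Lₖ))`. -/
def IsLindblad {n : Type*} [Fintype n] (𝔏 : SuperOp n n) : Prop :=
  ∃ H : Matrix n n ℂ, H.IsHermitian ∧ ∃ (N : ℕ) (L : Fin N → Matrix n n ℂ),
    ∀ X, 𝔏 X = -Complex.I • (H * X - X * H)
      + ∑ k, (L k * X * (L k)ᴴ
        - (1 / 2 : ℂ) • ((L k)ᴴ * L k * X + X * ((L k)ᴴ * L k)))

/-- The map `Φ ⊗ id` on the system extended by an ancilla `r`. -/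
def ampliate {m n : Type*} (r : Type*) (Φ : SuperOp m n) : SuperOp (m × r) (n × r) where
  toFun M := Matrix.of fun p q => Φ (Matrix.of fun i j => M (i, p.2) (j, q.2)) p.1 q.1
  map_add' X Y := by
    ext p q
    have : (Matrix.of fun i j => (X + Y) (i, p.2) (j, q.2) : Matrix m m ℂ)
        = (Matrix.of fun i j => X (i, p.2) (j, q.2))
          + (Matrix.of fun i j => Y (i, p.2) (j, q.2)) := rfl
    simp only [Matrix.of_apply, Matrix.add_apply]
    exact (congrFun (congrFun (congrArg Φ this) p.1) q.1).trans (by rw [map_add]; rfl)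
  map_smul' c X := by
    ext p q
    have : (Matrix.of fun i j => (c • X) (i, p.2) (j, q.2) : Matrix m m ℂ)
        = c • (Matrix.of fun i j => X (i, p.2) (j, q.2)) := rfl
    exact (congrFun (congrFun (congrArg Φ this) p.1) q.1).trans (by rw [map_smul]; rfl)

/-- Complete positivity: `Φ ⊗ id_k` preserves positive semidefiniteness for every `k`. -/
def IsCompletelyPositive {m n : Type*} [Fintype m] [Fintype n] (Φ : SuperOp m n) : Prop :=
  ∀ (k : ℕ) (X : Matrix (m × Fin k) (m × Fin k) ℂ),
    X.PosSemidef → (ampliate (Fin k) Φ X).PosSemidef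

/-- The superoperator on the system `N ≃ m × r` that acts as `Φ` on the factor `m` and trivially
on the factor `r`. -/
def actOn {N m r : Type*} (e : N ≃ m × r) (Φ : SuperOp m m) : SuperOp N N :=
  (Matrix.reindexLinearEquiv ℂ ℂ e e).symm.toLinearMap ∘ₗ ampliate r Φ ∘ₗ
    (Matrix.reindexLinearEquiv ℂ ℂ e e).toLinearMap

/-- A matrix-valued curve has derivative `M'` at time `t` (entry by entry). -/
def MatHasDerivAt {n : Type*} (M : ℝ → Matrix n n ℂ) (M' : Matrix n n ℂ) (t : ℝ) : Prop :=
  ∀ i j, HasDerivAt (fun s => M s i j) (M' i j) t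

/-- `ρ` solves the master equation `ρ̇ = G ρ` on `[0, ∞)` (one-sided derivative at `0`), started
in a density matrix. -/
def IsEvolution {n : Type*} [Fintype n] (G : SuperOp n n) (ρ : ℝ → Matrix n n ℂ) : Prop :=
  IsDensity (ρ 0) ∧
    ∀ t : ℝ, 0 ≤ t → ∀ i j, HasDerivWithinAt (fun s => ρ s i j) (G (ρ t) i j) (Set.Ici 0) t

/-! ### LOCC maps -/

/-- LOCC maps (finitely many rounds) on a bipartite system with local spaces `ℂ^a` (Alice) and
`ℂ^b` (Bob): either nothing is done, or one party measures a POVM given by Kraus operators `K i`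
with `∑ᵢ Kᵢ† Kᵢ = 1`, announces the outcome `i`, and the parties continue with an LOCC map `S i`
that may depend on `i` (and, recursively, on all earlier outcomes). -/
inductive IsLOCC {a b : Type*} [Fintype a] [Fintype b] [DecidableEq a] [DecidableEq b] :
    SuperOp (a × b) (a × b) → Prop
  | done : IsLOCC LinearMap.id
  | alice (n : ℕ) (K : Fin n → Matrix a a ℂ) (hK : ∑ i, (K i)ᴴ * K i = 1)
      (S : Fin n → SuperOp (a × b) (a × b)) (hS : ∀ i, IsLOCC (S i)) :
      IsLOCC (∑ i, S i ∘ₗ conjBy (K i ⊗ₖ (1 : Matrix b b ℂ)))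
  | bob (n : ℕ) (K : Fin n → Matrix b b ℂ) (hK : ∑ i, (K i)ᴴ * K i = 1)
      (S : Fin n → SuperOp (a × b) (a × b)) (hS : ∀ i, IsLOCC (S i)) :
      IsLOCC (∑ i, S i ∘ₗ conjBy ((1 : Matrix a a ℂ) ⊗ₖ K i))

/-! ### Classical dissipative channels -/

/-- A finite family of one-way classical channels between Alice and Bob: channel `c` runs from
Alice to Bob if `aliceToBob c = true` and from Bob to Alice otherwise, and each party owns one
`(size c + 1)`-dimensional register for it with basis states `|0⟩, …, |size c⟩`. -/
structure ChannelFamily where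
  num : ℕ
  aliceToBob : Fin num → Bool
  size : Fin num → ℕ

/-- Basis labels of the communication registers held by one of the two parties. -/
abbrev Registers (N : ChannelFamily) := (c : Fin N.num) → Fin (N.size c + 1)

/-- Basis labels of the total system: (Alice's main system and registers) × (Bob's main system
and registers). -/
abbrev Total (a b : Type*) (N : ChannelFamily) := (a × Registers N) × (b × Registers N)

/-- `|i⟩⟨j|` on the register of channel `c`, identity on the other registers of that party. -/
def regOp (N : ChannelFamily) (c : Fin N.num) (i j : Fin (N.size c + 1)) :
    Matrix (Registers N) (Registers N) ℂ :=
  Matrix.of fun r r' => if r' c = j ∧ r = Function.update r' c i then 1 else 0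

/-- An operator `X` on Alice's registers and an operator `Y` on Bob's registers, acting trivially
on the main system. -/
def onRegisters (a b : Type*) [DecidableEq a] [DecidableEq b] (N : ChannelFamily)
    (X Y : Matrix (Registers N) (Registers N) ℂ) : Matrix (Total a b N) (Total a b N) ℂ :=
  ((1 : Matrix a a ℂ) ⊗ₖ X) ⊗ₖ ((1 : Matrix b b ℂ) ⊗ₖ Y)

/-- One use of channel `c`: the sender's register is measured in the computational basis with
outcome `i` and reset to `|0⟩`; the receiver's register is discarded and set to `|i⟩`. This is
the map `ρ ↦ ∑ᵢ ⟨i| tr_receiver ρ |i⟩ ⊗ |0 i⟩⟨0 i|`. -/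
def channelMap (a b : Type*) [Fintype a] [Fintype b] [DecidableEq a] [DecidableEq b]
    (N : ChannelFamily) (c : Fin N.num) : SuperOp (Total a b N) (Total a b N) :=
  ∑ i, ∑ k, conjBy (if N.aliceToBob c
    then onRegisters a b N (regOp N c 0 i) (regOp N c i k)
    else onRegisters a b N (regOp N c i k) (regOp N c 0 i))

/-- The generator of the total master equation
`ρ̇ = γ 𝔏(ρ) + Γ ∑_c (channel_c(ρ) - ρ) + L_A(ρ) + L_B(ρ)`, where `𝔏` acts on the main system
alone, `L_A` on Alice's part of the main system and her registers, and `L_B` on Bob's. -/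
def totalGenerator {a b : Type*} [Fintype a] [Fintype b] [DecidableEq a] [DecidableEq b]
    (N : ChannelFamily) (γ Γ : ℝ) (𝔏 : SuperOp (a × b) (a × b))
    (LA : SuperOp (a × Registers N) (a × Registers N))
    (LB : SuperOp (b × Registers N) (b × Registers N)) :
    SuperOp (Total a b N) (Total a b N) :=
  (γ : ℂ) • actOn (Equiv.prodProdProdComm a (Registers N) b (Registers N)) 𝔏
    + (Γ : ℂ) • ∑ c, (channelMap a b N c - LinearMap.id)
    + actOn (Equiv.refl _) LA
    + actOn (Equiv.prodComm _ _) LB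

/-- The reduced state of the main system: the partial trace over all registers. -/
def reducedState {a b : Type*} (N : ChannelFamily)
    (ρ : Matrix (Total a b N) (Total a b N) ℂ) : Matrix (a × b) (a × b) ℂ :=
  Matrix.of fun x y => ∑ r : Registers N, ∑ s : Registers N,
    ρ ((x.1, r), (x.2, s)) ((y.1, r), (y.2, s))

/-- The (unnormalised) state `⟨0…0| ρ |0…0⟩` of the main system on the event that all registers
are empty, i.e. in the basis state `|0⟩`. -/
def idleState {a b : Type*} (N : ChannelFamily)
    (ρ : Matrix (Total a b N) (Total a b N) ℂ) : Matrix (a × b) (a × b) ℂ :=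
  Matrix.of fun x y => ρ ((x.1, 0), (x.2, 0)) ((y.1, 0), (y.2, 0))

end DissipativeLOCC

end

/-!
An LOCC map is unfolded into a decision tree in which the parties take turns, and its nodes are used
as tokens: in round `l` a token `x` becomes `y` under a Kraus operator `K l x y` of the party whose
turn it is (`IsRounds.exists_tokens`). Round `c` is announced through channel `c`, so that the
registers in the order sender of channel `0`, receiver of channel `0`, sender of channel `1`, … form
a pipeline through which tokens travel. Alice starts a run at the rate `δ` by applying the Kraus
operators of the root and writing the outcome into the first register. A party that finds a token in
a receiver's register performs the next round at the rate `Γ ^ 2 / δ`, empties this register, and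
writes the outcome into its next sender's register; after the last round the outcome is dropped. All
these operations decohere the registers they use and overwrite what they find.

With this choice the diagonal blocks `B ω` of the total state, one for each configuration `ω` of the
registers, satisfy a closed system of equations (`TokenProtocol.blocks_totalGenerator`): they evolve
under `γ 𝔏`, and classically controlled instruments act at the rates `δ`, `Γ` and `Γ ^ 2 / δ`. The
reduced state is the sum of all blocks and the idle state is the block of the empty configuration.
Since `𝔏` is a Lindblad generator the blocks stay positive (`IsHybridEvolution.posSemidef`).

Let `α = (γ + δ) / Γ`. Tokens enter at the rate `δ` and leave each site at a rate of at least `Γ`.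
Hence, after a transient of length `m / δ`, the flow of tokens through each site is at most
`δ (1 + O(α))`, and all sites are empty up to a probability `O(α)`. The crucial point is that the
flow of tokens of each kind is determined by the idle state `B 0` up to an error `O(α)` in norm. For
the configurations with a single token `x` at site `j` all unwanted gains are positive and can be
dropped, and the losses are due to the transfer of the token itself, to further entries, to erasure
by the channel from an empty sender's register and to `𝔏`, where everything but the first is smaller
by a factor `O(α)`. This yields by induction on `j` the lower bound
`lam j / δ • B (token j x) ≥ path j x (B 0) - O(α)` (`Pipeline.Run.token_ge`). The total flow is
bounded from above in trace, and a Hermitian matrix which is bounded from below and has small trace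
is small in norm (`abs_qf_le_of_lower`). Therefore the lower bounds are almost equalities.

In the derivative of the reduced state the entries contribute the first round, and the transfers
from site `j` contribute the next round minus the identity, applied to the flow through `j`.
Replacing all flows by the values determined by the idle state makes the sum telescope to `T - id`
(`Pipeline.sum_gen_eq`). The idle state is left at the rate `δ` and regained by those transfers that
leave the pipeline empty, which is a completely positive function of the total state
(`Pipeline.gen_zero`). The same combination of a lower bound and a trace bound compares it with the
image of the idle state. All errors are `O(α)`, which is at most `O(√α)` for `α ≤ 1`.
-/

noncomputable section

namespace DissipativeLOCC

/-! ### Quadratic forms, traces and the trace norm -/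

section LinearAlgebra

variable {n : Type*} [Fintype n]

/-- The real part of the quadratic form `v† X v`, as a real-linear functional of `X`. -/
def qf (v : n → ℂ) : Matrix n n ℂ →ₗ[ℝ] ℝ where
  toFun X := (star v ⬝ᵥ X *ᵥ v).re
  map_add' X Y := by simp [Matrix.add_mulVec, dotProduct_add]
  map_smul' c X := by simp [Matrix.smul_mulVec, dotProduct_smul]

/-- The squared Euclidean norm of a vector. -/
def nsq (v : n → ℂ) : ℝ := ∑ i, ‖v i‖ ^ 2

/-- The real part of the trace, as a real-linear functional. -/
def rtr : Matrix n n ℂ →ₗ[ℝ] ℝ where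
  toFun X := X.trace.re
  map_add' X Y := by simp
  map_smul' c X := by simp

/-- The squared Hilbert–Schmidt norm. -/
def hsq {m : Type*} [Fintype m] (A : Matrix m n ℂ) : ℝ := ∑ i, ∑ j, ‖A i j‖ ^ 2

theorem qf_apply (v : n → ℂ) (X : Matrix n n ℂ) : qf v X = (star v ⬝ᵥ X *ᵥ v).re := rfl

theorem rtr_apply (X : Matrix n n ℂ) : rtr X = X.trace.re := rfl

theorem qf_smul (v : n → ℂ) (c : ℝ) (X : Matrix n n ℂ) : qf v ((c : ℂ) • X) = c * qf v X := by
  simp [qf_apply]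

theorem rtr_smul (c : ℝ) (X : Matrix n n ℂ) : rtr ((c : ℂ) • X) = c * rtr X := by
  simp [rtr_apply]

omit [Fintype n] in
theorem isHermitian_sum {ι : Type*} (s : Finset ι) {X : ι → Matrix n n ℂ}
    (h : ∀ i ∈ s, (X i).IsHermitian) : (∑ i ∈ s, X i).IsHermitian := by
  rw [Matrix.IsHermitian, Matrix.conjTranspose_sum]
  exact Finset.sum_congr rfl fun i hi => (h i hi).eq

theorem nsq_nonneg (v : n → ℂ) : 0 ≤ nsq v := Finset.sum_nonneg fun _ _ => by positivity

theorem hsq_nonneg {m : Type*} [Fintype m] (A : Matrix m n ℂ) : 0 ≤ hsq A :=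
  Finset.sum_nonneg fun _ _ => Finset.sum_nonneg fun _ _ => by positivity

theorem nsq_eq_dotProduct (v : n → ℂ) : nsq v = (star v ⬝ᵥ v).re := by
  simp only [nsq, dotProduct, Complex.re_sum, Pi.star_apply]
  refine Finset.sum_congr rfl fun i _ => ?_
  rw [Complex.sq_norm, Complex.normSq_apply]
  simp

theorem nsq_eq_zero {v : n → ℂ} : nsq v = 0 ↔ v = 0 := by
  rw [nsq, Finset.sum_eq_zero_iff_of_nonneg (fun _ _ => by positivity)]
  simp [funext_iff]

theorem qf_conj {m : Type*} [Fintype m] (v : m → ℂ) (K : Matrix m n ℂ) (X : Matrix n n ℂ) :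
    qf v (K * X * Kᴴ) = qf (Kᴴ *ᵥ v) X := by
  rw [qf_apply, qf_apply, Matrix.star_mulVec, Matrix.conjTranspose_conjTranspose,
    ← Matrix.mulVec_mulVec, ← Matrix.mulVec_mulVec, Matrix.dotProduct_mulVec]

theorem qf_one [DecidableEq n] (v : n → ℂ) : qf v 1 = nsq v := by
  rw [qf_apply, Matrix.one_mulVec, nsq_eq_dotProduct]

theorem qf_conjTranspose_mul_self {m : Type*} [Fintype m] (A : Matrix m n ℂ) (v : n → ℂ) :
    qf v (Aᴴ * A) = nsq (A *ᵥ v) := by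
  rw [qf_apply, nsq_eq_dotProduct, Matrix.star_mulVec, ← Matrix.mulVec_mulVec,
    Matrix.dotProduct_mulVec]

theorem qf_nonneg {X : Matrix n n ℂ} (hX : X.PosSemidef) (v : n → ℂ) : 0 ≤ qf v X :=
  hX.re_dotProduct_nonneg v

theorem posSemidef_of_qf_nonneg {X : Matrix n n ℂ} (h : X.IsHermitian) (hq : ∀ v, 0 ≤ qf v X) :
    X.PosSemidef := by
  refine .of_dotProduct_mulVec_nonneg h fun v => ?_
  rw [Complex.nonneg_iff]
  exact ⟨hq v, (h.im_star_dotProduct_mulVec_self v).symm⟩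

theorem rtr_conjTranspose_mul_self {m : Type*} [Fintype m] (A : Matrix m n ℂ) :
    rtr (Aᴴ * A) = hsq A := by
  rw [rtr_apply, Matrix.trace, Complex.re_sum, hsq, Finset.sum_comm]
  refine Finset.sum_congr rfl fun j _ => ?_
  rw [Matrix.diag_apply, Matrix.mul_apply, Complex.re_sum]
  refine Finset.sum_congr rfl fun i _ => ?_
  rw [Complex.sq_norm, Complex.normSq_apply]
  simp

theorem hsq_conjTranspose {m : Type*} [Fintype m] (A : Matrix m n ℂ) : hsq Aᴴ = hsq A := by
  rw [hsq, hsq, Finset.sum_comm]; simp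

/-- Cauchy–Schwarz for complex vectors. -/
theorem norm_dotProduct_sq_le (v w : n → ℂ) : ‖v ⬝ᵥ w‖ ^ 2 ≤ nsq v * nsq w := by
  calc ‖v ⬝ᵥ w‖ ^ 2 ≤ (∑ i, ‖v i‖ * ‖w i‖) ^ 2 := by
        gcongr
        exact (norm_sum_le _ _).trans (le_of_eq (by simp))
    _ ≤ _ := Finset.sum_mul_sq_le_sq_mul_sq _ _ _

theorem nsq_mulVec_le {m : Type*} [Fintype m] (A : Matrix m n ℂ) (v : n → ℂ) :
    nsq (A *ᵥ v) ≤ hsq A * nsq v := by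
  rw [nsq, hsq, Finset.sum_mul]
  exact Finset.sum_le_sum fun i _ => norm_dotProduct_sq_le _ _

theorem hsq_mul_le {m l : Type*} [Fintype m] [Fintype l] (A : Matrix m n ℂ) (B : Matrix n l ℂ) :
    hsq (A * B) ≤ hsq A * hsq B := by
  rw [hsq, hsq, Finset.sum_mul]
  refine Finset.sum_le_sum fun i _ => ?_
  rw [hsq, Finset.sum_comm, Finset.mul_sum]
  refine Finset.sum_le_sum fun j _ => ?_
  exact norm_dotProduct_sq_le _ _

theorem abs_qf_le (v : n → ℂ) (X : Matrix n n ℂ) : |qf v X| ≤ √(hsq X) * nsq v := by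
  rw [← Real.sqrt_sq (nsq_nonneg v), ← Real.sqrt_mul (hsq_nonneg X)]
  refine Real.le_sqrt_of_sq_le ?_
  rw [sq_abs, ← sq_abs]
  calc |qf v X| ^ 2 ≤ ‖star v ⬝ᵥ X *ᵥ v‖ ^ 2 := by
        gcongr; exact Complex.abs_re_le_norm _
    _ ≤ nsq (star v) * nsq (X *ᵥ v) := norm_dotProduct_sq_le _ _
    _ ≤ nsq v * (hsq X * nsq v) := by
        have : nsq (star v) = nsq v := by simp [nsq]
        rw [this]
        exact mul_le_mul_of_nonneg_left (nsq_mulVec_le _ _) (nsq_nonneg _)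
    _ = _ := by ring

theorem rtr_nonneg {X : Matrix n n ℂ} (hX : X.PosSemidef) : 0 ≤ rtr X :=
  (Complex.nonneg_iff.1 hX.trace_nonneg).1

theorem hsq_add_le {m : Type*} [Fintype m] (A B : Matrix m n ℂ) :
    hsq (A + B) ≤ 2 * hsq A + 2 * hsq B := by
  simp only [hsq, Finset.mul_sum, ← Finset.sum_add_distrib]
  refine Finset.sum_le_sum fun i _ => Finset.sum_le_sum fun j _ => ?_
  have := norm_add_le (A i j) (B i j)
  rw [Matrix.add_apply]
  nlinarith [sq_nonneg (‖A i j‖ - ‖B i j‖), norm_nonneg (A i j + B i j)]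

variable [DecidableEq n]

theorem sum_eigenvalues_conjTranspose_mul_self (M : Matrix n n ℂ) :
    ∑ i, (Matrix.isHermitian_conjTranspose_mul_self M).eigenvalues i = hsq M := by
  rw [← rtr_conjTranspose_mul_self, rtr_apply,
    (Matrix.isHermitian_conjTranspose_mul_self M).trace_eq_sum_eigenvalues]
  simp

theorem eigenvalues_conjTranspose_mul_self_nonneg (M : Matrix n n ℂ) (i : n) :
    0 ≤ (Matrix.isHermitian_conjTranspose_mul_self M).eigenvalues i :=
  (Matrix.posSemidef_conjTranspose_mul_self M).eigenvalues_nonneg i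

theorem sqrt_hsq_le_traceNorm (M : Matrix n n ℂ) : √(hsq M) ≤ traceNorm M := by
  have h0 : 0 ≤ traceNorm M := Finset.sum_nonneg fun _ _ => Real.sqrt_nonneg _
  refine Real.sqrt_le_iff.2 ⟨h0, ?_⟩
  rw [← sum_eigenvalues_conjTranspose_mul_self, traceNorm]
  refine le_trans (le_of_eq ?_)
    (Finset.sum_sq_le_sq_sum_of_nonneg (fun _ _ => Real.sqrt_nonneg _))
  exact Finset.sum_congr rfl fun i _ =>
    (Real.sq_sqrt (eigenvalues_conjTranspose_mul_self_nonneg M i)).symm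

theorem traceNorm_le (M : Matrix n n ℂ) : traceNorm M ≤ √(Fintype.card n * hsq M) := by
  refine Real.le_sqrt_of_sq_le ?_
  rw [← sum_eigenvalues_conjTranspose_mul_self, traceNorm]
  refine (sq_sum_le_card_mul_sum_sq).trans (le_of_eq ?_)
  rw [Finset.card_univ]
  congr 1
  exact Finset.sum_congr rfl fun i _ =>
    (Real.sq_sqrt (eigenvalues_conjTranspose_mul_self_nonneg M i))

open scoped MatrixOrder in
theorem exists_eq_conjTranspose_mul_self {X : Matrix n n ℂ} (hX : X.PosSemidef) :
    ∃ A : Matrix n n ℂ, X = Aᴴ * A :=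
  CStarAlgebra.nonneg_iff_eq_star_mul_self.mp hX.nonneg

theorem qf_le_rtr_mul {X : Matrix n n ℂ} (hX : X.PosSemidef) (v : n → ℂ) :
    qf v X ≤ rtr X * nsq v := by
  obtain ⟨A, rfl⟩ := exists_eq_conjTranspose_mul_self hX
  rw [qf_conjTranspose_mul_self, rtr_conjTranspose_mul_self]
  exact nsq_mulVec_le _ _

theorem hsq_le_rtr_sq {X : Matrix n n ℂ} (hX : X.PosSemidef) : hsq X ≤ rtr X ^ 2 := by
  obtain ⟨A, rfl⟩ := exists_eq_conjTranspose_mul_self hX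
  rw [rtr_conjTranspose_mul_self, sq]
  refine (hsq_mul_le _ _).trans (le_of_eq ?_)
  rw [hsq_conjTranspose]

theorem rtr_one : rtr (1 : Matrix n n ℂ) = Fintype.card n := by simp [rtr_apply]

theorem hsq_smul_one (c : ℝ) : hsq ((c : ℂ) • (1 : Matrix n n ℂ)) = Fintype.card n * c ^ 2 := by
  rw [← rtr_conjTranspose_mul_self, Matrix.conjTranspose_smul, Matrix.conjTranspose_one,
    Matrix.smul_mul, Matrix.one_mul, smul_smul]
  simp [rtr_apply, sq, mul_comm]

/-- A lower bound on the quadratic form together with an upper bound on the trace controls the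
quadratic form from both sides. This is how one-sided estimates are turned into norm bounds. -/
theorem abs_qf_le_of_lower {X : Matrix n n ℂ} (hX : X.IsHermitian) {η β : ℝ} (hη : 0 ≤ η)
    (hlow : ∀ v, -(η * nsq v) ≤ qf v X) (htr : rtr X ≤ β) (v : n → ℂ) :
    |qf v X| ≤ (β + (Fintype.card n + 1) * η) * nsq v := by
  set Y : Matrix n n ℂ := X + (η : ℂ) • 1 with hYdef
  have hqY : ∀ w, qf w Y = qf w X + η * nsq w := fun w => by
    rw [hYdef, map_add, qf_smul, qf_one]
  have hY : Y.PosSemidef := by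
    refine posSemidef_of_qf_nonneg ?_ fun w => ?_
    · refine hX.add ?_
      rw [Matrix.IsHermitian, Matrix.conjTranspose_smul, Matrix.conjTranspose_one]
      simp
    · rw [hqY]; linarith [hlow w]
  have htrY : rtr Y = rtr X + η * Fintype.card n := by
    rw [hYdef, map_add, rtr_smul, rtr_one]
  have h1 := qf_le_rtr_mul hY v
  have h0 := rtr_nonneg hY
  have hv := nsq_nonneg v
  rw [htrY] at h1 h0
  rw [hqY] at h1
  have hβ : 0 ≤ β + η * Fintype.card n := by linarith
  have h3 : (rtr X + η * Fintype.card n) * nsq v ≤ (β + η * Fintype.card n) * nsq v := by gcongr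
  have h4 : 0 ≤ η * nsq v := by positivity
  have h5 := mul_nonneg hβ hv
  rw [abs_le]
  constructor
  · nlinarith [hlow v]
  · nlinarith

theorem abs_qf_le_of_posSemidef {X : Matrix n n ℂ} (hX : X.PosSemidef) {β : ℝ} (hβ : rtr X ≤ β)
    (v : n → ℂ) : |qf v X| ≤ β * nsq v := by
  rw [abs_of_nonneg (qf_nonneg hX v)]
  exact (qf_le_rtr_mul hX v).trans (by gcongr; exact nsq_nonneg v)

theorem rtr_eq_sum_qf (X : Matrix n n ℂ) : rtr X = ∑ i, qf (Pi.single i 1) X := by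
  simp [rtr_apply, qf_apply, Matrix.trace]

theorem nsq_single (i : n) : nsq (Pi.single i 1 : n → ℂ) = 1 := by
  rw [nsq, Finset.sum_eq_single i] <;> simp +contextual

/-- A Hermitian matrix whose quadratic form is small has small trace norm. -/
theorem traceNorm_le_of_abs_qf_le {X : Matrix n n ℂ} (hX : X.IsHermitian) {β : ℝ} (hβ : 0 ≤ β)
    (h : ∀ v, |qf v X| ≤ β * nsq v) : traceNorm X ≤ 4 * (Fintype.card n) ^ 2 * β := by
  set c : ℝ := (Fintype.card n : ℝ) with hc
  have hc0 : c = 0 ∨ 1 ≤ c := by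
    rcases Nat.eq_zero_or_pos (Fintype.card n) with h | h
    · left; simp [hc, h]
    · right; rw [hc]; exact_mod_cast h
  set Y : Matrix n n ℂ := X + (β : ℂ) • 1 with hYdef
  have hY : Y.PosSemidef := by
    refine posSemidef_of_qf_nonneg ?_ fun w => ?_
    · refine hX.add ?_
      rw [Matrix.IsHermitian, Matrix.conjTranspose_smul, Matrix.conjTranspose_one]
      simp
    · rw [hYdef, map_add, qf_smul, qf_one]; linarith [neg_le_of_abs_le (h w)]
  have htrX : rtr X ≤ c * β := by
    rw [rtr_eq_sum_qf]
    refine (Finset.sum_le_sum (g := fun _ => β) fun i _ => ?_).trans (by simp [hc])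
    have := (le_abs_self _).trans (h (Pi.single i 1))
    rwa [nsq_single, mul_one] at this
  have htrY : rtr Y ≤ 2 * c * β := by
    rw [hYdef, map_add, rtr_smul, rtr_one]; linarith
  have hhY : hsq Y ≤ (2 * c * β) ^ 2 :=
    (hsq_le_rtr_sq hY).trans (pow_le_pow_left₀ (rtr_nonneg hY) htrY 2)
  have hXY : X = Y + ((-β : ℝ) : ℂ) • 1 := by rw [hYdef]; simp
  have hhX : hsq X ≤ 2 * (2 * c * β) ^ 2 + 2 * (c * β ^ 2) := by
    rw [hXY]
    refine (hsq_add_le _ _).trans ?_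
    rw [hsq_smul_one, neg_sq]
    linarith
  refine (traceNorm_le X).trans (Real.sqrt_le_iff.2 ⟨by positivity, ?_⟩)
  rw [← hc]
  rcases hc0 with h0 | h1
  · simp [h0]
  · calc c * hsq X ≤ c * (2 * (2 * c * β) ^ 2 + 2 * (c * β ^ 2)) := by gcongr
      _ = β ^ 2 * (8 * c ^ 3 + 2 * c ^ 2) := by ring
      _ ≤ β ^ 2 * (16 * c ^ 4) := by
        gcongr
        nlinarith [pow_le_pow_right₀ h1 (show 2 ≤ 4 by norm_num),
          pow_le_pow_right₀ h1 (show 3 ≤ 4 by norm_num)]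
      _ = _ := by ring

end LinearAlgebra

/-! ### Lindblad generators -/

section Lindblad

variable {n : Type*} [Fintype n] {𝔏 : SuperOp n n}

theorem IsLindblad.trace_eq_zero (h : IsLindblad 𝔏) (X : Matrix n n ℂ) : (𝔏 X).trace = 0 := by
  obtain ⟨H, -, N, L, hL⟩ := h
  rw [hL, Matrix.trace_add, Matrix.trace_smul, Matrix.trace_sub, Matrix.trace_mul_comm H X,
    sub_self, smul_zero, zero_add, Matrix.trace_sum]
  refine Finset.sum_eq_zero fun k _ => ?_
  rw [Matrix.trace_sub, Matrix.trace_smul, Matrix.trace_add, Matrix.trace_mul_comm X,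
    Matrix.trace_mul_cycle (L k) X]
  simp only [smul_eq_mul]; ring

theorem IsLindblad.map_conjTranspose (h : IsLindblad 𝔏) (X : Matrix n n ℂ) :
    𝔏 Xᴴ = (𝔏 X)ᴴ := by
  obtain ⟨H, hH, N, L, hL⟩ := h
  rw [hL, hL, Matrix.conjTranspose_add, Matrix.conjTranspose_smul, Matrix.conjTranspose_sub,
    Matrix.conjTranspose_mul, Matrix.conjTranspose_mul, hH.eq, Matrix.conjTranspose_sum]
  congr 1
  · have : star (-Complex.I) = Complex.I := by simp
    rw [this, neg_smul, ← smul_neg, neg_sub]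
  · refine Finset.sum_congr rfl fun k _ => ?_
    rw [Matrix.conjTranspose_sub, Matrix.conjTranspose_smul, Matrix.conjTranspose_add]
    simp only [Matrix.conjTranspose_mul, Matrix.conjTranspose_conjTranspose, Matrix.mul_assoc]
    have : star (1 / 2 : ℂ) = 1 / 2 := by simp
    rw [this, add_comm (Xᴴ * _)]

/-- A Lindblad generator does not push a positive matrix out of the positive cone. -/
theorem IsLindblad.qf_nonneg_of_qf_eq_zero (h : IsLindblad 𝔏) {X : Matrix n n ℂ}
    (hX : X.PosSemidef) {v : n → ℂ} (hv : qf v X = 0) : 0 ≤ qf v (𝔏 X) := by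
  obtain ⟨H, hH, N, L, hL⟩ := h
  have hXv : X *ᵥ v = 0 := by
    rw [← hX.dotProduct_mulVec_zero_iff]
    exact Complex.ext hv (hX.1.im_star_dotProduct_mulVec_self v)
  have hvX : star v ᵥ* X = 0 := by
    rw [← hX.1.eq, ← Matrix.star_mulVec, hXv, star_zero]
  have e1 : ∀ A : Matrix n n ℂ, star v ⬝ᵥ (A * X) *ᵥ v = 0 := fun A => by
    rw [← Matrix.mulVec_mulVec, hXv]; simp
  have e2 : ∀ A : Matrix n n ℂ, star v ⬝ᵥ (X * A) *ᵥ v = 0 := fun A => by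
    rw [← Matrix.mulVec_mulVec, Matrix.dotProduct_mulVec, hvX]; simp
  have : qf v (𝔏 X) = ∑ k, qf v (L k * X * (L k)ᴴ) := by
    rw [hL, map_add, map_sum]
    have h0 : qf v (-Complex.I • (H * X - X * H)) = 0 := by
      rw [qf_apply, Matrix.smul_mulVec, Matrix.sub_mulVec, dotProduct_smul, dotProduct_sub, e1, e2]
      simp
    rw [h0, zero_add]
    refine Finset.sum_congr rfl fun k _ => ?_
    rw [map_sub]
    have h1 : qf v ((1 / 2 : ℂ) • ((L k)ᴴ * L k * X + X * ((L k)ᴴ * L k))) = 0 := by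
      rw [qf_apply, Matrix.smul_mulVec, Matrix.add_mulVec, dotProduct_smul, dotProduct_add, e1, e2]
      simp
    rw [h1, sub_zero]
  rw [this]
  exact Finset.sum_nonneg fun k _ => qf_nonneg (hX.mul_mul_conjTranspose_same _) v

/-- The normalisation of `𝔏` on density matrices, as a bound on quadratic forms. -/
theorem abs_qf_map_le [DecidableEq n] (h : ∀ σ, IsDensity σ → traceNorm (𝔏 σ) ≤ 1)
    {X : Matrix n n ℂ} (hX : X.PosSemidef) (v : n → ℂ) : |qf v (𝔏 X)| ≤ rtr X * nsq v := by
  rcases (rtr_nonneg hX).eq_or_lt with h0 | h0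
  · have : X = 0 := by
      rw [← hX.trace_eq_zero_iff]
      exact Complex.ext h0.symm (Complex.nonneg_iff.1 hX.trace_nonneg).2.symm
    simp [this, rtr]
  · set σ : Matrix n n ℂ := (((rtr X)⁻¹ : ℝ) : ℂ) • X with hσ
    have hXσ : X = ((rtr X : ℝ) : ℂ) • σ := by
      rw [hσ, smul_smul, ← Complex.ofReal_mul, mul_inv_cancel₀ h0.ne', Complex.ofReal_one, one_smul]
    have hd : IsDensity σ := by
      refine ⟨hX.smul (by simpa using h0.le), ?_⟩
      rw [hσ, Matrix.trace_smul]
      have : X.trace = ((rtr X : ℝ) : ℂ) :=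
        Complex.ext rfl (Complex.nonneg_iff.1 hX.trace_nonneg).2.symm
      rw [this, smul_eq_mul, ← Complex.ofReal_mul, inv_mul_cancel₀ h0.ne', Complex.ofReal_one]
    have h1 : |qf v (𝔏 σ)| ≤ nsq v := by
      refine (abs_qf_le v _).trans ?_
      have := (sqrt_hsq_le_traceNorm (𝔏 σ)).trans (h σ hd)
      nlinarith [nsq_nonneg v]
    calc |qf v (𝔏 X)| = rtr X * |qf v (𝔏 σ)| := by
          conv_lhs => rw [hXσ, map_smul, qf_smul, abs_mul, abs_of_nonneg h0.le]
      _ ≤ _ := by gcongr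

end Lindblad

/-! ### Positivity of classically controlled evolutions -/

section FirstExit

open Set Filter Topology

/-- A first-exit argument: if a function that is positive at time `0` has positive derivative
wherever it reaches its minimum value `0` on a compact set of parameters, then it stays positive. -/
theorem pos_of_first_exit {W : Type*} [TopologicalSpace W] {S : Set W} (hS : IsCompact S)
    {H H' : ℝ → W → ℝ} (hcont : ContinuousOn (fun p : ℝ × W => H p.1 p.2) (Ici 0 ×ˢ S))
    (h0 : ∀ w ∈ S, 0 < H 0 w)
    (hder : ∀ t, 0 ≤ t → ∀ w ∈ S, HasDerivWithinAt (fun s => H s w) (H' t w) (Ici 0) t)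
    (hpos : ∀ t, 0 ≤ t → ∀ w ∈ S, (∀ w' ∈ S, 0 ≤ H t w') → H t w = 0 → 0 < H' t w)
    {t : ℝ} (ht : 0 ≤ t) {w : W} (hw : w ∈ S) : 0 < H t w := by
  by_contra! hneg
  set Z : Set (ℝ × W) := (Icc 0 t ×ˢ S) ∩ {p | H p.1 p.2 ≤ 0} with hZ
  have hZc : IsCompact Z := by
    have hc : IsCompact (Icc 0 t ×ˢ S) := isCompact_Icc.prod hS
    have hco : ContinuousOn (fun p : ℝ × W => H p.1 p.2) (Icc 0 t ×ˢ S) :=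
      hcont.mono (prod_mono Icc_subset_Ici_self subset_rfl)
    rw [isCompact_iff_isCompact_univ] at hc
    have hcl : IsClosed {p : (Icc (0 : ℝ) t ×ˢ S : Set (ℝ × W)) | H p.1.1 p.1.2 ≤ 0} :=
      isClosed_le (continuousOn_iff_continuous_domRestrict.1 hco) continuous_const
    have := (hc.inter_right hcl).image continuous_subtype_val
    convert this using 1
    ext p
    simp only [hZ, mem_inter_iff, mem_ofPred_eq, mem_image, univ_inter, Subtype.exists,
      exists_and_left, exists_prop, exists_eq_right_right]
    exact and_comm
  obtain ⟨⟨s, v⟩, ⟨⟨⟨hs0, hst⟩, hv⟩, hle⟩, hmin⟩ :=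
    hZc.exists_isMinOn ⟨(t, w), ⟨⟨ht, le_rfl⟩, hw⟩, hneg⟩ continuous_fst.continuousOn
  simp only at hs0 hst hv
  simp only [mem_ofPred_eq] at hle
  have hspos : 0 < s := by
    rcases hs0.eq_or_lt with h | h
    · exact absurd (h0 v hv) (not_lt.2 (by rw [← h] at hle; exact hle))
    · exact h
  have hbefore : ∀ r ∈ Ico 0 s, ∀ u ∈ S, 0 < H r u := by
    intro r hr u hu
    by_contra! hc
    have : s ≤ r := hmin (a := (r, u)) ⟨⟨⟨hr.1, hr.2.le.trans hst⟩, hu⟩, hc⟩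
    exact absurd hr.2 (not_lt.2 this)
  have hda : ∀ u ∈ S, HasDerivAt (fun r => H r u) (H' s u) s := fun u hu =>
    (hder s hs0 u hu).hasDerivAt (Ici_mem_nhds hspos)
  have hev : ∀ᶠ r in 𝓝[<] s, r ∈ Ico 0 s := Ico_mem_nhdsLT hspos
  have hnn : ∀ u ∈ S, 0 ≤ H s u := fun u hu =>
    ge_of_tendsto ((hda u hu).continuousAt.tendsto.mono_left nhdsWithin_le_nhds)
      (hev.mono fun r hr => (hbefore r hr u hu).le)
  have hz : H s v = 0 := le_antisymm hle (hnn v hv)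
  have hslope := (hasDerivWithinAt_iff_tendsto_slope' (by simp)).1
    ((hda v hv).hasDerivWithinAt (s := Iio s))
  refine absurd (hpos s hs0 v hv hnn hz) (not_lt.2 (le_of_tendsto hslope (hev.mono fun r hr => ?_)))
  rw [slope_def_field, hz, sub_zero]
  exact div_nonpos_of_nonneg_of_nonpos (hbefore r hr v hv).le (by linarith [hr.2])

end FirstExit

theorem hasDerivWithinAt_map_of_entries {n : Type*} [Fintype n] (f : Matrix n n ℂ →ₗ[ℝ] ℝ)
    {M : ℝ → Matrix n n ℂ} {M' : Matrix n n ℂ} {s : Set ℝ} {t : ℝ}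
    (h : ∀ i j, HasDerivWithinAt (fun u => M u i j) (M' i j) s t) :
    HasDerivWithinAt (fun u => f (M u)) (f M') s t := by
  have h1 : HasDerivWithinAt (fun u => (M u : n → n → ℂ)) (M' : n → n → ℂ) s t :=
    hasDerivWithinAt_pi.2 fun i => hasDerivWithinAt_pi.2 fun j => h i j
  let g : (n → n → ℂ) →ₗ[ℝ] ℝ := f
  exact (LinearMap.toContinuousLinearMap g).hasFDerivAt.comp_hasDerivWithinAt t h1

theorem qf_eq_sum {n : Type*} [Fintype n] (v : n → ℂ) (X : Matrix n n ℂ) :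
    qf v X = ∑ i, ∑ j, (star (v i) * (X i j * v j)).re := by
  simp [qf_apply, dotProduct, Matrix.mulVec, Finset.mul_sum]

section Hybrid

variable {Ω Y M ι : Type*} [Fintype Ω] [Fintype Y] [Fintype M] [Fintype ι] [DecidableEq Ω]

/-- The effect, on a family of operators labelled by classical configurations, of a classically
controlled instrument: in configuration `ω` the operation `K ω y` is applied and the configuration
changes to `f ω y`. -/
def push (K : Ω → Y → Matrix M M ℂ) (f : Ω → Y → Ω) :
    (Ω → Matrix M M ℂ) →ₗ[ℂ] (Ω → Matrix M M ℂ) :=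
  LinearMap.pi fun ω' => ∑ ω, ∑ y, if f ω y = ω' then conjBy (K ω y) ∘ₗ LinearMap.proj ω else 0

theorem push_apply (K : Ω → Y → Matrix M M ℂ) (f : Ω → Y → Ω) (B : Ω → Matrix M M ℂ) (ω' : Ω) :
    push K f B ω' = ∑ ω, ∑ y, if f ω y = ω' then K ω y * B ω * (K ω y)ᴴ else 0 := by
  simp only [push, LinearMap.pi_apply, LinearMap.sum_apply]
  refine Finset.sum_congr rfl fun ω _ => Finset.sum_congr rfl fun y _ => ?_
  split_ifs <;> rfl

/-- The generator of an evolution in which the operators `B ω` evolve under `γ 𝔏` and the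
instruments `(K i, f i)` are applied at the rates `rate i`. -/
def hybridGen (γ : ℝ) (𝔏 : SuperOp M M) (rate : ι → ℝ) (K : ι → Ω → Y → Matrix M M ℂ)
    (f : ι → Ω → Y → Ω) : (Ω → Matrix M M ℂ) →ₗ[ℂ] (Ω → Matrix M M ℂ) :=
  (γ : ℂ) • LinearMap.pi (fun ω => 𝔏 ∘ₗ LinearMap.proj ω)
    + ∑ i, (rate i : ℂ) • (push (K i) (f i) - LinearMap.id)

theorem hybridGen_apply (γ : ℝ) (𝔏 : SuperOp M M) (rate : ι → ℝ) (K : ι → Ω → Y → Matrix M M ℂ)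
    (f : ι → Ω → Y → Ω) (B : Ω → Matrix M M ℂ) (ω : Ω) :
    hybridGen γ 𝔏 rate K f B ω
      = (γ : ℂ) • 𝔏 (B ω) + ∑ i, (rate i : ℂ) • (push (K i) (f i) B ω - B ω) := by
  simp [hybridGen]

theorem push_conjTranspose (K : Ω → Y → Matrix M M ℂ) (f : Ω → Y → Ω) (B : Ω → Matrix M M ℂ) :
    push K f (fun ω => (B ω)ᴴ) = fun ω => (push K f B ω)ᴴ := by
  funext ω'
  simp only [push_apply, Matrix.conjTranspose_sum]
  refine Finset.sum_congr rfl fun ω _ => Finset.sum_congr rfl fun y _ => ?_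
  split_ifs
  · simp [Matrix.mul_assoc]
  · simp

theorem hybridGen_conjTranspose (γ : ℝ) {𝔏 : SuperOp M M} (h𝔏 : IsLindblad 𝔏) (rate : ι → ℝ)
    (K : ι → Ω → Y → Matrix M M ℂ) (f : ι → Ω → Y → Ω) (B : Ω → Matrix M M ℂ) :
    hybridGen γ 𝔏 rate K f (fun ω => (B ω)ᴴ) = fun ω => (hybridGen γ 𝔏 rate K f B ω)ᴴ := by
  funext ω
  simp only [hybridGen_apply, push_conjTranspose, h𝔏.map_conjTranspose,
    Matrix.conjTranspose_add, Matrix.conjTranspose_sum, Matrix.conjTranspose_smul,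
    Matrix.conjTranspose_sub]
  simp

theorem qf_push (K : Ω → Y → Matrix M M ℂ) (f : Ω → Y → Ω) (B : Ω → Matrix M M ℂ) (ω' : Ω)
    (v : M → ℂ) :
    qf v (push K f B ω') = ∑ ω, ∑ y, if f ω y = ω' then qf ((K ω y)ᴴ *ᵥ v) (B ω) else 0 := by
  simp only [push_apply, map_sum]
  refine Finset.sum_congr rfl fun ω _ => Finset.sum_congr rfl fun y _ => ?_
  split_ifs
  · exact qf_conj _ _ _
  · exact map_zero _

/-- At the boundary of the positive cone the generator points inwards: the losses are proportional
to the vanishing quadratic form itself, and all gains are positive. -/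
theorem hybridGen_qf_nonneg {γ : ℝ} (hγ : 0 ≤ γ) {𝔏 : SuperOp M M} (h𝔏 : IsLindblad 𝔏)
    {rate : ι → ℝ} (hr : ∀ i, 0 ≤ rate i) (K : ι → Ω → Y → Matrix M M ℂ) (f : ι → Ω → Y → Ω)
    {B : Ω → Matrix M M ℂ} (hB : ∀ ω, (B ω).PosSemidef) {ω : Ω} {v : M → ℂ}
    (hv : qf v (B ω) = 0) : 0 ≤ qf v (hybridGen γ 𝔏 rate K f B ω) := by
  rw [hybridGen_apply, map_add, qf_smul, map_sum]
  refine add_nonneg (mul_nonneg hγ (h𝔏.qf_nonneg_of_qf_eq_zero (hB ω) hv))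
    (Finset.sum_nonneg fun i _ => ?_)
  rw [qf_smul, map_sub, hv, sub_zero, qf_push]
  refine mul_nonneg (hr i) (Finset.sum_nonneg fun ω _ => Finset.sum_nonneg fun y _ => ?_)
  split_ifs
  · exact qf_nonneg (hB ω) _
  · exact le_rfl

/-- `B` solves the evolution equation with generator `G` on `[0, ∞)`. -/
def IsHybridEvolution (G : (Ω → Matrix M M ℂ) →ₗ[ℂ] (Ω → Matrix M M ℂ))
    (B : ℝ → Ω → Matrix M M ℂ) : Prop :=
  ∀ t, 0 ≤ t → ∀ ω i j, HasDerivWithinAt (fun s => B s ω i j) (G (B t) ω i j) (Set.Ici 0) t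

/-- The perturbed solution `B + ε e^{ct} 1` stays strictly positive by the first-exit argument,
applied to its quadratic form on the unit sphere; then `ε` tends to zero. -/
theorem posSemidef_of_isHermitian [DecidableEq M] {γ : ℝ} (hγ : 0 ≤ γ) {𝔏 : SuperOp M M}
    (h𝔏 : IsLindblad 𝔏)
    {rate : ι → ℝ} (hr : ∀ i, 0 ≤ rate i) (K : ι → Ω → Y → Matrix M M ℂ) (f : ι → Ω → Y → Ω)
    {B : ℝ → Ω → Matrix M M ℂ} (hB : IsHybridEvolution (hybridGen γ 𝔏 rate K f) B)
    (hH : ∀ t, 0 ≤ t → ∀ ω, (B t ω).IsHermitian) (h0 : ∀ ω, (B 0 ω).PosSemidef)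
    {t : ℝ} (ht : 0 ≤ t) (ω : Ω) : (B t ω).PosSemidef := by
  set G := hybridGen γ 𝔏 rate K f with hG
  -- `c` dominates the growth rate of the perturbation `ε e^{ct} 1`
  set c : ℝ := (∑ ω, √(hsq (G (fun _ => 1) ω))) + 1 with hc
  have hone : ∀ ω v, qf v (G (fun _ => 1) ω) ≤ (c - 1) * nsq v := fun ω v => by
    refine (le_abs_self _).trans ((abs_qf_le _ _).trans ?_)
    have := Finset.single_le_sum (f := fun ω => √(hsq (G (fun _ => 1) ω)))
      (fun _ _ => Real.sqrt_nonneg _) (Finset.mem_univ ω)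
    have h' := nsq_nonneg v
    rw [hc, add_sub_cancel_right]
    gcongr
  let N : (Ω → M → ℂ) → ℝ := fun w => ∑ ω, nsq (w ω)
  have hNpos : ∀ w : Ω → M → ℂ, w ≠ 0 → 0 < N w := fun w hw => by
    refine lt_of_le_of_ne (Finset.sum_nonneg fun _ _ => nsq_nonneg _) fun h => hw ?_
    have := (Finset.sum_eq_zero_iff_of_nonneg fun _ _ => nsq_nonneg _).1 h.symm
    exact funext fun ω => nsq_eq_zero.1 (this ω (Finset.mem_univ _))
  have homog : ∀ (Z : Ω → Matrix M M ℂ) (e : ℝ), (∀ w ∈ Metric.sphere (0 : Ω → M → ℂ) 1,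
      0 ≤ (∑ ω, qf (w ω) (Z ω)) + e * N w) → ∀ ω v, 0 ≤ qf v (Z ω) + e * nsq v := by
    intro Z e hZ ω v
    by_cases hv : v = 0
    · simp [hv, qf_apply, nsq]
    have hsv : (Pi.single ω v : Ω → M → ℂ) ≠ 0 := by simpa using hv
    set r := ‖(Pi.single ω v : Ω → M → ℂ)‖ with hr
    have hrpos : 0 < r := norm_pos_iff.2 hsv
    have h1 := hZ ((r⁻¹ : ℝ) • (Pi.single ω v : Ω → M → ℂ))
      (by simp [norm_smul, ← hr, abs_of_pos hrpos, hrpos.ne'])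
    have h2 : ∀ Z : Matrix M M ℂ, ∀ u : M → ℂ, qf ((r⁻¹ : ℝ) • u) Z = (r⁻¹) ^ 2 * qf u Z :=
      fun Z u => by
        simp [qf_apply, Matrix.mulVec_smul, dotProduct_smul, sq, mul_assoc]
    have h3 : ∀ u : M → ℂ, nsq ((r⁻¹ : ℝ) • u) = (r⁻¹) ^ 2 * nsq u := fun u => by
      rw [← qf_one, ← qf_one, h2]
    simp only [N, Pi.smul_apply, h2, h3, ← Finset.mul_sum] at h1
    rw [Finset.sum_eq_single ω, Finset.sum_eq_single ω, Pi.single_eq_same] at h1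
    · have h4 : 0 ≤ (r⁻¹) ^ 2 * (qf v (Z ω) + e * nsq v) := by linarith
      exact nonneg_of_mul_nonneg_right h4 (by positivity)
    · intro ω' _ h; rw [Pi.single_eq_of_ne h]; simp [nsq]
    · simp
    · intro ω' _ h; rw [Pi.single_eq_of_ne h]; simp [qf_apply]
    · simp
  have key : ∀ ε : ℝ, 0 < ε → ∀ w ∈ Metric.sphere (0 : Ω → M → ℂ) 1,
      0 < (∑ ω, qf (w ω) (B t ω)) + ε * Real.exp (c * t) * N w := by
    intro ε hε w hw
    refine pos_of_first_exit (isCompact_sphere (0 : Ω → M → ℂ) 1)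
      (H := fun t w => (∑ ω, qf (w ω) (B t ω)) + ε * Real.exp (c * t) * N w)
      (H' := fun t w => (∑ ω, qf (w ω) (G (B t) ω)) + ε * (Real.exp (c * t) * c) * N w)
      ?_ ?_ ?_ ?_ ht hw
    · have hBc : ∀ ω i j, ContinuousOn (fun p : ℝ × (Ω → M → ℂ) => B p.1 ω i j)
          (Set.Ici 0 ×ˢ Metric.sphere 0 1) := fun ω i j => by
        have h1 : ContinuousOn (fun s => B s ω i j) (Set.Ici 0) :=
          fun s hs => (hB s hs ω i j).continuousWithinAt
        exact h1.comp continuousOn_fst fun p hp => hp.1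
      refine ContinuousOn.add (continuousOn_finsetSum _ fun ω _ => ?_) ?_
      · simp only [qf_eq_sum]
        refine continuousOn_finsetSum _ fun i _ => continuousOn_finsetSum _ fun j _ => ?_
        refine Complex.continuous_re.comp_continuousOn ?_
        refine ContinuousOn.mul (by fun_prop) (ContinuousOn.mul (hBc ω i j) (by fun_prop))
      · refine Continuous.continuousOn ?_
        simp only [N, nsq]
        fun_prop
    · intro w hw
      have hw0 : w ≠ 0 := by rintro rfl; simp at hw
      have h1 : 0 ≤ ∑ ω, qf (w ω) (B 0 ω) := Finset.sum_nonneg fun ω _ => qf_nonneg (h0 ω) _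
      have := hNpos w hw0
      positivity
    · intro s hs w hw
      refine HasDerivWithinAt.add (HasDerivWithinAt.fun_sum fun ω _ => ?_) ?_
      · exact hasDerivWithinAt_map_of_entries (qf (w ω)) (hB s hs ω)
      · have h1 : HasDerivAt (fun u : ℝ => Real.exp (c * u)) (Real.exp (c * s) * c) s := by
          simpa using ((hasDerivAt_id s).const_mul c).exp
        exact ((h1.const_mul ε).mul_const (N w)).hasDerivWithinAt
    · intro s hs w hw hmin hz
      have hw0 : w ≠ 0 := by rintro rfl; simp at hw
      set e : ℝ := ε * Real.exp (c * s) with he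
      have hepos : 0 < e := by positivity
      set X : Ω → Matrix M M ℂ := B s + (e : ℂ) • (fun _ : Ω => (1 : Matrix M M ℂ)) with hX
      have hqX : ∀ ω v, qf v (X ω) = qf v (B s ω) + e * nsq v := fun ω v => by
        rw [hX, Pi.add_apply, Pi.smul_apply, map_add, qf_smul, qf_one]
      have hXpos : ∀ ω, (X ω).PosSemidef := fun ω => by
        refine posSemidef_of_qf_nonneg ((hH s hs ω).add ?_) fun v => ?_
        · rw [Pi.smul_apply, Matrix.IsHermitian, Matrix.conjTranspose_smul,
            Matrix.conjTranspose_one]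
          simp
        · rw [hqX]; exact homog _ _ hmin ω v
      have hsum : ∑ ω, qf (w ω) (X ω) = 0 := by
        simp only [hqX, Finset.sum_add_distrib, ← Finset.mul_sum]
        exact hz
      have hzero : ∀ ω, qf (w ω) (X ω) = 0 := fun ω =>
        (Finset.sum_eq_zero_iff_of_nonneg fun ω _ => qf_nonneg (hXpos ω) _).1 hsum ω
          (Finset.mem_univ _)
      have hGX : 0 ≤ ∑ ω, qf (w ω) (G X ω) := Finset.sum_nonneg fun ω _ =>
        hybridGen_qf_nonneg hγ h𝔏 hr K f hXpos (hzero ω)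
      have hGX2 : ∑ ω, qf (w ω) (G X ω)
          = (∑ ω, qf (w ω) (G (B s) ω)) + e * ∑ ω, qf (w ω) (G (fun _ => 1) ω) := by
        rw [Finset.mul_sum, ← Finset.sum_add_distrib]
        refine Finset.sum_congr rfl fun ω _ => ?_
        rw [hX, map_add, map_smul, Pi.add_apply, Pi.smul_apply, map_add, qf_smul]
      have hb : ∑ ω, qf (w ω) (G (fun _ => 1) ω) ≤ (c - 1) * N w := by
        simp only [N, Finset.mul_sum]
        exact Finset.sum_le_sum fun ω _ => hone ω _
      have hb' := mul_le_mul_of_nonneg_left hb hepos.le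
      have := mul_pos hepos (hNpos w hw0)
      have hce : ε * (Real.exp (c * s) * c) * N w = e * (c * N w) := by rw [he]; ring
      rw [hce]
      nlinarith
  refine posSemidef_of_qf_nonneg (hH t ht ω) fun v => ?_
  refine le_of_forall_pos_le_add fun ε hε => ?_
  have hA : 0 ≤ Real.exp (c * t) * nsq v := mul_nonneg (Real.exp_pos _).le (nsq_nonneg v)
  set A := Real.exp (c * t) * nsq v with hAdef
  have h1 := homog (B t) (ε / (A + 1) * Real.exp (c * t))
    (fun w hw => (key (ε / (A + 1)) (by positivity) w hw).le) ω v
  have h2 : ε / (A + 1) * Real.exp (c * t) * nsq v ≤ ε := by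
    rw [mul_assoc, ← hAdef, div_mul_eq_mul_div, div_le_iff₀ (by positivity)]
    nlinarith
  linarith

omit [Fintype Ω] [Fintype M] [DecidableEq Ω] in
theorem IsHybridEvolution.combination {G : (Ω → Matrix M M ℂ) →ₗ[ℂ] (Ω → Matrix M M ℂ)}
    {B B' : ℝ → Ω → Matrix M M ℂ} (h : IsHybridEvolution G B) (h' : IsHybridEvolution G B')
    (c c' : ℂ) : IsHybridEvolution G (fun t => c • B t + c' • B' t) := by
  intro t ht ω i j
  rw [map_add, map_smul, map_smul]
  exact ((h t ht ω i j).const_mul c).add ((h' t ht ω i j).const_mul c')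

theorem IsHybridEvolution.conjTranspose {γ : ℝ} {𝔏 : SuperOp M M} (h𝔏 : IsLindblad 𝔏)
    {rate : ι → ℝ} {K : ι → Ω → Y → Matrix M M ℂ} {f : ι → Ω → Y → Ω}
    {B : ℝ → Ω → Matrix M M ℂ} (hB : IsHybridEvolution (hybridGen γ 𝔏 rate K f) B) :
    IsHybridEvolution (hybridGen γ 𝔏 rate K f) (fun t ω => (B t ω)ᴴ) := by
  intro t ht ω i j
  rw [hybridGen_conjTranspose γ h𝔏]
  exact (hB t ht ω j i).star

variable [DecidableEq M] {γ : ℝ} {𝔏 : SuperOp M M} {rate : ι → ℝ}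
  {K : ι → Ω → Y → Matrix M M ℂ} {f : ι → Ω → Y → Ω} {B : ℝ → Ω → Matrix M M ℂ}

/-- Hermiticity follows from positivity: `±i (B - B†)` are Hermitian solutions that start at zero,
so both stay positive semidefinite. -/
theorem IsHybridEvolution.isHermitian (hB : IsHybridEvolution (hybridGen γ 𝔏 rate K f) B)
    (hγ : 0 ≤ γ) (h𝔏 : IsLindblad 𝔏) (hr : ∀ i, 0 ≤ rate i) (h0 : ∀ ω, (B 0 ω).PosSemidef)
    {t : ℝ} (ht : 0 ≤ t) (ω : Ω) : (B t ω).IsHermitian := by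
  have hskew : ∀ (c : ℂ), c = Complex.I ∨ c = -Complex.I →
      (c • B t ω + (-c) • (B t ω)ᴴ).PosSemidef := by
    intro c hc
    refine posSemidef_of_isHermitian hγ h𝔏 hr K f
      (hB.combination (hB.conjTranspose h𝔏) c (-c)) (fun s hs ω => ?_) (fun ω => ?_) ht ω
    · simp only [Pi.add_apply, Pi.smul_apply]
      rw [Matrix.IsHermitian, Matrix.conjTranspose_add, Matrix.conjTranspose_smul,
        Matrix.conjTranspose_smul, Matrix.conjTranspose_conjTranspose, add_comm]
      rcases hc with rfl | rfl <;> simp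
    · simp only [Pi.add_apply, Pi.smul_apply]
      rw [(h0 ω).1.eq]
      simp [Matrix.PosSemidef.zero]
  have h1 := hskew _ (Or.inl rfl)
  have h2 := hskew _ (Or.inr rfl)
  have h3 : (Complex.I • B t ω + (-Complex.I) • (B t ω)ᴴ).trace = 0 := by
    refine le_antisymm ?_ h1.trace_nonneg
    have := h2.trace_nonneg
    have e : (-Complex.I) • B t ω + (- -Complex.I) • (B t ω)ᴴ
        = -(Complex.I • B t ω + (-Complex.I) • (B t ω)ᴴ) := by simp [add_comm]
    rw [e, Matrix.trace_neg] at this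
    exact neg_nonneg.1 this
  rw [h1.trace_eq_zero_iff, neg_smul, ← smul_neg, ← smul_add, smul_eq_zero] at h3
  have := h3.resolve_left Complex.I_ne_zero
  exact (eq_of_sub_eq_zero (by rwa [sub_eq_add_neg])).symm

theorem IsHybridEvolution.posSemidef (hB : IsHybridEvolution (hybridGen γ 𝔏 rate K f) B)
    (hγ : 0 ≤ γ) (h𝔏 : IsLindblad 𝔏) (hr : ∀ i, 0 ≤ rate i) (h0 : ∀ ω, (B 0 ω).PosSemidef)
    {t : ℝ} (ht : 0 ≤ t) (ω : Ω) : (B t ω).PosSemidef :=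
  posSemidef_of_isHermitian hγ h𝔏 hr K f hB
    (fun _ hs ω => hB.isHermitian hγ h𝔏 hr h0 hs ω) h0 ht ω

omit [DecidableEq M] in
theorem sum_mul_rtr_push (K : Ω → Y → Matrix M M ℂ) (f : Ω → Y → Ω) (B : Ω → Matrix M M ℂ)
    (φ : Ω → ℝ) :
    ∑ ω, φ ω * rtr (push K f B ω) = ∑ ω, ∑ y, φ (f ω y) * rtr (K ω y * B ω * (K ω y)ᴴ) := by
  simp only [push_apply, map_sum, Finset.mul_sum]
  rw [Finset.sum_comm]
  refine Finset.sum_congr rfl fun ω _ => ?_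
  rw [Finset.sum_comm]
  refine Finset.sum_congr rfl fun y _ => ?_
  rw [Finset.sum_eq_single (f ω y)]
  · simp
  · intro ω' _ h
    rw [if_neg (Ne.symm h)]; simp
  · simp

theorem sum_rtr_conj {K : Y → Matrix M M ℂ} (hK : ∑ y, (K y)ᴴ * K y = 1) (X : Matrix M M ℂ) :
    ∑ y, rtr (K y * X * (K y)ᴴ) = rtr X := by
  have : ∀ y, rtr (K y * X * (K y)ᴴ) = rtr ((K y)ᴴ * K y * X) := fun y => by
    rw [rtr_apply, rtr_apply, Matrix.trace_mul_cycle]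
  rw [Finset.sum_congr rfl fun y _ => this y, ← map_sum, ← Finset.sum_mul, hK, Matrix.one_mul]

/-- The rate of change of the expectation of a function of the classical configuration. -/
theorem sum_mul_rtr_hybridGen (h𝔏 : IsLindblad 𝔏) (hK : ∀ i ω, ∑ y, (K i ω y)ᴴ * K i ω y = 1)
    (B : Ω → Matrix M M ℂ) (φ : Ω → ℝ) :
    ∑ ω, φ ω * rtr (hybridGen γ 𝔏 rate K f B ω)
      = ∑ i, rate i * ∑ ω, ∑ y, (φ (f i ω y) - φ ω) * rtr (K i ω y * B ω * (K i ω y)ᴴ) := by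
  have h1 : ∀ X, rtr (𝔏 X) = 0 := fun X => by rw [rtr_apply, h𝔏.trace_eq_zero]; rfl
  have h2 : ∀ i ω, φ ω * rtr (B ω) = ∑ y, φ ω * rtr (K i ω y * B ω * (K i ω y)ᴴ) := fun i ω => by
    rw [← Finset.mul_sum, sum_rtr_conj (hK i ω)]
  simp only [hybridGen_apply, map_add, map_sum, rtr_smul, h1, mul_zero, zero_add, Finset.mul_sum]
  rw [Finset.sum_comm]
  refine Finset.sum_congr rfl fun i _ => ?_
  have h3 := sum_mul_rtr_push (K i) (f i) B φ
  calc ∑ ω, φ ω * (rate i * rtr (push (K i) (f i) B ω - B ω))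
      = rate i * (∑ ω, φ ω * rtr (push (K i) (f i) B ω) - ∑ ω, φ ω * rtr (B ω)) := by
        rw [← Finset.sum_sub_distrib, Finset.mul_sum]
        exact Finset.sum_congr rfl fun ω _ => by rw [map_sub]; ring
    _ = _ := by
        rw [h3, Finset.sum_congr rfl fun ω _ => h2 i ω, ← Finset.sum_sub_distrib, Finset.mul_sum]
        refine Finset.sum_congr rfl fun ω _ => ?_
        rw [← Finset.sum_sub_distrib, Finset.mul_sum]
        exact Finset.sum_congr rfl fun y _ => by ring

end Hybrid

/-! ### Scalar relaxation estimates -/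

/-- Relaxation towards at most `c`: if `u' ≤ lam (c - u)` then `u` approaches `c` from above at the
rate `lam`. -/
theorem le_add_exp_of_deriv_le {u u' : ℝ → ℝ} {lam c U t₀ t : ℝ} (ht₀ : 0 ≤ t₀) (htt : t₀ ≤ t)
    (hu : ∀ s, 0 ≤ s → HasDerivWithinAt u (u' s) (Set.Ici 0) s)
    (hd : ∀ s, t₀ ≤ s → u' s ≤ lam * (c - u s)) (hU : u t₀ ≤ c + U) :
    u t ≤ c + U * Real.exp (-(lam * (t - t₀))) := by
  set g : ℝ → ℝ := fun s => Real.exp (lam * (s - t₀)) * (u s - c) with hg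
  have hder : ∀ s, 0 ≤ s → HasDerivWithinAt g
      (Real.exp (lam * (s - t₀)) * lam * (u s - c) + Real.exp (lam * (s - t₀)) * u' s)
      (Set.Ici 0) s := fun s hs => by
    have h1 : HasDerivAt (fun s : ℝ => Real.exp (lam * (s - t₀)))
        (Real.exp (lam * (s - t₀)) * lam) s := by
      simpa using (((hasDerivAt_id s).sub_const t₀).const_mul lam).exp
    exact h1.hasDerivWithinAt.mul ((hu s hs).sub_const c)
  have hanti : AntitoneOn g (Set.Icc t₀ t) := by
    refine antitoneOn_of_deriv_nonpos (convex_Icc _ _) ?_ ?_ ?_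
    · intro s hs
      exact ((hder s (ht₀.trans hs.1)).mono
        (fun r hr => ht₀.trans hr.1)).continuousWithinAt
    · intro s hs
      rw [interior_Icc] at hs ⊢
      have hs0 : 0 < s := ht₀.trans_lt hs.1
      exact ((hder s hs0.le).hasDerivAt (Ici_mem_nhds hs0)).differentiableAt.differentiableWithinAt
    · intro s hs
      rw [interior_Icc] at hs
      have hs0 : 0 < s := ht₀.trans_lt hs.1
      rw [((hder s hs0.le).hasDerivAt (Ici_mem_nhds hs0)).deriv]
      have := hd s hs.1.le
      have he := Real.exp_pos (lam * (s - t₀))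
      nlinarith
  have h1 := hanti (Set.left_mem_Icc.2 htt) (Set.right_mem_Icc.2 htt) htt
  simp only [hg, sub_self, mul_zero, Real.exp_zero, one_mul] at h1
  have he := Real.exp_pos (lam * (t - t₀))
  have h2 : u t - c ≤ (u t₀ - c) * Real.exp (-(lam * (t - t₀))) := by
    rw [Real.exp_neg, ← div_eq_mul_inv, le_div_iff₀ he, mul_comm]
    exact h1
  have h3 : (u t₀ - c) * Real.exp (-(lam * (t - t₀))) ≤ U * Real.exp (-(lam * (t - t₀))) :=
    mul_le_mul_of_nonneg_right (by linarith) (Real.exp_pos _).le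
  linarith

theorem ge_sub_exp_of_le_deriv {u u' : ℝ → ℝ} {lam c U t₀ t : ℝ} (ht₀ : 0 ≤ t₀) (htt : t₀ ≤ t)
    (hu : ∀ s, 0 ≤ s → HasDerivWithinAt u (u' s) (Set.Ici 0) s)
    (hd : ∀ s, t₀ ≤ s → lam * (c - u s) ≤ u' s) (hU : c - U ≤ u t₀) :
    c - U * Real.exp (-(lam * (t - t₀))) ≤ u t := by
  have := le_add_exp_of_deriv_le (u := fun s => -u s) (u' := fun s => -u' s) (lam := lam) (c := -c)
    (U := U) ht₀ htt (fun s hs => (hu s hs).neg) (fun s hs => by linarith [hd s hs]) (by linarith)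
  linarith

theorem sq_mul_exp_neg_le {x : ℝ} (hx : 0 < x) : x ^ 2 * Real.exp (-x) ≤ 6 / x := by
  have h := Real.pow_div_factorial_le_exp x hx.le 3
  rw [Real.exp_neg, ← div_eq_mul_inv, div_le_div_iff₀ (Real.exp_pos x) hx]
  simp [Nat.factorial] at h
  nlinarith

theorem exp_neg_le_inv {x : ℝ} (hx : 0 < x) : Real.exp (-x) ≤ 1 / x := by
  rw [Real.exp_neg, ← one_div]
  exact one_div_le_one_div_of_le hx (by linarith [Real.add_one_le_exp x])

/-! ### Pipelines -/

/-- A pipeline: tokens, i.e. non-zero elements of `Fin (n + 1)`, travel through the sites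
`0, …, m - 1`; a token `x` that leaves site `j` becomes `y` under the operator `K (j + 1) x y`,
and new tokens `y` enter at site `0` under `K 0 root y`. The value `0` means that a site is empty.
The flag `ow j` tells whether an empty site `j` erases the content of site `j + 1`, as a channel
does when the sender's register is empty. -/
structure Pipeline (M : Type*) [Fintype M] [DecidableEq M] where
  m : ℕ
  n : ℕ
  K : ℕ → Fin (n + 1) → Fin (n + 1) → Matrix M M ℂ
  root : Fin (n + 1)
  ow : ℕ → Bool
  root_ne : root ≠ 0
  sum_K : ∀ l x, ∑ y, (K l x y)ᴴ * K l x y = 1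
  K_zero_zero : ∀ l, K l 0 0 = 1
  K_zero : ∀ l y, y ≠ 0 → K l 0 y = 0
  K_empty : ∀ l x, x ≠ 0 → K l x 0 = 0

namespace Pipeline

variable {M : Type*} [Fintype M] [DecidableEq M] (P : Pipeline M)

/-- The contents of all sites. -/
abbrev Conf := Fin P.m → Fin (P.n + 1)

/-- Write `y` into site `j`; nothing happens if there is no such site, so that tokens leave the
pipeline behind its last site. -/
def put (j : ℕ) (y : Fin (P.n + 1)) (ω : P.Conf) : P.Conf :=
  if h : j < P.m then Function.update ω ⟨j, h⟩ y else ω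

/-- The Kraus operators of the entry of a token (`none`) and of its transfer from a site. -/
def kraus : Option (Fin P.m) → P.Conf → Fin (P.n + 1) → Matrix M M ℂ
  | none, _, y => P.K 0 P.root y
  | some j, ω, y => P.K (j + 1) (ω j) y

/-- The configuration after the entry of a token (`none`) or its transfer from a site. -/
def next : Option (Fin P.m) → P.Conf → Fin (P.n + 1) → P.Conf
  | none, ω, y => P.put 0 y ω
  | some j, ω, y => if ω j = 0 ∧ P.ow j = false then ω
      else P.put (j + 1) y (Function.update ω j 0)

/-- Tokens enter at the rate `δ` and are transferred from site `j` at the rate `lam j`. -/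
def rates (δ : ℝ) (lam : ℕ → ℝ) : Option (Fin P.m) → ℝ
  | none => δ
  | some j => lam j

/-- The generator of the pipeline dynamics. -/
def gen (γ : ℝ) (𝔏 : SuperOp M M) (δ : ℝ) (lam : ℕ → ℝ) :
    (P.Conf → Matrix M M ℂ) →ₗ[ℂ] (P.Conf → Matrix M M ℂ) :=
  hybridGen γ 𝔏 (P.rates δ lam) P.kraus P.next

theorem sum_kraus (i : Option (Fin P.m)) (ω : P.Conf) :
    ∑ y, (P.kraus i ω y)ᴴ * P.kraus i ω y = 1 := by
  cases i <;> exact P.sum_K _ _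

/-- A run of the pipeline in the regime of interest: entries are slow compared with the transfers,
and a site that can be erased is emptied much faster than it is erased. -/
structure Run (γ δ Γ : ℝ) (lam : ℕ → ℝ) (𝔏 : SuperOp M M) (B : ℝ → P.Conf → Matrix M M ℂ) :
    Prop where
  γ_nonneg : 0 ≤ γ
  δ_pos : 0 < δ
  small : γ + δ ≤ Γ
  le_lam : ∀ j, Γ ≤ lam j
  lam_le : ∀ j, lam j ≤ Γ ^ 2 / δ
  lam_ow : ∀ j, P.ow j = true → lam j ≤ δ / Γ * lam (j + 1)
  lindblad : IsLindblad 𝔏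
  bounded : ∀ X : Matrix M M ℂ, X.PosSemidef → ∀ v, |qf v (𝔏 X)| ≤ rtr X * nsq v
  evol : IsHybridEvolution (P.gen γ 𝔏 δ lam) B
  init_pos : ∀ ω, (B 0 ω).PosSemidef
  init_trace : ∑ ω, rtr (B 0 ω) = 1

variable {P} {γ δ Γ : ℝ} {lam : ℕ → ℝ} {𝔏 : SuperOp M M} {B : ℝ → P.Conf → Matrix M M ℂ}

namespace Run

variable (R : P.Run γ δ Γ lam 𝔏 B)
include R

theorem Γ_pos : 0 < Γ := by linarith [R.small, R.γ_nonneg, R.δ_pos]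

theorem lam_pos (j : ℕ) : 0 < lam j := R.Γ_pos.trans_le (R.le_lam j)

theorem rates_nonneg (i : Option (Fin P.m)) : 0 ≤ P.rates δ lam i := by
  cases i
  · exact R.δ_pos.le
  · exact (R.lam_pos _).le

theorem pos {t : ℝ} (ht : 0 ≤ t) (ω : P.Conf) : (B t ω).PosSemidef :=
  IsHybridEvolution.posSemidef R.evol R.γ_nonneg R.lindblad R.rates_nonneg R.init_pos ht ω

theorem hasDerivWithinAt_expectation (φ : P.Conf → ℝ) {t : ℝ} (ht : 0 ≤ t) :
    HasDerivWithinAt (fun s => ∑ ω, φ ω * rtr (B s ω))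
      (∑ i, P.rates δ lam i * ∑ ω, ∑ y, (φ (P.next i ω y) - φ ω) *
        rtr (P.kraus i ω y * B t ω * (P.kraus i ω y)ᴴ)) (Set.Ici 0) t := by
  rw [← sum_mul_rtr_hybridGen (γ := γ) R.lindblad P.sum_kraus]
  exact HasDerivWithinAt.fun_sum fun ω _ =>
    (hasDerivWithinAt_map_of_entries rtr (R.evol t ht ω)).const_mul _

theorem sum_rtr {t : ℝ} (ht : 0 ≤ t) : ∑ ω, rtr (B t ω) = 1 := by
  have hd : ∀ s, 0 ≤ s → HasDerivWithinAt (fun s => ∑ ω, rtr (B s ω)) 0 (Set.Ici 0) s :=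
    fun s hs => by simpa using R.hasDerivWithinAt_expectation (fun _ => 1) hs
  have h1 := le_add_exp_of_deriv_le (u' := fun _ => 0) (lam := 0) (c := 1) (U := 0) le_rfl ht hd
    (by simp) (by rw [R.init_trace]; simp)
  have h2 := ge_sub_exp_of_le_deriv (u' := fun _ => 0) (lam := 0) (c := 1) (U := 0) le_rfl ht hd
    (by simp) (by rw [R.init_trace]; simp)
  linarith

theorem weight_nonneg {t : ℝ} (ht : 0 ≤ t) (i : Option (Fin P.m)) (ω : P.Conf)
    (y : Fin (P.n + 1)) : 0 ≤ rtr (P.kraus i ω y * B t ω * (P.kraus i ω y)ᴴ) :=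
  rtr_nonneg ((R.pos ht ω).mul_mul_conjTranspose_same _)

end Run

theorem put_apply_of_ne {j : ℕ} {y : Fin (P.n + 1)} {ω : P.Conf} {i : Fin P.m} (h : (i : ℕ) ≠ j) :
    P.put j y ω i = ω i := by
  unfold put
  split_ifs with hj
  · exact Function.update_of_ne (fun hi => h (by rw [hi])) _ _
  · rfl

theorem next_some_of_stay {j : Fin P.m} {ω : P.Conf} {y : Fin (P.n + 1)}
    (h : ω j = 0 ∧ P.ow j = false) : P.next (some j) ω y = ω := if_pos h

theorem next_some_of_move {j : Fin P.m} {ω : P.Conf} {y : Fin (P.n + 1)}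
    (h : ¬ (ω j = 0 ∧ P.ow j = false)) :
    P.next (some j) ω y = P.put (j + 1) y (Function.update ω j 0) := if_neg h

theorem put_apply_self {j : Fin P.m} {y : Fin (P.n + 1)} {ω : P.Conf} :
    P.put j y ω j = y := by
  simp [put]

theorem put_apply_mk {j : ℕ} (hj : j < P.m) {y : Fin (P.n + 1)} {ω : P.Conf} :
    P.put j y ω ⟨j, hj⟩ = y := by
  rw [put, dif_pos hj]
  exact Function.update_self _ _ _

variable (P) in
/-- The probability that site `j` holds a token. -/
def occ (B : P.Conf → Matrix M M ℂ) (j : Fin P.m) : ℝ :=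
  ∑ ω, (if ω j = 0 then 0 else 1) * rtr (B ω)

theorem weight_eq_zero {j : Fin P.m} {ω : P.Conf} {y : Fin (P.n + 1)} (hω : ω j = 0) (hy : y ≠ 0)
    (X : Matrix M M ℂ) : rtr (P.kraus (some j) ω y * X * (P.kraus (some j) ω y)ᴴ) = 0 := by
  simp [kraus, hω, P.K_zero _ _ hy]

namespace Run

variable (R : P.Run γ δ Γ lam 𝔏 B)
include R

theorem occ_nonneg {t : ℝ} (ht : 0 ≤ t) (j : Fin P.m) : 0 ≤ P.occ (B t) j :=
  Finset.sum_nonneg fun ω _ => mul_nonneg (by split_ifs <;> simp) (rtr_nonneg (R.pos ht ω))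

theorem occ_le_one {t : ℝ} (ht : 0 ≤ t) (j : Fin P.m) : P.occ (B t) j ≤ 1 := by
  rw [← R.sum_rtr ht]
  refine Finset.sum_le_sum fun ω _ => ?_
  have := rtr_nonneg (R.pos ht ω)
  split_ifs <;> simp [this]

/-- If the pointwise gain of `φ` under an instrument is at most `g`, its mean gain is at most the
mean of `g`. -/
theorem sum_gain_le {t : ℝ} (ht : 0 ≤ t) (i : Option (Fin P.m)) (G : P.Conf → Fin (P.n + 1) → ℝ)
    (g : P.Conf → ℝ)
    (h : ∀ ω y, rtr (P.kraus i ω y * B t ω * (P.kraus i ω y)ᴴ) ≠ 0 → G ω y ≤ g ω) :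
    ∑ ω, ∑ y, G ω y * rtr (P.kraus i ω y * B t ω * (P.kraus i ω y)ᴴ)
      ≤ ∑ ω, g ω * rtr (B t ω) := by
  refine Finset.sum_le_sum fun ω _ => ?_
  rw [← sum_rtr_conj (P.sum_kraus i ω) (B t ω), Finset.mul_sum]
  refine Finset.sum_le_sum fun y _ => ?_
  by_cases h0 : rtr (P.kraus i ω y * B t ω * (P.kraus i ω y)ᴴ) = 0
  · simp [h0]
  · exact mul_le_mul_of_nonneg_right (h ω y h0) (R.weight_nonneg ht i ω y)

/-- The occupation of a site grows at most by the inflow from the preceding site. -/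
theorem occ_deriv_le {t : ℝ} (ht : 0 ≤ t) (j : Fin P.m) :
    ∑ i, P.rates δ lam i * ∑ ω, ∑ y,
      ((if P.next i ω y j = 0 then 0 else 1) - (if ω j = 0 then 0 else 1)) *
        rtr (P.kraus i ω y * B t ω * (P.kraus i ω y)ᴴ)
      ≤ (if (j : ℕ) = 0 then δ else 0)
        + ∑ i : Fin P.m, (if (i : ℕ) + 1 = j then lam i * P.occ (B t) i else 0)
        - lam j * P.occ (B t) j := by
  have hnone : ∑ ω, ∑ y, ((if P.next none ω y j = 0 then 0 else 1) - (if ω j = 0 then 0 else 1)) *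
        rtr (P.kraus none ω y * B t ω * (P.kraus none ω y)ᴴ) ≤ if (j : ℕ) = 0 then 1 else 0 := by
    refine (R.sum_gain_le ht none _ (fun _ => if (j : ℕ) = 0 then 1 else 0) ?_).trans ?_
    · intro ω y _
      by_cases hj : (j : ℕ) = 0
      · rw [if_pos hj]; split_ifs <;> norm_num
      · rw [if_neg hj, next, put_apply_of_ne hj, sub_self]
    · rw [← Finset.mul_sum, R.sum_rtr ht, mul_one]
  have hsome : ∀ i : Fin P.m,
      ∑ ω, ∑ y, ((if P.next (some i) ω y j = 0 then 0 else 1) - (if ω j = 0 then 0 else 1)) *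
        rtr (P.kraus (some i) ω y * B t ω * (P.kraus (some i) ω y)ᴴ)
      ≤ (if (i : ℕ) + 1 = j then P.occ (B t) i else 0)
        - (if i = j then P.occ (B t) j else 0) := by
    intro i
    refine (R.sum_gain_le ht (some i) _ (fun ω =>
      (if (i : ℕ) + 1 = j then (if ω i = 0 then 0 else 1) else 0)
        - (if i = j then (if ω j = 0 then 0 else 1) else 0)) ?_).trans (le_of_eq ?_)
    · intro ω y hne
      have hy : ω i = 0 → y = 0 := fun h => by
        by_contra h'
        exact hne (weight_eq_zero h h' _)
      by_cases hij : i = j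
      · subst hij
        have h1 : ¬ ((i : ℕ) + 1 = i) := by omega
        rw [if_neg h1, if_pos rfl]
        by_cases hc : ω i = 0 ∧ P.ow i = false
        · rw [next_some_of_stay hc]; simp [hc.1]
        · rw [next_some_of_move hc, put_apply_of_ne (by omega)]; simp
      · rw [if_neg hij, sub_zero]
        by_cases h1 : (i : ℕ) + 1 = j
        · rw [if_pos h1]
          by_cases hc : ω i = 0 ∧ P.ow i = false
          · rw [next_some_of_stay hc]; simp [hc.1]
          · rw [next_some_of_move hc, h1, put_apply_self]
            by_cases h0 : ω i = 0
            · rw [hy h0, if_pos rfl, if_pos h0]; split_ifs <;> norm_num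
            · rw [if_neg h0]; split_ifs <;> norm_num
        · rw [if_neg h1]
          by_cases hc : ω i = 0 ∧ P.ow i = false
          · rw [next_some_of_stay hc]; simp
          · rw [next_some_of_move hc, put_apply_of_ne (Ne.symm h1),
              Function.update_of_ne (Ne.symm hij)]
            simp
    · simp only [sub_mul, Finset.sum_sub_distrib, occ]
      congr 1 <;> split_ifs <;> simp
  rw [Fintype.sum_option]
  have h1 := mul_le_mul_of_nonneg_left hnone R.δ_pos.le
  have h2 : ∑ i : Fin P.m, lam i * ∑ ω, ∑ y,
      ((if P.next (some i) ω y j = 0 then 0 else 1) - (if ω j = 0 then 0 else 1)) *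
        rtr (P.kraus (some i) ω y * B t ω * (P.kraus (some i) ω y)ᴴ)
      ≤ ∑ i : Fin P.m, lam i * ((if (i : ℕ) + 1 = j then P.occ (B t) i else 0)
        - (if i = j then P.occ (B t) j else 0)) :=
    Finset.sum_le_sum fun i _ => mul_le_mul_of_nonneg_left (hsome i) (R.lam_pos i).le
  have h3 : ∑ i : Fin P.m, lam i * ((if (i : ℕ) + 1 = j then P.occ (B t) i else 0)
        - (if i = j then P.occ (B t) j else 0))
      = ∑ i : Fin P.m, (if (i : ℕ) + 1 = j then lam i * P.occ (B t) i else 0)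
        - lam j * P.occ (B t) j := by
    simp [mul_sub, Finset.sum_sub_distrib]
  have h4 : δ * (if (j : ℕ) = 0 then 1 else 0) = if (j : ℕ) = 0 then δ else 0 := by simp
  simp only [rates]
  linarith

/-- After the time `(j + 1) / δ`, site `j` is occupied with probability at most about
`δ / lam j`. -/
theorem lam_mul_occ_le_aux : ∀ (j : ℕ) (hj : j < P.m) {t : ℝ}, (j + 1 : ℝ) / δ ≤ t →
    lam j * P.occ (B t) ⟨j, hj⟩ ≤ δ * (1 + 6 * (j + 1) * ((γ + δ) / Γ)) := by
  have hδ := R.δ_pos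
  have hΓ := R.Γ_pos
  have hγ := R.γ_nonneg
  -- one relaxation time `1 / δ` of a site reduces any initial excess to relative size `O(δ / Γ)`
  have step : ∀ (j : ℕ) (hj : j < P.m) (c t₀ : ℝ), 0 ≤ t₀ → 0 ≤ c →
      (∀ s, t₀ ≤ s → (if j = 0 then δ else 0)
        + ∑ i : Fin P.m, (if (i : ℕ) + 1 = j then lam i * P.occ (B s) i else 0) ≤ c) →
      ∀ t, t₀ + 1 / δ ≤ t →
        lam j * P.occ (B t) ⟨j, hj⟩ ≤ c + δ * (6 * ((γ + δ) / Γ)) := by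
    intro j hj c t₀ ht₀ hc hin t ht
    have hl := R.lam_pos j
    have htt : t₀ ≤ t := le_trans (by simp [hδ.le]) ht
    have h1 := le_add_exp_of_deriv_le (u := fun s => P.occ (B s) ⟨j, hj⟩) (lam := lam j)
      (c := c / lam j) (U := 1) ht₀ htt
      (fun s hs => R.hasDerivWithinAt_expectation (fun ω => if ω ⟨j, hj⟩ = 0 then 0 else 1) hs)
      (fun s hs => by
        refine (R.occ_deriv_le (ht₀.trans hs) ⟨j, hj⟩).trans ?_
        rw [mul_sub, mul_div_cancel₀ _ hl.ne']
        have := hin s hs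
        simp only at this ⊢
        linarith)
      ((R.occ_le_one ht₀ _).trans (by have := div_nonneg hc hl.le; linarith))
    have h2 : lam j * P.occ (B t) ⟨j, hj⟩ ≤ c + lam j * Real.exp (-(lam j * (t - t₀))) := by
      have := mul_le_mul_of_nonneg_left h1 hl.le
      rwa [one_mul, mul_add, mul_div_cancel₀ _ hl.ne'] at this
    refine h2.trans (add_le_add le_rfl ?_)
    have hx : 0 < Γ / δ := div_pos hΓ hδ
    have h3 : Real.exp (-(lam j * (t - t₀))) ≤ Real.exp (-(Γ / δ)) := by
      refine Real.exp_le_exp.2 (neg_le_neg ?_)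
      have h4 : 1 / δ ≤ t - t₀ := by linarith
      calc Γ / δ = Γ * (1 / δ) := by ring
        _ ≤ lam j * (t - t₀) := by
          have := R.le_lam j
          gcongr
    calc lam j * Real.exp (-(lam j * (t - t₀)))
        ≤ (Γ ^ 2 / δ) * Real.exp (-(Γ / δ)) := by
          have := R.lam_le j
          gcongr
      _ = δ * ((Γ / δ) ^ 2 * Real.exp (-(Γ / δ))) := by field_simp
      _ ≤ δ * (6 / (Γ / δ)) := by gcongr; exact sq_mul_exp_neg_le hx
      _ = δ * (6 * (δ / Γ)) := by field_simp
      _ ≤ _ := by gcongr; linarith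
  intro j
  induction j with
  | zero =>
    intro hj t ht
    have := step 0 hj δ 0 le_rfl hδ.le (fun s _ => by simp) t (by simpa using ht)
    simp only [Nat.cast_zero, zero_add, mul_one] at this ⊢
    linarith
  | succ j ih =>
    intro hj t ht
    have hα : 0 ≤ (γ + δ) / Γ := by positivity
    have := step (j + 1) hj (δ * (1 + 6 * (j + 1) * ((γ + δ) / Γ))) ((j + 1 : ℝ) / δ)
      (by positivity) (by positivity) (fun s hs => by
        rw [if_neg (by omega), zero_add, Finset.sum_eq_single ⟨j, by omega⟩]
        · simpa using ih (by omega) hs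
        · intro i _ hi
          rw [if_neg]
          intro h
          exact hi (Fin.ext (by simpa using h))
        · simp) t (by rw [← add_div]; convert ht using 2; push_cast; ring)
    push_cast
    linarith

end Run
end Pipeline

/-- Since all gains of a configuration are positive, those along any given transitions into it bound
the total gain from below. -/
theorem qf_push_ge_sum {Ω Y M Z : Type*} [Fintype Ω] [Fintype Y] [Fintype M] [DecidableEq Ω]
    [Fintype Z] (K : Ω → Y → Matrix M M ℂ) (f : Ω → Y → Ω) {B : Ω → Matrix M M ℂ}
    (hB : ∀ ω, (B ω).PosSemidef) {ω' : Ω} (g : Z → Ω) (hg : Function.Injective g) (u : Z → Y)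
    (h : ∀ z, f (g z) (u z) = ω') (v : M → ℂ) :
    ∑ z, qf ((K (g z) (u z))ᴴ *ᵥ v) (B (g z)) ≤ qf v (push K f B ω') := by
  classical
  rw [qf_push]
  set G : Ω → ℝ := fun ω => ∑ y, if f ω y = ω' then qf ((K ω y)ᴴ *ᵥ v) (B ω) else 0 with hG
  have hnn : ∀ ω y, 0 ≤ if f ω y = ω' then qf ((K ω y)ᴴ *ᵥ v) (B ω) else 0 := fun ω y => by
    split_ifs
    · exact qf_nonneg (hB ω) _
    · exact le_rfl
  calc ∑ z, qf ((K (g z) (u z))ᴴ *ᵥ v) (B (g z)) ≤ ∑ z, G (g z) := by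
        refine Finset.sum_le_sum fun z _ => ?_
        have := Finset.single_le_sum (fun y _ => hnn (g z) y) (Finset.mem_univ (u z))
        simpa only [if_pos (h z)] using this
    _ = ∑ ω ∈ Finset.univ.map ⟨g, hg⟩, G ω := by rw [Finset.sum_map]; rfl
    _ ≤ ∑ ω, G ω := Finset.sum_le_univ_sum_of_nonneg fun ω => Finset.sum_nonneg fun y _ => hnn ω y

namespace Pipeline

variable {M : Type*} [Fintype M] [DecidableEq M] (P : Pipeline M)

/-! ### The map implemented by a pipeline -/

/-- The operation accumulated by a token that arrives as `y` at site `j`. -/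
def path : ℕ → Fin (P.n + 1) → SuperOp M M
  | 0, y => conjBy (P.K 0 P.root y)
  | j + 1, y => ∑ x, conjBy (P.K (j + 1) x y) ∘ₗ path j x

/-- The map implemented by the tokens that have travelled through all sites. -/
def protocol : SuperOp M M := ∑ y, P.path P.m y

theorem path_zero_apply (y : Fin (P.n + 1)) (X : Matrix M M ℂ) :
    P.path 0 y X = P.K 0 P.root y * X * (P.K 0 P.root y)ᴴ := rfl

theorem path_succ_apply (j : ℕ) (y : Fin (P.n + 1)) (X : Matrix M M ℂ) :
    P.path (j + 1) y X = ∑ x, P.K (j + 1) x y * P.path j x X * (P.K (j + 1) x y)ᴴ := by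
  simp [path, conjBy]

theorem protocol_apply (X : Matrix M M ℂ) : P.protocol X = ∑ y, P.path P.m y X := by
  simp [protocol]

theorem path_empty (j : ℕ) (X : Matrix M M ℂ) : P.path j 0 X = 0 := by
  induction j with
  | zero => rw [path_zero_apply, P.K_empty 0 _ P.root_ne]; simp
  | succ j ih =>
    rw [path_succ_apply]
    refine Finset.sum_eq_zero fun x _ => ?_
    by_cases hx : x = 0
    · rw [hx, ih]; simp
    · rw [P.K_empty _ _ hx]; simp

theorem path_posSemidef (j : ℕ) (y : Fin (P.n + 1)) {X : Matrix M M ℂ} (hX : X.PosSemidef) :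
    (P.path j y X).PosSemidef := by
  induction j generalizing y with
  | zero => exact hX.mul_mul_conjTranspose_same _
  | succ j ih =>
    rw [path_succ_apply]
    exact Matrix.posSemidef_sum _ fun x _ => (ih x).mul_mul_conjTranspose_same _

theorem sum_rtr_path (j : ℕ) (X : Matrix M M ℂ) : ∑ y, rtr (P.path j y X) = rtr X := by
  induction j with
  | zero => exact sum_rtr_conj (P.sum_K 0 P.root) X
  | succ j ih =>
    simp only [path_succ_apply, map_sum]
    rw [Finset.sum_comm, ← ih]
    exact Finset.sum_congr rfl fun x _ => sum_rtr_conj (P.sum_K _ x) _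

theorem nsq_K_le (l : ℕ) (x y : Fin (P.n + 1)) (v : M → ℂ) :
    nsq ((P.K l x y)ᴴ *ᵥ v) ≤ Fintype.card M * nsq v := by
  refine (nsq_mulVec_le _ _).trans (mul_le_mul_of_nonneg_right ?_ (nsq_nonneg v))
  rw [hsq_conjTranspose, ← rtr_conjTranspose_mul_self, ← rtr_one, ← P.sum_K l x, map_sum]
  exact Finset.single_le_sum (f := fun y => rtr ((P.K l x y)ᴴ * P.K l x y))
    (fun y _ => rtr_nonneg (Matrix.posSemidef_conjTranspose_mul_self _)) (Finset.mem_univ y)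

/-- The factor by which one round of Kraus operators may increase bounds on quadratic forms. -/
def growth : ℝ := (P.n + 1) * Fintype.card M

theorem growth_nonneg : 0 ≤ P.growth := by unfold growth; positivity

theorem sum_K_qf_ge (l : ℕ) (y : Fin (P.n + 1)) {β : ℝ} (hβ : 0 ≤ β)
    {q : Fin (P.n + 1) → (M → ℂ) → ℝ} (h : ∀ x v, -(β * nsq v) ≤ q x v) (v : M → ℂ) :
    -(P.growth * β * nsq v) ≤ ∑ x, q x ((P.K l x y)ᴴ *ᵥ v) := by
  have : ∀ x, -(β * (Fintype.card M * nsq v)) ≤ q x ((P.K l x y)ᴴ *ᵥ v) := fun x =>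
    le_trans (neg_le_neg (mul_le_mul_of_nonneg_left (P.nsq_K_le l x y v) hβ)) (h x _)
  refine le_trans (le_of_eq ?_) (Finset.sum_le_sum fun x (_ : x ∈ Finset.univ) => this x)
  simp [growth]
  ring

theorem sum_K_abs_qf_le (l : ℕ) (y : Fin (P.n + 1)) {β : ℝ} (hβ : 0 ≤ β)
    {X : Fin (P.n + 1) → Matrix M M ℂ} (h : ∀ x v, |qf v (X x)| ≤ β * nsq v) (v : M → ℂ) :
    |qf v (∑ x, P.K l x y * X x * (P.K l x y)ᴴ)| ≤ P.growth * β * nsq v := by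
  rw [map_sum, Finset.sum_congr rfl fun x _ => qf_conj v (P.K l x y) (X x), abs_le]
  constructor
  · exact P.sum_K_qf_ge l y hβ (fun x v => neg_le_of_abs_le (h x v)) v
  · have := P.sum_K_qf_ge l y hβ (q := fun x v => -qf v (X x))
      (fun x v => neg_le_neg (le_of_abs_le (h x v))) v
    rw [Finset.sum_neg_distrib] at this
    linarith

theorem abs_qf_path_le (j : ℕ) (y : Fin (P.n + 1)) {β : ℝ} (hβ : 0 ≤ β) {X : Matrix M M ℂ}
    (h : ∀ v, |qf v X| ≤ β * nsq v) (v : M → ℂ) :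
    |qf v (P.path j y X)| ≤ P.growth ^ (j + 1) * β * nsq v := by
  induction j generalizing y v with
  | zero =>
    rw [path_zero_apply, qf_conj, zero_add, pow_one]
    refine (h _).trans ?_
    have h1 := mul_le_mul_of_nonneg_left (P.nsq_K_le 0 P.root y v) hβ
    have h2 : (0 : ℝ) ≤ P.n * (Fintype.card M * (β * nsq v)) := by
      have := nsq_nonneg v
      positivity
    unfold growth
    linarith
  | succ j ih =>
    rw [path_succ_apply]
    have := P.sum_K_abs_qf_le (j + 1) y (mul_nonneg (pow_nonneg P.growth_nonneg (j + 1)) hβ)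
      (X := fun x => P.path j x X) (fun x v => ih x v) v
    rw [pow_succ']
    linarith

/-! ### Returns to the idle configuration -/

/-- The rate, in units of `δ`, at which tokens that disappear leave the pipeline empty, as a map on
the unnormalised states of the configurations. -/
def ret (δ : ℝ) (lam : ℕ → ℝ) : (P.Conf → Matrix M M ℂ) →ₗ[ℂ] Matrix M M ℂ :=
  ∑ j : Fin P.m, ((lam j / δ : ℝ) : ℂ) • ∑ ω, ∑ y,
    if ω ≠ 0 ∧ P.next (some j) ω y = 0 then conjBy (P.kraus (some j) ω y) ∘ₗ LinearMap.proj ω else 0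

theorem ret_apply (δ : ℝ) (lam : ℕ → ℝ) (B : P.Conf → Matrix M M ℂ) :
    P.ret δ lam B = ∑ j : Fin P.m, ((lam j / δ : ℝ) : ℂ) • ∑ ω, ∑ y,
      if ω ≠ 0 ∧ P.next (some j) ω y = 0
        then P.kraus (some j) ω y * B ω * (P.kraus (some j) ω y)ᴴ else 0 := by
  simp only [ret, LinearMap.sum_apply, LinearMap.smul_apply]
  refine Finset.sum_congr rfl fun j _ => ?_
  congr 1
  refine Finset.sum_congr rfl fun ω _ => Finset.sum_congr rfl fun y _ => ?_
  split_ifs <;> rfl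

variable {P} {γ δ Γ : ℝ} {lam : ℕ → ℝ} {𝔏 : SuperOp M M}

theorem put_empty_of_apply_eq_zero {j : ℕ} {ω : P.Conf} (h : ∀ hj : j < P.m, ω ⟨j, hj⟩ = 0) :
    P.put j 0 ω = ω := by
  unfold put
  split_ifs with hj
  · rw [← h hj, Function.update_eq_self]
  · rfl

/-- Transfers from an empty site do nothing if the following site is empty as well. -/
theorem next_some_empty {j : Fin P.m} {ω : P.Conf} (h0 : ω j = 0)
    (h1 : ∀ hj : (j : ℕ) + 1 < P.m, ω ⟨j + 1, hj⟩ = 0) : P.next (some j) ω 0 = ω := by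
  by_cases h : ω j = 0 ∧ P.ow j = false
  · exact next_some_of_stay h
  · have : Function.update ω j 0 = ω := by rw [← h0, Function.update_eq_self]
    rw [next_some_of_move h, this, put_empty_of_apply_eq_zero h1]

/-- The empty configuration is left at the rate `δ`, and otherwise only gains from returns. -/
theorem gen_zero (hm : 0 < P.m) (hδ : 0 < δ) (B : P.Conf → Matrix M M ℂ) :
    P.gen γ 𝔏 δ lam B 0 = (γ : ℂ) • 𝔏 (B 0) + (δ : ℂ) • (P.ret δ lam B - B 0) := by
  have hnone : push (P.kraus none) (P.next none) B 0 = 0 := by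
    rw [push_apply]
    refine Finset.sum_eq_zero fun ω _ => Finset.sum_eq_zero fun y _ => ?_
    split_ifs with h
    · have hy : y = 0 := by
        have := congrFun h ⟨0, hm⟩
        rwa [next, put_apply_mk hm] at this
      rw [hy, kraus, P.K_empty 0 _ P.root_ne]; simp
    · rfl
  have hsome : ∀ j : Fin P.m, push (P.kraus (some j)) (P.next (some j)) B 0 - B 0
      = ∑ ω, ∑ y, if ω ≠ 0 ∧ P.next (some j) ω y = 0
        then P.kraus (some j) ω y * B ω * (P.kraus (some j) ω y)ᴴ else 0 := by
    intro j
    have h0 : ∑ y, (if P.next (some j) 0 y = 0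
        then P.kraus (some j) 0 y * B 0 * (P.kraus (some j) 0 y)ᴴ else 0) = B 0 := by
      rw [Finset.sum_eq_single 0]
      · rw [if_pos (next_some_empty rfl fun _ => rfl), kraus, Pi.zero_apply, P.K_zero_zero]; simp
      · intro y _ hy
        rw [kraus, Pi.zero_apply, P.K_zero _ _ hy]; simp
      · simp
    rw [push_apply, ← Finset.add_sum_erase _ _ (Finset.mem_univ (0 : P.Conf)), h0,
      add_sub_cancel_left,
      ← Finset.add_sum_erase (a := (0 : P.Conf)) Finset.univ
        (fun ω => ∑ y, if ω ≠ 0 ∧ P.next (some j) ω y = 0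
        then P.kraus (some j) ω y * B ω * (P.kraus (some j) ω y)ᴴ else 0) (Finset.mem_univ _)]
    simp only [ne_eq, not_true_eq_false, false_and, if_false, Finset.sum_const_zero, zero_add]
    refine Finset.sum_congr rfl fun ω hω => Finset.sum_congr rfl fun y _ => ?_
    simp [Finset.ne_of_mem_erase hω]
  rw [gen, hybridGen_apply, Fintype.sum_option, hnone]
  simp only [hsome, rates]
  rw [ret_apply, smul_sub, smul_sub, smul_zero, zero_sub, Finset.smul_sum]
  have : ∀ j : Fin P.m, (δ : ℂ) * ((lam j / δ : ℝ) : ℂ) = (lam j : ℂ) := fun j => by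
    rw [← Complex.ofReal_mul, mul_div_cancel₀ _ hδ.ne']
  simp only [smul_smul, this]
  abel

variable {B : ℝ → P.Conf → Matrix M M ℂ}

namespace Run

variable (R : P.Run γ δ Γ lam 𝔏 B)
include R

theorem ratio_nonneg : 0 ≤ (γ + δ) / Γ :=
  div_nonneg (add_nonneg R.γ_nonneg R.δ_pos.le) R.Γ_pos.le

theorem ratio_le_one : (γ + δ) / Γ ≤ 1 := (div_le_one R.Γ_pos).2 R.small

theorem δ_div_le : δ / Γ ≤ (γ + δ) / Γ := by
  have := R.Γ_pos
  have := R.γ_nonneg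
  gcongr
  linarith

/-- The flow of tokens through a site is at most the rate of entries, up to `O(α)`. -/
theorem lam_mul_occ_le {t : ℝ} (ht : (P.m : ℝ) / δ ≤ t) (j : Fin P.m) :
    lam j * P.occ (B t) j ≤ δ * (1 + 6 * P.m * ((γ + δ) / Γ)) := by
  have hδ := R.δ_pos
  have hα := R.ratio_nonneg
  have hj : (j : ℝ) + 1 ≤ P.m := by exact_mod_cast j.2
  refine (R.lam_mul_occ_le_aux j j.2 (le_trans ?_ ht)).trans ?_
  · gcongr
  · gcongr

theorem lam_mul_occ_le' {t : ℝ} (ht : (P.m : ℝ) / δ ≤ t) (j : Fin P.m) :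
    lam j * P.occ (B t) j ≤ δ * (1 + 6 * P.m) := by
  have hδ := R.δ_pos
  refine (R.lam_mul_occ_le ht j).trans ?_
  exact mul_le_mul_of_nonneg_left
    (add_le_add le_rfl (mul_le_of_le_one_right (by positivity) R.ratio_le_one)) hδ.le

theorem nonneg_of_le {t : ℝ} (ht : (P.m : ℝ) / δ ≤ t) : 0 ≤ t :=
  le_trans (div_nonneg (Nat.cast_nonneg _) R.δ_pos.le) ht

/-- Some site is occupied only with a probability `O(α)`, where `α = (γ + δ) / Γ`. -/
theorem one_sub_rtr_idle_le {t : ℝ} (ht : (P.m : ℝ) / δ ≤ t) :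
    1 - rtr (B t 0) ≤ P.m * (1 + 6 * P.m) * ((γ + δ) / Γ) := by
  have ht0 := R.nonneg_of_le ht
  have h1 : 1 - rtr (B t 0) ≤ ∑ j, P.occ (B t) j := by
    rw [← R.sum_rtr ht0, ← Finset.add_sum_erase _ _ (Finset.mem_univ (0 : P.Conf)),
      add_sub_cancel_left]
    simp only [occ]
    rw [Finset.sum_comm]
    refine (Finset.sum_le_sum fun ω hω => ?_).trans (Finset.sum_le_univ_sum_of_nonneg fun ω => ?_)
    · have hne := Finset.ne_of_mem_erase hω
      obtain ⟨j, hj⟩ := Function.ne_iff.1 hne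
      have hp := rtr_nonneg (R.pos ht0 ω)
      have := Finset.single_le_sum (f := fun j => (if ω j = 0 then 0 else 1) * rtr (B t ω))
        (fun j _ => mul_nonneg (by split_ifs <;> simp) hp) (Finset.mem_univ j)
      simpa [show ω j ≠ 0 from hj] using this
    · exact Finset.sum_nonneg fun j _ =>
        mul_nonneg (by split_ifs <;> simp) (rtr_nonneg (R.pos ht0 ω))
  refine h1.trans ((Finset.sum_le_sum (g := fun _ => (1 + 6 * P.m) * ((γ + δ) / Γ))
    fun j _ => ?_).trans (le_of_eq ?_))
  · have hΓ := R.Γ_pos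
    have h2 : Γ * P.occ (B t) j ≤ δ * (1 + 6 * P.m) :=
      (mul_le_mul_of_nonneg_right (R.le_lam j) (R.occ_nonneg ht0 j)).trans (R.lam_mul_occ_le' ht j)
    calc P.occ (B t) j ≤ δ / Γ * (1 + 6 * P.m) := by
          rw [div_mul_eq_mul_div, le_div_iff₀ hΓ]; linarith
      _ ≤ (γ + δ) / Γ * (1 + 6 * P.m) :=
          mul_le_mul_of_nonneg_right R.δ_div_le (by positivity)
      _ = _ := mul_comm _ _
  · simp; ring

theorem rtr_idle_le_one {t : ℝ} (ht : 0 ≤ t) : rtr (B t 0) ≤ 1 := by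
  rw [← R.sum_rtr ht]
  exact Finset.single_le_sum (f := fun ω => rtr (B t ω)) (fun ω _ => rtr_nonneg (R.pos ht ω))
    (Finset.mem_univ _)

theorem ret_posSemidef {t : ℝ} (ht : 0 ≤ t) : (P.ret δ lam (B t)).PosSemidef := by
  rw [ret_apply]
  refine Matrix.posSemidef_sum _ fun j _ => Matrix.PosSemidef.smul
    (Matrix.posSemidef_sum _ fun ω _ => Matrix.posSemidef_sum _ fun y _ => ?_) ?_
  · split_ifs
    · exact (R.pos ht ω).mul_mul_conjTranspose_same _
    · exact Matrix.PosSemidef.zero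
  · have := div_nonneg (R.lam_pos j).le R.δ_pos.le
    exact_mod_cast this

/-- The total rate of returns is at most `δ` up to a relative error `O(α)`. -/
theorem rtr_ret_le {t : ℝ} (ht : (P.m : ℝ) / δ ≤ t) :
    rtr (P.ret δ lam (B t)) ≤ 1 + (6 * P.m + P.m * (1 + 6 * P.m)) * ((γ + δ) / Γ) := by
  have ht0 := R.nonneg_of_le ht
  have hδ := R.δ_pos
  have hΓ := R.Γ_pos
  have hα := R.ratio_nonneg
  have hocc : ∀ j : Fin P.m, lam j * ∑ ω, ∑ y, (if ω ≠ 0 ∧ P.next (some j) ω y = 0 then 1 else 0)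
        * rtr (P.kraus (some j) ω y * B t ω * (P.kraus (some j) ω y)ᴴ)
      ≤ δ * ((if (j : ℕ) + 1 = P.m then 1 + 6 * P.m * ((γ + δ) / Γ) else 0)
        + (1 + 6 * P.m) * ((γ + δ) / Γ)) := by
    intro j
    by_cases hj : (j : ℕ) + 1 = P.m
    · rw [if_pos hj]
      have h1 := R.sum_gain_le ht0 (some j)
        (fun ω y => if ω ≠ 0 ∧ P.next (some j) ω y = 0 then 1 else 0)
        (fun ω => if ω j = 0 then 0 else 1) (fun ω y _ => by
          by_cases hc : ω ≠ 0 ∧ P.next (some j) ω y = 0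
          · rw [if_pos hc, if_neg]
            intro h0
            obtain ⟨i, hi⟩ := Function.ne_iff.1 hc.1
            have hij : i ≠ j := by rintro rfl; exact hi h0
            refine hi ?_
            have h2 := congrFun hc.2 i
            by_cases hs : ω j = 0 ∧ P.ow j = false
            · rwa [next_some_of_stay hs] at h2
            · rwa [next_some_of_move hs, put_apply_of_ne (by omega),
                Function.update_of_ne hij] at h2
          · rw [if_neg hc]; split_ifs <;> norm_num)
      have h2 := mul_le_mul_of_nonneg_left h1 (R.lam_pos j).le
      have h3 := R.lam_mul_occ_le ht j
      have h4 : 0 ≤ δ * ((1 + 6 * P.m) * ((γ + δ) / Γ)) := by positivity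
      simp only [occ] at h3
      linarith
    · have hj' : (j : ℕ) + 1 < P.m := by omega
      rw [if_neg hj, zero_add]
      have h1 := R.sum_gain_le ht0 (some j)
        (fun ω y => if ω ≠ 0 ∧ P.next (some j) ω y = 0 then 1 else 0)
        (fun ω => if P.ow j = true then (if ω ⟨j + 1, hj'⟩ = 0 then 0 else 1) else 0)
        (fun ω y hne => by
          by_cases hc : ω ≠ 0 ∧ P.next (some j) ω y = 0
          · by_cases hs : ω j = 0 ∧ P.ow j = false
            · exact absurd (next_some_of_stay hs ▸ hc.2) hc.1
            · have hn := hc.2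
              rw [next_some_of_move hs] at hn
              have hy : y = 0 := by
                have := congrFun hn ⟨j + 1, hj'⟩
                rwa [put_apply_mk hj'] at this
              have hωj : ω j = 0 := by
                by_contra h
                refine hne ?_
                rw [hy, kraus, P.K_empty _ _ h]; simp
              have how : P.ow j = true := by
                by_contra h
                exact hs ⟨hωj, by simpa using h⟩
              rw [if_pos hc, if_pos how, if_neg]
              intro h0
              obtain ⟨i, hi⟩ := Function.ne_iff.1 hc.1
              have hij : i ≠ j := by rintro rfl; exact hi hωj
              have hij' : (i : ℕ) ≠ j + 1 := fun h => hi (by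
                rw [show i = ⟨j + 1, hj'⟩ from Fin.ext h, h0]; rfl)
              refine hi ?_
              have h2 := congrFun hn i
              rwa [put_apply_of_ne hij', Function.update_of_ne hij] at h2
          · rw [if_neg hc]; split_ifs <;> norm_num)
      have h2 := mul_le_mul_of_nonneg_left h1 (R.lam_pos j).le
      refine h2.trans ?_
      by_cases how : P.ow j = true
      · simp only [how, if_true]
        have h3 := R.lam_mul_occ_le' ht ⟨j + 1, hj'⟩
        have h4 := R.occ_nonneg ht0 ⟨j + 1, hj'⟩
        have h5 := R.lam_ow j how
        calc lam j * P.occ (B t) ⟨j + 1, hj'⟩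
            ≤ δ / Γ * lam (j + 1) * P.occ (B t) ⟨j + 1, hj'⟩ := by gcongr
          _ = δ / Γ * (lam (j + 1) * P.occ (B t) ⟨j + 1, hj'⟩) := by ring
          _ ≤ (γ + δ) / Γ * (δ * (1 + 6 * P.m)) :=
              mul_le_mul R.δ_div_le h3 (mul_nonneg (R.lam_pos _).le h4) hα
          _ = _ := by ring
      · simp only [how]
        simp only [Bool.false_eq_true, if_false, zero_mul, Finset.sum_const_zero, mul_zero]
        positivity
  have hsum : δ * rtr (P.ret δ lam (B t)) = ∑ j : Fin P.m, lam j * ∑ ω, ∑ y,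
      (if ω ≠ 0 ∧ P.next (some j) ω y = 0 then 1 else 0)
        * rtr (P.kraus (some j) ω y * B t ω * (P.kraus (some j) ω y)ᴴ) := by
    rw [ret_apply, map_sum, Finset.mul_sum]
    refine Finset.sum_congr rfl fun j _ => ?_
    rw [rtr_smul, ← mul_assoc, mul_div_cancel₀ _ hδ.ne', map_sum]
    congr 1
    refine Finset.sum_congr rfl fun ω _ => ?_
    rw [map_sum]
    refine Finset.sum_congr rfl fun y _ => ?_
    split_ifs <;> simp
  have hlast : ∑ j : Fin P.m, (if (j : ℕ) + 1 = P.m then 1 + 6 * P.m * ((γ + δ) / Γ) else 0)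
      ≤ 1 + 6 * P.m * ((γ + δ) / Γ) := by
    rcases Nat.eq_zero_or_pos P.m with h0 | h0
    · rw [Finset.sum_eq_zero (fun j _ => absurd j.2 (by omega))]; positivity
    · rw [Finset.sum_eq_single ⟨P.m - 1, by omega⟩]
      · split_ifs
        · exact le_rfl
        · positivity
      · intro j _ hj
        rw [if_neg fun h => hj (Fin.ext (by simp; omega))]
      · simp
  refine le_of_mul_le_mul_left ?_ hδ
  rw [hsum]
  refine (Finset.sum_le_sum fun j _ => hocc j).trans ?_
  rw [← Finset.mul_sum, Finset.sum_add_distrib, Finset.sum_const, Finset.card_univ,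
    Fintype.card_fin, nsmul_eq_mul]
  refine mul_le_mul_of_nonneg_left ?_ hδ.le
  linarith

end Run
end Pipeline

namespace Pipeline

variable {M : Type*} [Fintype M] [DecidableEq M] (P : Pipeline M)

/-! ### Single tokens -/

/-- The configuration in which site `j` contains `x` and all other sites are empty. -/
def token (j : Fin P.m) (x : Fin (P.n + 1)) : P.Conf := Function.update 0 j x

/-- The quadratic form of the gain of the configuration `token j x` from the preceding site, or
from the empty pipeline if `j = 0`. -/
def inflow (δ : ℝ) (lam : ℕ → ℝ) (B : P.Conf → Matrix M M ℂ) (j : Fin P.m) (x : Fin (P.n + 1))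
    (v : M → ℂ) : ℝ :=
  (if (j : ℕ) = 0 then δ * qf ((P.K 0 P.root x)ᴴ *ᵥ v) (B 0) else 0)
    + ∑ i : Fin P.m, if (i : ℕ) + 1 = j
      then lam i * ∑ z, qf ((P.K j z x)ᴴ *ᵥ v) (B (P.token i z)) else 0

variable {P} {γ δ Γ : ℝ} {lam : ℕ → ℝ} {𝔏 : SuperOp M M}

theorem token_self (j : Fin P.m) (x : Fin (P.n + 1)) : P.token j x j = x :=
  Function.update_self _ _ _

theorem token_of_ne {i j : Fin P.m} (h : i ≠ j) (x : Fin (P.n + 1)) : P.token j x i = 0 :=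
  Function.update_of_ne h _ _

theorem token_injective (j : Fin P.m) : Function.Injective (P.token j) :=
  Function.update_injective (0 : P.Conf) j

theorem update_token_empty (j : Fin P.m) (x : Fin (P.n + 1)) :
    Function.update (P.token j x) j 0 = 0 := by
  rw [token, Function.update_idem]
  exact Function.update_eq_self j (0 : P.Conf)

theorem put_zero_eq_token {j : Fin P.m} {k : ℕ} (h : k = j) (x : Fin (P.n + 1)) :
    P.put k x 0 = P.token j x := by
  subst h
  rw [put, dif_pos j.2]
  rfl

theorem token_ne_token {i j : Fin P.m} (h : i ≠ j) {x : Fin (P.n + 1)} (hx : x ≠ 0)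
    (z : Fin (P.n + 1)) : P.token i z ≠ P.token j x := fun he => hx (by
  rw [← token_self j x, ← he, token_of_ne h.symm])

omit [DecidableEq M] in
theorem qf_zero_left (X : Matrix M M ℂ) : qf (0 : M → ℂ) X = 0 := by simp [qf_apply]

/-- A lower bound for the gain of a single-token configuration by transfers from site `i`: besides
the inflow only losses by the token's own transfer and by erasure have to be taken into account. -/
theorem qf_push_token_ge {B : P.Conf → Matrix M M ℂ} (hB : ∀ ω, (B ω).PosSemidef) (i j : Fin P.m)
    {x : Fin (P.n + 1)} (hx : x ≠ 0) (v : M → ℂ) :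
    (if (i : ℕ) + 1 = j then ∑ z, qf ((P.K j z x)ᴴ *ᵥ v) (B (P.token i z)) else 0)
      - (if i = j then qf v (B (P.token j x)) else 0)
      - (if (i : ℕ) + 1 = j ∧ P.ow i = true then qf v (B (P.token j x)) else 0)
      ≤ qf v (push (P.kraus (some i)) (P.next (some i)) B (P.token j x) - B (P.token j x)) := by
  rw [map_sub]
  have hmove : ∀ z, (z ≠ 0 ∨ P.ow i = true) → (i : ℕ) + 1 = j →
      P.next (some i) (P.token i z) x = P.token j x := by
    intro z hz hij
    rw [next_some_of_move, update_token_empty, put_zero_eq_token hij]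
    rw [token_self]
    rintro ⟨h1, h2⟩
    rcases hz with h | h
    · exact h h1
    · rw [h] at h2; exact absurd h2 (by decide)
  by_cases hij : i = j
  · subst hij
    rw [if_neg (by omega), if_pos rfl, if_neg (by omega)]
    have := qf_push_ge_sum (Z := Empty) (P.kraus (some i)) (P.next (some i)) hB
      (ω' := P.token i x) Empty.elim (fun a => a.elim) Empty.elim (fun a => a.elim) v
    simp only [Finset.univ_eq_empty, Finset.sum_empty] at this
    linarith
  rw [if_neg hij, sub_zero]
  by_cases h1 : (i : ℕ) + 1 = j
  · rw [if_pos h1]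
    by_cases how : P.ow i = true
    · rw [if_pos ⟨h1, how⟩]
      have := qf_push_ge_sum (P.kraus (some i)) (P.next (some i)) hB (ω' := P.token j x)
        (P.token i) (token_injective i) (fun _ => x) (fun z => hmove z (Or.inr how) h1) v
      simp only [kraus, token_self, h1] at this
      linarith
    · rw [if_neg (fun h => how h.2), sub_zero]
      have := qf_push_ge_sum (P.kraus (some i)) (P.next (some i)) hB (ω' := P.token j x)
        (fun z => if z = 0 then P.token j x else P.token i z) (by
          intro z z' h
          by_cases hz : z = 0 <;> by_cases hz' : z' = 0
          · rw [hz, hz']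
          · simp only [hz, hz', if_true, if_false] at h
            exact absurd h.symm (token_ne_token hij hx _)
          · simp only [hz, hz', if_true, if_false] at h
            exact absurd h (token_ne_token hij hx _)
          · simp only [hz, hz', if_false] at h
            exact token_injective i h)
        (fun z => if z = 0 then 0 else x) (by
          intro z
          by_cases hz : z = 0
          · simp only [hz, if_true]
            exact next_some_of_stay ⟨token_of_ne hij x, by simpa using how⟩
          · simp only [hz, if_false]
            exact hmove z (Or.inl hz) h1) v
      rw [← Finset.add_sum_erase _ _ (Finset.mem_univ (0 : Fin (P.n + 1)))] at this ⊢
      rw [P.K_zero _ _ hx, Matrix.conjTranspose_zero, Matrix.zero_mulVec, qf_zero_left, zero_add]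
      simp only [if_true, kraus, token_of_ne hij, P.K_zero_zero, Matrix.conjTranspose_one,
        Matrix.one_mulVec] at this
      have h2 : ∑ z ∈ Finset.univ.erase (0 : Fin (P.n + 1)),
          qf ((P.K ((i : ℕ) + 1) ((if z = 0 then P.token j x else P.token i z) i)
            (if z = 0 then 0 else x))ᴴ *ᵥ v) (B (if z = 0 then P.token j x else P.token i z))
          = ∑ z ∈ Finset.univ.erase (0 : Fin (P.n + 1)),
            qf ((P.K j z x)ᴴ *ᵥ v) (B (P.token i z)) :=
        Finset.sum_congr rfl fun z hz => by
          have := Finset.ne_of_mem_erase hz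
          simp only [this, if_false, token_self, h1]
      linarith
  · rw [if_neg h1, if_neg (fun h => h1 h.1), sub_zero]
    have := qf_push_ge_sum (Z := Unit) (P.kraus (some i)) (P.next (some i)) hB
      (ω' := P.token j x) (fun _ => P.token j x) (fun _ _ _ => rfl) (fun _ => 0)
      (fun _ => next_some_empty (token_of_ne hij x) fun hi => token_of_ne
        (fun h => h1 (by rw [← h])) x) v
    simp only [kraus, token_of_ne hij, P.K_zero_zero, Matrix.conjTranspose_one,
      Matrix.one_mulVec, Finset.univ_unique, Finset.sum_singleton] at this
    linarith

theorem qf_push_none_token_ge {B : P.Conf → Matrix M M ℂ} (hB : ∀ ω, (B ω).PosSemidef)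
    (j : Fin P.m) (x : Fin (P.n + 1)) (v : M → ℂ) :
    (if (j : ℕ) = 0 then qf ((P.K 0 P.root x)ᴴ *ᵥ v) (B 0) else 0)
      ≤ qf v (push (P.kraus none) (P.next none) B (P.token j x)) := by
  split_ifs with h
  · have := qf_push_ge_sum (Z := Unit) (P.kraus none) (P.next none) hB
      (ω' := P.token j x) (fun _ => 0) (fun _ _ _ => rfl) (fun _ => x)
      (fun _ => put_zero_eq_token h.symm x) v
    simpa [kraus] using this
  · have := qf_push_ge_sum (Z := Empty) (P.kraus none) (P.next none) hB
      (ω' := P.token j x) Empty.elim (fun a => a.elim) Empty.elim (fun a => a.elim) v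
    simpa using this

variable {B : ℝ → P.Conf → Matrix M M ℂ}

namespace Run

variable (R : P.Run γ δ Γ lam 𝔏 B)
include R

/-- All that happens to a single token, bounded from below: the last factor collects further
entries, its own transfer and its erasure. -/
theorem qf_gen_token_ge {t : ℝ} (ht : 0 ≤ t) (j : Fin P.m) {x : Fin (P.n + 1)} (hx : x ≠ 0)
    (v : M → ℂ) :
    P.inflow δ lam (B t) j x v - γ * (rtr (B t (P.token j x)) * nsq v)
        - (δ + lam j + δ / Γ * lam j) * qf v (B t (P.token j x))
      ≤ qf v (P.gen γ 𝔏 δ lam (B t) (P.token j x)) := by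
  have hB := fun ω => R.pos ht ω
  set q := qf v (B t (P.token j x)) with hq
  have hq0 : 0 ≤ q := qf_nonneg (hB _) v
  rw [gen, hybridGen_apply, Fintype.sum_option, map_add, map_add, qf_smul, qf_smul, map_sum]
  have h1 : -(γ * (rtr (B t (P.token j x)) * nsq v)) ≤ γ * qf v (𝔏 (B t (P.token j x))) := by
    have := neg_le_of_abs_le (R.bounded _ (hB (P.token j x)) v)
    have := mul_le_mul_of_nonneg_left this R.γ_nonneg
    linarith
  have h2 := mul_le_mul_of_nonneg_left (qf_push_none_token_ge hB j x v) R.δ_pos.le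
  have h3 : ∑ i : Fin P.m, lam i *
      ((if (i : ℕ) + 1 = j then ∑ z, qf ((P.K j z x)ᴴ *ᵥ v) (B t (P.token i z)) else 0)
      - (if i = j then q else 0) - (if (i : ℕ) + 1 = j ∧ P.ow i = true then q else 0))
      ≤ ∑ i : Fin P.m, qf v (((P.rates δ lam (some i) : ℝ) : ℂ) •
        (push (P.kraus (some i)) (P.next (some i)) (B t) (P.token j x) - B t (P.token j x))) := by
    refine Finset.sum_le_sum fun i _ => ?_
    rw [qf_smul]
    exact mul_le_mul_of_nonneg_left (qf_push_token_ge hB i j hx v) (R.lam_pos i).le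
  have h4 : ∑ i : Fin P.m, lam i * (if i = j then q else 0) = lam j * q := by simp
  have h5 : ∑ i : Fin P.m, lam i * (if (i : ℕ) + 1 = j ∧ P.ow i = true then q else 0)
      ≤ δ / Γ * lam j * q := by
    have hnn : 0 ≤ δ / Γ * lam j * q :=
      mul_nonneg (mul_nonneg (div_nonneg R.δ_pos.le R.Γ_pos.le) (R.lam_pos j).le) hq0
    by_cases hex : ∃ i : Fin P.m, (i : ℕ) + 1 = j ∧ P.ow i = true
    · obtain ⟨i, hi, how⟩ := hex
      rw [Finset.sum_eq_single i, if_pos ⟨hi, how⟩]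
      · rw [← hi]
        exact mul_le_mul_of_nonneg_right (R.lam_ow i how) hq0
      · intro i' _ hne
        rw [if_neg, mul_zero]
        rintro ⟨h, -⟩
        exact hne (Fin.ext (by omega))
      · simp
    · rw [Finset.sum_eq_zero]
      · exact hnn
      · intro i _
        rw [if_neg (fun h => hex ⟨i, h⟩), mul_zero]
  simp only [mul_sub, Finset.sum_sub_distrib] at h3
  rw [h4] at h3
  simp only [rates, inflow, map_sub, mul_ite, mul_zero] at *
  linarith

/-- The quadratic form of the derivative of the idle state is bounded by `O(γ + δ)`. -/
theorem abs_qf_gen_zero_le (hm : 0 < P.m) {t : ℝ} (ht : (P.m : ℝ) / δ ≤ t) (v : M → ℂ) :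
    |qf v (P.gen γ 𝔏 δ lam (B t) 0)|
      ≤ (γ + δ) * (2 + (6 * P.m + P.m * (1 + 6 * P.m))) * nsq v := by
  have ht0 := R.nonneg_of_le ht
  have hδ := R.δ_pos
  have hγ := R.γ_nonneg
  have hv := nsq_nonneg v
  rw [gen_zero hm hδ, map_add, qf_smul, qf_smul, map_sub]
  set c : ℝ := 6 * P.m + P.m * (1 + 6 * P.m) with hc
  have hc0 : 0 ≤ c := by positivity
  have h1 : |qf v (𝔏 (B t 0))| ≤ 1 * nsq v := (R.bounded _ (R.pos ht0 0) v).trans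
    (mul_le_mul_of_nonneg_right (R.rtr_idle_le_one ht0) hv)
  have h2 : |qf v (B t 0)| ≤ 1 * nsq v :=
    abs_qf_le_of_posSemidef (R.pos ht0 0) (R.rtr_idle_le_one ht0) v
  have h3 : |qf v (P.ret δ lam (B t))| ≤ (1 + c) * nsq v :=
    abs_qf_le_of_posSemidef (R.ret_posSemidef ht0) ((R.rtr_ret_le ht).trans
      (add_le_add le_rfl (mul_le_of_le_one_right hc0 R.ratio_le_one))) v
  have h4 : 0 ≤ γ * (1 + c) * nsq v := by positivity
  calc |γ * qf v (𝔏 (B t 0)) + δ * (qf v (P.ret δ lam (B t)) - qf v (B t 0))|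
      ≤ γ * |qf v (𝔏 (B t 0))| + δ * (|qf v (P.ret δ lam (B t))| + |qf v (B t 0)|) := by
        refine (abs_add_le _ _).trans (add_le_add ?_ ?_)
        · rw [abs_mul, abs_of_nonneg hγ]
        · rw [abs_mul, abs_of_nonneg hδ.le]
          exact mul_le_mul_of_nonneg_left (abs_sub _ _) hδ.le
    _ ≤ γ * (1 * nsq v) + δ * ((1 + c) * nsq v + 1 * nsq v) := by gcongr
    _ ≤ _ := by linarith

theorem rtr_token_le_occ {t : ℝ} (ht : 0 ≤ t) (j : Fin P.m) {x : Fin (P.n + 1)} (hx : x ≠ 0) :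
    rtr (B t (P.token j x)) ≤ P.occ (B t) j := by
  have := Finset.single_le_sum (f := fun ω => (if ω j = 0 then 0 else 1) * rtr (B t ω))
    (fun ω _ => mul_nonneg (by split_ifs <;> simp) (rtr_nonneg (R.pos ht ω)))
    (Finset.mem_univ (P.token j x))
  simpa [token_self, hx, occ] using this

/-- One relaxation time after the inflow into `token j x` has become at least the quasi-stationary
value, up to `η`, so has the outflow, up to `η + O(α)`. -/
theorem token_ge_of_inflow_ge (hm : 0 < P.m) (j : Fin P.m) {x : Fin (P.n + 1)} (hx : x ≠ 0)
    {t₀ η : ℝ} (hη : 0 ≤ η) (ht₀ : (P.m : ℝ) / δ ≤ t₀) (v : M → ℂ)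
    (hin : ∀ s, t₀ ≤ s → δ * (qf v (P.path j x (B s 0)) - η * nsq v)
      ≤ P.inflow δ lam (B s) j x v) {t : ℝ} (ht : t₀ + 1 / δ ≤ t) :
    -((η + (2 * (1 + 6 * P.m)
        + P.growth ^ ((j : ℕ) + 1) * (3 + (6 * P.m + P.m * (1 + 6 * P.m)))) * ((γ + δ) / Γ))
        * nsq v)
      ≤ lam j / δ * qf v (B t (P.token j x)) - qf v (P.path j x (B t 0)) := by
  have hδ := R.δ_pos
  have hΓ := R.Γ_pos
  have hγ := R.γ_nonneg
  have hα := R.ratio_nonneg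
  have hl := R.lam_pos j
  have hv := nsq_nonneg v
  have ht₀0 := R.nonneg_of_le ht₀
  have htt : t₀ ≤ t := le_trans (by simp [hδ.le]) ht
  set α := (γ + δ) / Γ with hαdef
  set c₀ : ℝ := 1 + 6 * P.m with hc₀
  set c₁ : ℝ := 6 * P.m + P.m * c₀ with hc₁
  set κ : ℝ := P.growth ^ ((j : ℕ) + 1) with hκ
  have hκ0 : 0 ≤ κ := pow_nonneg P.growth_nonneg _
  have hc₀0 : 0 ≤ c₀ := by positivity
  have hc₁0 : 0 ≤ c₁ := by positivity
  have hαl : γ + δ ≤ α * lam j := by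
    calc γ + δ = α * Γ := by rw [hαdef, div_mul_cancel₀ _ hΓ.ne']
      _ ≤ _ := mul_le_mul_of_nonneg_left (R.le_lam j) hα
  have hder : ∀ s, 0 ≤ s → HasDerivWithinAt
      (fun s => lam j / δ * qf v (B s (P.token j x)) - qf v (P.path j x (B s 0)))
      (lam j / δ * qf v (P.gen γ 𝔏 δ lam (B s) (P.token j x))
        - qf v (P.path j x (P.gen γ 𝔏 δ lam (B s) 0))) (Set.Ici 0) s := fun s hs =>
    ((hasDerivWithinAt_map_of_entries (qf v) (R.evol s hs _)).const_mul _).sub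
      (hasDerivWithinAt_map_of_entries (qf v ∘ₗ (P.path j x).restrictScalars ℝ) (R.evol s hs 0))
  have hmain := ge_sub_exp_of_le_deriv (lam := lam j) (t := t)
    (c := -((η + (2 * c₀ + κ * (2 + c₁)) * α) * nsq v))
    (U := κ * nsq v) ht₀0 htt hder ?_ ?_
  · have hexp : Real.exp (-(lam j * (t - t₀))) ≤ α := by
      refine le_trans (Real.exp_le_exp.2 (neg_le_neg ?_ : _ ≤ -(Γ / δ)))
        ((exp_neg_le_inv (div_pos hΓ hδ)).trans ?_)
      · have h4 : 1 / δ ≤ t - t₀ := le_sub_iff_add_le'.2 ht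
        calc Γ / δ = Γ * (1 / δ) := by ring
          _ ≤ lam j * (t - t₀) := by
            have := R.le_lam j
            gcongr
      · rw [one_div_div]; exact R.δ_div_le
    have := mul_le_mul_of_nonneg_left hexp (mul_nonneg hκ0 hv)
    refine le_trans (le_trans (le_of_eq ?_) (sub_le_sub_left this _)) hmain
    ring
  · intro s hs
    have hs' := ht₀.trans hs
    have hs0 := R.nonneg_of_le hs'
    have h1 := R.qf_gen_token_ge hs0 j hx v
    set q := qf v (B s (P.token j x)) with hq
    set r := rtr (B s (P.token j x)) with hr
    have hq0 : 0 ≤ q := qf_nonneg (R.pos hs0 _) v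
    have hqr : q ≤ r * nsq v := qf_le_rtr_mul (R.pos hs0 _) v
    have hr0 : 0 ≤ r := rtr_nonneg (R.pos hs0 _)
    have hlr : lam j / δ * r ≤ c₀ := by
      rw [div_mul_eq_mul_div, div_le_iff₀ hδ, mul_comm c₀]
      exact (mul_le_mul_of_nonneg_left (R.rtr_token_le_occ hs0 j hx) hl.le).trans
        (R.lam_mul_occ_le' hs' j)
    have hlq : lam j / δ * q ≤ c₀ * nsq v := by
      calc lam j / δ * q ≤ lam j / δ * (r * nsq v) := by gcongr
        _ = lam j / δ * r * nsq v := by ring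
        _ ≤ _ := by gcongr
    have h2 : |qf v (P.path j x (P.gen γ 𝔏 δ lam (B s) 0))| ≤ κ * ((γ + δ) * (2 + c₁)) * nsq v :=
      P.abs_qf_path_le j x (by positivity) (R.abs_qf_gen_zero_le hm hs') v
    have h3 := mul_le_mul_of_nonneg_left (hin s hs) (div_nonneg hl.le hδ.le)
    have h4 := mul_le_mul_of_nonneg_left h1 (div_nonneg hl.le hδ.le)
    have h5 : lam j / δ * (δ * (qf v (P.path j x (B s 0)) - η * nsq v))
        = lam j * (qf v (P.path j x (B s 0)) - η * nsq v) := by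
      rw [← mul_assoc, div_mul_cancel₀ _ hδ.ne']
    rw [h5] at h3
    -- the losses of the token other than by its own transfer
    have h6 : lam j / δ * (γ * (r * nsq v)) ≤ γ * (c₀ * nsq v) := by
      calc lam j / δ * (γ * (r * nsq v)) = γ * (lam j / δ * r * nsq v) := by ring
        _ ≤ _ := by gcongr
    have h7 : lam j / δ * ((δ + lam j + δ / Γ * lam j) * q)
        ≤ (δ + α * lam j) * (c₀ * nsq v) + lam j * (lam j / δ * q) := by
      have h8 : δ + δ / Γ * lam j ≤ δ + α * lam j :=
        add_le_add le_rfl (mul_le_mul_of_nonneg_right R.δ_div_le hl.le)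
      calc lam j / δ * ((δ + lam j + δ / Γ * lam j) * q)
          = (δ + δ / Γ * lam j) * (lam j / δ * q) + lam j * (lam j / δ * q) := by ring
        _ ≤ _ := by
          refine add_le_add (mul_le_mul h8 hlq ?_ ?_) le_rfl <;> positivity
    have h9 : (γ + δ) * (c₀ * nsq v + κ * (2 + c₁) * nsq v)
        ≤ α * lam j * (c₀ * nsq v + κ * (2 + c₁) * nsq v) :=
      mul_le_mul_of_nonneg_right hαl (by positivity)
    have h10 := le_of_abs_le h2
    linarith
  · have h1 : |qf v (P.path j x (B t₀ 0))| ≤ κ * 1 * nsq v :=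
      P.abs_qf_path_le j x zero_le_one
        (abs_qf_le_of_posSemidef (R.pos ht₀0 0) (R.rtr_idle_le_one ht₀0)) v
    have h2 : 0 ≤ lam j / δ * qf v (B t₀ (P.token j x)) :=
      mul_nonneg (div_nonneg hl.le hδ.le) (qf_nonneg (R.pos ht₀0 _) v)
    have h3 := le_of_abs_le h1
    have h4 : 0 ≤ (η + (2 * c₀ + κ * (2 + c₁)) * α) * nsq v := by positivity
    linarith

end Run

variable (P) in
/-- The constant in the lower bound for the outflow of single tokens from site `j`. -/
def lowConst : ℕ → ℝ
  | 0 => 2 * (1 + 6 * P.m)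
      + P.growth ^ (0 + 1) * (3 + (6 * P.m + P.m * (1 + 6 * P.m)))
  | j + 1 => P.growth * lowConst j + (2 * (1 + 6 * P.m)
      + P.growth ^ (j + 1 + 1) * (3 + (6 * P.m + P.m * (1 + 6 * P.m))))

theorem lowConst_nonneg (j : ℕ) : 0 ≤ P.lowConst j := by
  have := P.growth_nonneg
  induction j with
  | zero => unfold lowConst; positivity
  | succ j ih => unfold lowConst; positivity

namespace Run

variable (R : P.Run γ δ Γ lam 𝔏 B)
include R

/-- The outflow of single tokens from each site is at least what the idle state provides, up to
`O(α)`. -/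
theorem token_ge (hm : 0 < P.m) : ∀ (j : ℕ) (hj : j < P.m) {x : Fin (P.n + 1)}, x ≠ 0 →
    ∀ {t : ℝ}, (P.m : ℝ) / δ + (j + 1 : ℝ) / δ ≤ t → ∀ v,
    -(P.lowConst j * ((γ + δ) / Γ) * nsq v)
      ≤ lam j / δ * qf v (B t (P.token ⟨j, hj⟩ x)) - qf v (P.path j x (B t 0)) := by
  have hδ := R.δ_pos
  have hα := R.ratio_nonneg
  intro j
  induction j with
  | zero =>
    intro hj x hx t ht v
    have := R.token_ge_of_inflow_ge hm ⟨0, hj⟩ hx le_rfl le_rfl v (t := t) (fun s _ => by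
      simp [inflow, path_zero_apply, qf_conj]) (by simpa using ht)
    simpa [lowConst] using this
  | succ j ih =>
    intro hj x hx t ht v
    have hj' : j < P.m := by omega
    have hin : ∀ s, (P.m : ℝ) / δ + (j + 1 : ℝ) / δ ≤ s →
        δ * (qf v (P.path (j + 1) x (B s 0))
          - P.growth * (P.lowConst j * ((γ + δ) / Γ)) * nsq v)
        ≤ P.inflow δ lam (B s) ⟨j + 1, hj⟩ x v := by
      intro s hs
      have h1 := P.sum_K_qf_ge (j + 1) x (mul_nonneg (lowConst_nonneg j) hα)
        (q := fun z w => if z = 0 then 0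
          else lam j / δ * qf w (B s (P.token ⟨j, hj'⟩ z)) - qf w (P.path j z (B s 0)))
        (fun z w => by
          by_cases hz : z = 0
          · rw [if_pos hz]
            have := mul_nonneg (mul_nonneg (lowConst_nonneg (P := P) j) hα) (nsq_nonneg w)
            exact neg_nonpos.2 this
          · rw [if_neg hz]
            exact ih hj' hz hs w) v
      have h2 : ∀ z, (if z = 0 then 0
          else lam j / δ * qf ((P.K (j + 1) z x)ᴴ *ᵥ v) (B s (P.token ⟨j, hj'⟩ z))
            - qf ((P.K (j + 1) z x)ᴴ *ᵥ v) (P.path j z (B s 0)))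
          = lam j / δ * qf ((P.K (j + 1) z x)ᴴ *ᵥ v) (B s (P.token ⟨j, hj'⟩ z))
            - qf ((P.K (j + 1) z x)ᴴ *ᵥ v) (P.path j z (B s 0)) := by
        intro z
        by_cases hz : z = 0
        · rw [if_pos hz, hz, P.K_zero _ _ hx]
          simp [qf_zero_left]
        · rw [if_neg hz]
      rw [Finset.sum_congr rfl fun z _ => h2 z, Finset.sum_sub_distrib, ← Finset.mul_sum] at h1
      have h3 : ∑ z, qf ((P.K (j + 1) z x)ᴴ *ᵥ v) (P.path j z (B s 0))
          = qf v (P.path (j + 1) x (B s 0)) := by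
        rw [path_succ_apply, map_sum]
        exact Finset.sum_congr rfl fun z _ => (qf_conj _ _ _).symm
      have h4 : P.inflow δ lam (B s) ⟨j + 1, hj⟩ x v
          = lam j * ∑ z, qf ((P.K (j + 1) z x)ᴴ *ᵥ v) (B s (P.token ⟨j, hj'⟩ z)) := by
        rw [inflow, if_neg (by simp), zero_add, Finset.sum_eq_single ⟨j, hj'⟩]
        · simp
        · intro i _ hi
          rw [if_neg]
          intro h
          exact hi (Fin.ext (by simpa using h))
        · simp
      rw [h3] at h1
      rw [h4]
      have h5 := mul_le_mul_of_nonneg_left h1 hδ.le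
      rw [mul_sub, ← mul_assoc δ (lam j / δ), mul_div_cancel₀ _ hδ.ne'] at h5
      linarith
    have hle : (P.m : ℝ) / δ ≤ (P.m : ℝ) / δ + (j + 1 : ℝ) / δ := by
      have : (0 : ℝ) ≤ (j + 1 : ℝ) / δ := by positivity
      linarith
    have := R.token_ge_of_inflow_ge hm ⟨j + 1, hj⟩ hx
      (mul_nonneg P.growth_nonneg (mul_nonneg (lowConst_nonneg j) hα)) hle v hin (t := t) (by
        rw [add_assoc, ← add_div]
        convert ht using 3
        push_cast; ring)
    simp only [lowConst] at this ⊢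
    refine le_trans (le_of_eq ?_) this
    ring

end Run
end Pipeline

namespace Pipeline

variable {M : Type*} [Fintype M] [DecidableEq M] (P : Pipeline M)

/-! ### The effective evolution of the main system -/

/-- The unnormalised state of the main system on the event that site `j` contains `x`. -/
def marg (B : P.Conf → Matrix M M ℂ) (j : Fin P.m) (x : Fin (P.n + 1)) : Matrix M M ℂ :=
  ∑ ω, if ω j = x then B ω else 0

/-- The deviation of the outflow of tokens `x` from site `j`, in units of `δ`, from the
quasi-stationary value determined by the idle state. -/
def excess (δ : ℝ) (lam : ℕ → ℝ) (B : P.Conf → Matrix M M ℂ) (j : Fin P.m) (x : Fin (P.n + 1)) :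
    Matrix M M ℂ :=
  if x = 0 then 0 else ((lam j / δ : ℝ) : ℂ) • P.marg B j x - P.path j x (B 0)

/-- A bound for all the constants `lowConst`. -/
def lowBound : ℝ := ∑ j : Fin P.m, P.lowConst j

theorem lowBound_nonneg : 0 ≤ P.lowBound := Finset.sum_nonneg fun _ _ => lowConst_nonneg _

theorem lowConst_le (j : Fin P.m) : P.lowConst j ≤ P.lowBound :=
  Finset.single_le_sum (f := fun j : Fin P.m => P.lowConst j) (fun _ _ => lowConst_nonneg _)
    (Finset.mem_univ j)

/-- The constant in the bound for `excess`. -/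
def excessConst : ℝ :=
  6 * P.m + P.m * (1 + 6 * P.m) + (P.n + 1) * (P.lowBound * Fintype.card M)
    + (Fintype.card M + 1) * P.lowBound

theorem excessConst_nonneg : 0 ≤ P.excessConst := by
  have := P.lowBound_nonneg
  unfold excessConst; positivity

variable {P} {γ δ Γ : ℝ} {lam : ℕ → ℝ} {𝔏 : SuperOp M M} {B : ℝ → P.Conf → Matrix M M ℂ}

theorem rtr_ge_of_qf_ge {X : Matrix M M ℂ} {η : ℝ} (h : ∀ v, -(η * nsq v) ≤ qf v X) :
    -(η * Fintype.card M) ≤ rtr X := by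
  rw [rtr_eq_sum_qf]
  refine le_trans (le_of_eq ?_) (Finset.sum_le_sum fun i (_ : i ∈ Finset.univ) => h (Pi.single i 1))
  simp [nsq_single, mul_comm]

theorem path_isHermitian (j : ℕ) (y : Fin (P.n + 1)) {X : Matrix M M ℂ} (hX : X.IsHermitian) :
    (P.path j y X).IsHermitian := by
  induction j generalizing y with
  | zero => exact Matrix.isHermitian_mul_mul_conjTranspose _ hX
  | succ j ih =>
    rw [path_succ_apply]
    exact isHermitian_sum _ fun x _ => Matrix.isHermitian_mul_mul_conjTranspose _ (ih x)

theorem sum_path_succ (j : ℕ) (X : Matrix M M ℂ) :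
    ∑ y, P.path (j + 1) y X
      = ∑ x, ∑ y, P.K (j + 1) x y * P.path j x X * (P.K (j + 1) x y)ᴴ := by
  simp only [path_succ_apply]
  exact Finset.sum_comm

/-- The generator acts on the total state of the main system by the entries and by the transfers of
tokens only. -/
theorem sum_gen (B : P.Conf → Matrix M M ℂ) :
    ∑ ω, P.gen γ 𝔏 δ lam B ω = (γ : ℂ) • 𝔏 (∑ ω, B ω)
      + (δ : ℂ) • (∑ y, P.path 0 y (∑ ω, B ω) - ∑ ω, B ω)
      + ∑ j : Fin P.m, (lam j : ℂ) • ∑ x,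
        (∑ y, P.K (j + 1) x y * (if x = 0 then 0 else P.marg B j x) * (P.K (j + 1) x y)ᴴ
          - if x = 0 then 0 else P.marg B j x) := by
  have hpush : ∀ i, ∑ ω, push (P.kraus i) (P.next i) B ω
      = ∑ ω, ∑ y, P.kraus i ω y * B ω * (P.kraus i ω y)ᴴ := by
    intro i
    simp only [push_apply]
    rw [Finset.sum_comm]
    refine Finset.sum_congr rfl fun ω _ => ?_
    rw [Finset.sum_comm]
    exact Finset.sum_congr rfl fun y _ => by simp
  have hsome : ∀ j : Fin P.m, ∑ ω, (push (P.kraus (some j)) (P.next (some j)) B ω - B ω)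
      = ∑ x, (∑ y, P.K (j + 1) x y * (if x = 0 then 0 else P.marg B j x) * (P.K (j + 1) x y)ᴴ
          - if x = 0 then 0 else P.marg B j x) := by
    intro j
    have h1 : ∀ x, (∑ y, P.K (j + 1) x y * (if x = 0 then 0 else P.marg B j x)
          * (P.K (j + 1) x y)ᴴ - if x = 0 then 0 else P.marg B j x)
        = ∑ y, P.K (j + 1) x y * P.marg B j x * (P.K (j + 1) x y)ᴴ - P.marg B j x := by
      intro x
      by_cases hx : x = 0
      · rw [hx, Finset.sum_eq_single (0 : Fin (P.n + 1)) (fun y _ hy => by simp) (by simp),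
          Finset.sum_eq_single (0 : Fin (P.n + 1))
            (fun y _ hy => by rw [P.K_zero _ _ hy]; simp) (by simp), P.K_zero_zero]
        simp
      · simp [hx]
    rw [Finset.sum_sub_distrib, hpush, Finset.sum_congr rfl fun x _ => h1 x,
      Finset.sum_sub_distrib]
    congr 1
    · simp only [kraus, marg, Finset.mul_sum, Finset.sum_mul]
      have : ∀ x y, ∑ ω, P.K (j + 1) x y * (if ω j = x then B ω else 0) * (P.K (j + 1) x y)ᴴ
          = ∑ ω, if ω j = x then P.K (j + 1) (ω j) y * B ω * (P.K (j + 1) (ω j) y)ᴴ else 0 :=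
        fun x y => Finset.sum_congr rfl fun ω _ => by
          split_ifs with h
          · rw [h]
          · simp
      simp only [this]
      rw [Finset.sum_comm]
      conv_rhs => rw [Finset.sum_comm]
      refine Finset.sum_congr rfl fun y _ => ?_
      conv_rhs => rw [Finset.sum_comm]
      exact Finset.sum_congr rfl fun ω _ => by simp
    · simp only [marg]
      rw [Finset.sum_comm]
      exact Finset.sum_congr rfl fun ω _ => by simp
  have hnone : ∑ ω, (push (P.kraus none) (P.next none) B ω - B ω)
      = ∑ y, P.path 0 y (∑ ω, B ω) - ∑ ω, B ω := by
    rw [Finset.sum_sub_distrib, hpush]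
    congr 1
    rw [Finset.sum_comm]
    refine Finset.sum_congr rfl fun y _ => ?_
    rw [path_zero_apply, Finset.mul_sum, Finset.sum_mul]
    rfl
  simp only [gen, hybridGen_apply, Finset.sum_add_distrib]
  rw [Finset.sum_comm, Fintype.sum_option, ← Finset.smul_sum, ← Finset.smul_sum, hnone, map_sum,
    ← add_assoc]
  congr 1
  refine Finset.sum_congr rfl fun j _ => ?_
  rw [← Finset.smul_sum, hsome]
  rfl

/-- The error term of the effective evolution of the reduced state. -/
def errorTerm (P : Pipeline M) (δ : ℝ) (lam : ℕ → ℝ) (B : P.Conf → Matrix M M ℂ) :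
    Matrix M M ℂ :=
  ∑ y, P.path 0 y (∑ ω, B ω - B 0)
    + ∑ j : Fin P.m, (∑ y, ∑ x, P.K (j + 1) x y * P.excess δ lam B j x * (P.K (j + 1) x y)ᴴ
      - ∑ x, P.excess δ lam B j x)
    - ∑ y, P.path P.m y (∑ ω, B ω - B 0)

/-- If the flow of tokens `x` through each site `j` is written as `path j x (B 0)` plus an excess,
the contributions of the first terms telescope to `protocol`. -/
theorem sum_gen_eq (hδ : 0 < δ) (B : P.Conf → Matrix M M ℂ) :
    ∑ ω, P.gen γ 𝔏 δ lam B ω = (γ : ℂ) • 𝔏 (∑ ω, B ω)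
      + (δ : ℂ) • ((P.protocol (∑ ω, B ω) + P.errorTerm δ lam B) - ∑ ω, B ω) := by
  have hex : ∀ (j : Fin P.m) x, (lam j : ℂ) • (if x = 0 then 0 else P.marg B j x)
      = (δ : ℂ) • (P.excess δ lam B j x + P.path j x (B 0)) := by
    intro j x
    unfold excess
    by_cases hx : x = 0
    · rw [if_pos hx, if_pos hx, hx, path_empty]; simp
    · rw [if_neg hx, if_neg hx, sub_add_cancel, smul_smul, ← Complex.ofReal_mul,
        mul_div_cancel₀ _ hδ.ne']
  have hj : ∀ j : Fin P.m, (lam j : ℂ) • ∑ x,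
        (∑ y, P.K (j + 1) x y * (if x = 0 then 0 else P.marg B j x) * (P.K (j + 1) x y)ᴴ
          - if x = 0 then 0 else P.marg B j x)
      = (δ : ℂ) • ((∑ y, ∑ x, P.K (j + 1) x y * P.excess δ lam B j x * (P.K (j + 1) x y)ᴴ
          - ∑ x, P.excess δ lam B j x)
        + (∑ y, P.path (j + 1) y (B 0) - ∑ y, P.path j y (B 0))) := by
    intro j
    have h1 : ∀ x, (lam j : ℂ) •
        (∑ y, P.K (j + 1) x y * (if x = 0 then 0 else P.marg B j x) * (P.K (j + 1) x y)ᴴ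
          - if x = 0 then 0 else P.marg B j x)
        = (δ : ℂ) • (∑ y, P.K (j + 1) x y * (P.excess δ lam B j x + P.path j x (B 0))
          * (P.K (j + 1) x y)ᴴ - (P.excess δ lam B j x + P.path j x (B 0))) := by
      intro x
      rw [smul_sub, smul_sub, hex, Finset.smul_sum, Finset.smul_sum]
      congr 1
      refine Finset.sum_congr rfl fun y _ => ?_
      rw [← Matrix.smul_mul, ← Matrix.mul_smul, hex, Matrix.mul_smul, Matrix.smul_mul]
    rw [Finset.smul_sum, Finset.sum_congr rfl fun x _ => h1 x, ← Finset.smul_sum,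
      sum_path_succ]
    congr 1
    simp only [Matrix.mul_add, Matrix.add_mul, Finset.sum_add_distrib, Finset.sum_sub_distrib]
    rw [Finset.sum_comm (f := fun y x =>
      P.K (j + 1) x y * P.excess δ lam B j x * (P.K (j + 1) x y)ᴴ)]
    abel
  have htel : ∑ j : Fin P.m, (∑ y, P.path (j + 1) y (B 0) - ∑ y, P.path j y (B 0))
      = ∑ y, P.path P.m y (B 0) - ∑ y, P.path 0 y (B 0) := by
    rw [Fin.sum_univ_eq_sum_range (fun j => ∑ y, P.path (j + 1) y (B 0) - ∑ y, P.path j y (B 0)),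
      Finset.sum_range_sub (fun j => ∑ y, P.path j y (B 0))]
  rw [sum_gen, Finset.sum_congr rfl fun j _ => hj j, ← Finset.smul_sum, Finset.sum_add_distrib,
    htel, add_assoc, ← smul_add, errorTerm, protocol_apply]
  congr 2
  simp only [map_sub, Finset.sum_sub_distrib]
  abel

namespace Run

variable (R : P.Run γ δ Γ lam 𝔏 B)
include R

theorem token_ge_lowBound (hm : 0 < P.m) (j : Fin P.m) {x : Fin (P.n + 1)} (hx : x ≠ 0) {t : ℝ}
    (ht : (2 * P.m : ℝ) / δ ≤ t) (v : M → ℂ) :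
    -(P.lowBound * ((γ + δ) / Γ) * nsq v)
      ≤ lam j / δ * qf v (B t (P.token j x)) - qf v (P.path j x (B t 0)) := by
  have hδ := R.δ_pos
  have hα := R.ratio_nonneg
  have hv := nsq_nonneg v
  have hj : (j : ℝ) + 1 ≤ P.m := by exact_mod_cast j.2
  refine le_trans (neg_le_neg ?_) (R.token_ge hm j j.2 hx (le_trans ?_ ht) v)
  · have := P.lowConst_le j
    gcongr
  · rw [← add_div]
    gcongr
    linarith

theorem le_of_two_mul_le {t : ℝ} (ht : (2 * P.m : ℝ) / δ ≤ t) : (P.m : ℝ) / δ ≤ t := by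
  have hδ := R.δ_pos
  refine le_trans ?_ ht
  gcongr
  have : (0 : ℝ) ≤ P.m := Nat.cast_nonneg _
  linarith

theorem marg_posSemidef {t : ℝ} (ht : 0 ≤ t) (j : Fin P.m) (x : Fin (P.n + 1)) :
    (P.marg (B t) j x).PosSemidef := by
  refine Matrix.posSemidef_sum _ fun ω _ => ?_
  split_ifs
  · exact R.pos ht ω
  · exact Matrix.PosSemidef.zero

theorem excess_isHermitian {t : ℝ} (ht : 0 ≤ t) (j : Fin P.m) (x : Fin (P.n + 1)) :
    (P.excess δ lam (B t) j x).IsHermitian := by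
  unfold excess
  split_ifs
  · exact Matrix.isHermitian_zero
  · refine Matrix.IsHermitian.sub ?_ (P.path_posSemidef _ _ (R.pos ht 0)).1
    rw [Matrix.IsHermitian, Matrix.conjTranspose_smul, (R.marg_posSemidef ht j x).1.eq]
    simp

theorem qf_excess_ge (hm : 0 < P.m) (j : Fin P.m) (x : Fin (P.n + 1)) {t : ℝ}
    (ht : (2 * P.m : ℝ) / δ ≤ t) (v : M → ℂ) :
    -(P.lowBound * ((γ + δ) / Γ) * nsq v) ≤ qf v (P.excess δ lam (B t) j x) := by
  have ht0 := R.nonneg_of_le (R.le_of_two_mul_le ht)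
  unfold excess
  split_ifs with hx
  · have := mul_nonneg (mul_nonneg P.lowBound_nonneg R.ratio_nonneg) (nsq_nonneg v)
    rw [map_zero]; linarith
  · refine (R.token_ge_lowBound hm j hx ht v).trans ?_
    rw [map_sub, qf_smul]
    refine sub_le_sub_right (mul_le_mul_of_nonneg_left ?_
      (div_nonneg (R.lam_pos j).le R.δ_pos.le)) _
    rw [marg, map_sum]
    have := Finset.single_le_sum (f := fun ω => qf v (if ω j = x then B t ω else 0))
      (fun ω _ => by
        split_ifs
        · exact qf_nonneg (R.pos ht0 ω) v
        · rw [map_zero]) (Finset.mem_univ (P.token j x))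
    simpa [token_self] using this

theorem sum_rtr_excess_le (j : Fin P.m) {t : ℝ} (ht : (2 * P.m : ℝ) / δ ≤ t) :
    ∑ x, rtr (P.excess δ lam (B t) j x)
      ≤ (6 * P.m + P.m * (1 + 6 * P.m)) * ((γ + δ) / Γ) := by
  have ht' := R.le_of_two_mul_le ht
  have hδ := R.δ_pos
  have h1 : ∀ x, rtr (P.excess δ lam (B t) j x)
      = lam j / δ * (if x = 0 then 0 else rtr (P.marg (B t) j x)) - rtr (P.path j x (B t 0)) := by
    intro x
    unfold excess
    by_cases hx : x = 0
    · rw [if_pos hx, if_pos hx, hx, path_empty]; simp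
    · rw [if_neg hx, if_neg hx, map_sub, rtr_smul]
  have h2 : ∑ x, (if x = 0 then 0 else rtr (P.marg (B t) j x)) = P.occ (B t) j := by
    have : ∀ x, (if x = 0 then 0 else rtr (P.marg (B t) j x))
        = ∑ ω, if ω j = x then (if ω j = 0 then 0 else 1) * rtr (B t ω) else 0 := by
      intro x
      rw [marg, map_sum]
      by_cases hx : x = 0
      · rw [if_pos hx, Finset.sum_eq_zero]
        intro ω _
        split_ifs with h h' <;> simp_all
      · rw [if_neg hx]
        refine Finset.sum_congr rfl fun ω _ => ?_
        split_ifs with h h' <;> simp_all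
    rw [Finset.sum_congr rfl fun x _ => this x, Finset.sum_comm, occ]
    exact Finset.sum_congr rfl fun ω _ => by simp
  rw [Finset.sum_congr rfl fun x _ => h1 x, Finset.sum_sub_distrib, ← Finset.mul_sum, h2,
    sum_rtr_path]
  have h3 := R.one_sub_rtr_idle_le ht'
  have h4 : lam j / δ * P.occ (B t) j ≤ 1 + 6 * P.m * ((γ + δ) / Γ) := by
    rw [div_mul_eq_mul_div, div_le_iff₀ hδ, mul_comm _ δ]
    exact R.lam_mul_occ_le ht' j
  linarith

/-- The excess is bounded from below, and the traces for all tokens together are bounded from above,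
so that each excess is small in norm. -/
theorem abs_qf_excess_le (hm : 0 < P.m) (j : Fin P.m) (x : Fin (P.n + 1)) {t : ℝ}
    (ht : (2 * P.m : ℝ) / δ ≤ t) (v : M → ℂ) :
    |qf v (P.excess δ lam (B t) j x)| ≤ P.excessConst * ((γ + δ) / Γ) * nsq v := by
  have ht0 := R.nonneg_of_le (R.le_of_two_mul_le ht)
  have hα := R.ratio_nonneg
  have hη := mul_nonneg P.lowBound_nonneg hα
  have htr : rtr (P.excess δ lam (B t) j x)
      ≤ (6 * P.m + P.m * (1 + 6 * P.m)) * ((γ + δ) / Γ)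
        + (P.n + 1) * (P.lowBound * ((γ + δ) / Γ) * Fintype.card M) := by
    have h1 := R.sum_rtr_excess_le j ht
    rw [← Finset.add_sum_erase _ _ (Finset.mem_univ x)] at h1
    have h2 : -((P.n + 1) * (P.lowBound * ((γ + δ) / Γ) * Fintype.card M))
        ≤ ∑ y ∈ Finset.univ.erase x, rtr (P.excess δ lam (B t) j y) := by
      refine le_trans ?_ (Finset.sum_le_sum fun y (_ : y ∈ Finset.univ.erase x) =>
        rtr_ge_of_qf_ge (R.qf_excess_ge hm j y ht))
      rw [Finset.sum_const, Finset.card_erase_of_mem (Finset.mem_univ x), Finset.card_univ,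
        Fintype.card_fin, nsmul_eq_mul, Nat.add_sub_cancel]
      have : 0 ≤ P.lowBound * ((γ + δ) / Γ) * Fintype.card M := mul_nonneg hη (Nat.cast_nonneg _)
      linarith
    linarith
  refine (abs_qf_le_of_lower (R.excess_isHermitian ht0 j x) hη (R.qf_excess_ge hm j x ht)
    htr v).trans (le_of_eq ?_)
  unfold excessConst
  ring

theorem sum_sub_idle_posSemidef {t : ℝ} (ht : 0 ≤ t) : (∑ ω, B t ω - B t 0).PosSemidef := by
  rw [← Finset.add_sum_erase _ _ (Finset.mem_univ (0 : P.Conf)), add_sub_cancel_left]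
  exact Matrix.posSemidef_sum _ fun ω _ => R.pos ht ω

theorem abs_qf_sum_sub_idle_le {t : ℝ} (ht : (P.m : ℝ) / δ ≤ t) (v : M → ℂ) :
    |qf v (∑ ω, B t ω - B t 0)| ≤ P.m * (1 + 6 * P.m) * ((γ + δ) / Γ) * nsq v := by
  have ht0 := R.nonneg_of_le ht
  refine abs_qf_le_of_posSemidef (R.sum_sub_idle_posSemidef ht0) ?_ v
  rw [map_sub, map_sum, R.sum_rtr ht0]
  exact R.one_sub_rtr_idle_le ht

theorem errorTerm_isHermitian {t : ℝ} (ht : 0 ≤ t) :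
    (P.errorTerm δ lam (B t)).IsHermitian := by
  have h := (R.sum_sub_idle_posSemidef ht).1
  refine Matrix.IsHermitian.sub (Matrix.IsHermitian.add ?_ ?_) ?_
  · exact isHermitian_sum _ fun y _ => path_isHermitian _ _ h
  · refine isHermitian_sum _ fun j _ => Matrix.IsHermitian.sub ?_ ?_
    · exact isHermitian_sum _ fun y _ => isHermitian_sum _ fun x _ =>
        Matrix.isHermitian_mul_mul_conjTranspose _ (R.excess_isHermitian ht j x)
    · exact isHermitian_sum _ fun x _ => R.excess_isHermitian ht j x
  · exact isHermitian_sum _ fun y _ => path_isHermitian _ _ h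

end Run

omit [DecidableEq M] in
theorem abs_qf_sum_le {ι : Type*} [Fintype ι] {X : ι → Matrix M M ℂ} {β : ℝ} {v : M → ℂ}
    (h : ∀ i, |qf v (X i)| ≤ β * nsq v) : |qf v (∑ i, X i)| ≤ Fintype.card ι * β * nsq v := by
  rw [map_sum]
  refine (Finset.abs_sum_le_sum_abs _ _).trans ((Finset.sum_le_sum fun i _ => h i).trans ?_)
  simp [mul_assoc]

variable (P) in
/-- The constant in the bound for `errorTerm`. -/
def errorConst : ℝ :=
  (P.n + 1) * (P.growth ^ (0 + 1) * (P.m * (1 + 6 * P.m)))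
    + P.m * ((P.n + 1) * (P.growth * P.excessConst) + (P.n + 1) * P.excessConst)
    + (P.n + 1) * (P.growth ^ (P.m + 1) * (P.m * (1 + 6 * P.m)))

theorem errorConst_nonneg : 0 ≤ P.errorConst := by
  have := P.growth_nonneg
  have := P.excessConst_nonneg
  unfold errorConst; positivity

namespace Run

variable (R : P.Run γ δ Γ lam 𝔏 B)
include R

theorem abs_qf_errorTerm_le (hm : 0 < P.m) {t : ℝ} (ht : (2 * P.m : ℝ) / δ ≤ t) (v : M → ℂ) :
    |qf v (P.errorTerm δ lam (B t))| ≤ P.errorConst * ((γ + δ) / Γ) * nsq v := by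
  have ht' := R.le_of_two_mul_le ht
  have hα := R.ratio_nonneg
  have hc : (0 : ℝ) ≤ P.m * (1 + 6 * P.m) * ((γ + δ) / Γ) := by positivity
  have hpath : ∀ k, |qf v (∑ y, P.path k y (∑ ω, B t ω - B t 0))|
      ≤ (P.n + 1 : ℕ) * (P.growth ^ (k + 1) * (P.m * (1 + 6 * P.m) * ((γ + δ) / Γ))) * nsq v := by
    intro k
    have := abs_qf_sum_le (v := v) fun y => P.abs_qf_path_le k y hc (R.abs_qf_sum_sub_idle_le ht') v
    simpa using this
  have h0 := hpath 0
  have h1 := hpath P.m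
  have hxc := mul_nonneg P.excessConst_nonneg hα
  have h2 : |qf v (∑ j : Fin P.m,
      (∑ y, ∑ x, P.K (j + 1) x y * P.excess δ lam (B t) j x * (P.K (j + 1) x y)ᴴ
        - ∑ x, P.excess δ lam (B t) j x))|
      ≤ P.m * ((P.n + 1 : ℕ) * (P.growth * (P.excessConst * ((γ + δ) / Γ)))
        + (P.n + 1 : ℕ) * (P.excessConst * ((γ + δ) / Γ))) * nsq v := by
    have := abs_qf_sum_le (ι := Fin P.m) (v := v) (X := fun j =>
      (∑ y, ∑ x, P.K (j + 1) x y * P.excess δ lam (B t) j x * (P.K (j + 1) x y)ᴴ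
        - ∑ x, P.excess δ lam (B t) j x))
      (β := ((P.n + 1 : ℕ) * (P.growth * (P.excessConst * ((γ + δ) / Γ)))
        + (P.n + 1 : ℕ) * (P.excessConst * ((γ + δ) / Γ)))) (fun j => by
          rw [map_sub, add_mul]
          refine (abs_sub _ _).trans (add_le_add ?_ ?_)
          · have := abs_qf_sum_le (v := v) fun y => P.sum_K_abs_qf_le (j + 1) y hxc
              (fun x v => R.abs_qf_excess_le hm j x ht v) v
            simpa using this
          · have := abs_qf_sum_le (v := v) fun x => R.abs_qf_excess_le hm j x ht v
            simpa using this)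
    simpa using this
  have hsplit : qf v (P.errorTerm δ lam (B t)) = qf v (∑ y, P.path 0 y (∑ ω, B t ω - B t 0))
      + qf v (∑ j : Fin P.m,
        (∑ y, ∑ x, P.K (j + 1) x y * P.excess δ lam (B t) j x * (P.K (j + 1) x y)ᴴ
          - ∑ x, P.excess δ lam (B t) j x))
      - qf v (∑ y, P.path P.m y (∑ ω, B t ω - B t 0)) := by
    rw [errorTerm, map_sub, map_add]
  rw [hsplit]
  refine (abs_sub _ _).trans ((add_le_add (abs_add_le _ _) le_rfl).trans
    ((add_le_add (add_le_add h0 h2) h1).trans (le_of_eq ?_)))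
  unfold errorConst
  push_cast
  ring

/-- The returns to the idle configuration are at least what the idle state provides. -/
theorem qf_ret_sub_protocol_ge (hm : 0 < P.m) {t : ℝ} (ht : (2 * P.m : ℝ) / δ ≤ t) (v : M → ℂ) :
    -((P.n + 1) * (P.growth * P.lowBound) * ((γ + δ) / Γ) * nsq v)
      ≤ qf v (P.ret δ lam (B t) - P.protocol (B t 0)) := by
  have ht0 := R.nonneg_of_le (R.le_of_two_mul_le ht)
  have hα := R.ratio_nonneg
  obtain ⟨k, hk⟩ : ∃ k, P.m = k + 1 := ⟨P.m - 1, by omega⟩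
  set j : Fin P.m := ⟨k, by omega⟩ with hj
  have hnn : ∀ (i : Fin P.m) ω y, 0 ≤ qf v (if ω ≠ 0 ∧ P.next (some i) ω y = 0
      then P.kraus (some i) ω y * B t ω * (P.kraus (some i) ω y)ᴴ else 0) := by
    intro i ω y
    split_ifs
    · exact qf_nonneg ((R.pos ht0 ω).mul_mul_conjTranspose_same _) v
    · rw [map_zero]
  -- only single tokens leaving the last site are counted
  have hlast : lam j / δ * ∑ x, ∑ y, (if x = 0 then 0 else
      qf ((P.K (k + 1) x y)ᴴ *ᵥ v) (B t (P.token j x))) ≤ qf v (P.ret δ lam (B t)) := by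
    rw [ret_apply, map_sum]
    refine le_trans ?_ (Finset.single_le_sum (fun i _ => ?_) (Finset.mem_univ j))
    · rw [qf_smul, map_sum]
      refine mul_le_mul_of_nonneg_left ?_ (div_nonneg (R.lam_pos _).le R.δ_pos.le)
      refine le_trans (le_trans (Finset.sum_le_sum fun x _ => ?_) (le_of_eq
        (Finset.sum_map Finset.univ ⟨P.token j, token_injective j⟩ (fun ω => qf v (∑ y,
          if ω ≠ 0 ∧ P.next (some j) ω y = 0
          then P.kraus (some j) ω y * B t ω * (P.kraus (some j) ω y)ᴴ else 0))).symm))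
        (Finset.sum_le_univ_sum_of_nonneg fun ω => ?_)
      · rw [Function.Embedding.coeFn_mk, map_sum]
        refine Finset.sum_le_sum fun y _ => ?_
        by_cases hx : x = 0
        · rw [if_pos hx]; exact hnn _ _ _
        · have h1 : P.token j x ≠ 0 := fun h => hx (by rw [← token_self j x, h]; rfl)
          have h2 : P.next (some j) (P.token j x) y = 0 := by
            rw [next_some_of_move (fun h => hx (by rw [← token_self j x]; exact h.1)),
              update_token_empty, put, dif_neg (by simp [hj]; omega)]
          rw [if_neg hx, if_pos ⟨h1, h2⟩, qf_conj, kraus, token_self]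
      · rw [map_sum]
        exact Finset.sum_nonneg fun y _ => hnn _ _ _
    · rw [qf_smul, map_sum]
      refine mul_nonneg (div_nonneg (R.lam_pos _).le R.δ_pos.le) (Finset.sum_nonneg fun ω _ => ?_)
      rw [map_sum]
      exact Finset.sum_nonneg fun y _ => hnn _ _ _
  have hlow : ∀ y, -(P.growth * (P.lowBound * ((γ + δ) / Γ)) * nsq v)
      ≤ ∑ x, (lam j / δ * (if x = 0 then 0 else
          qf ((P.K (k + 1) x y)ᴴ *ᵥ v) (B t (P.token j x)))
        - qf ((P.K (k + 1) x y)ᴴ *ᵥ v) (P.path k x (B t 0))) := by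
    intro y
    refine P.sum_K_qf_ge (k + 1) y (mul_nonneg P.lowBound_nonneg hα)
      (q := fun x w => lam j / δ * (if x = 0 then 0 else qf w (B t (P.token j x)))
        - qf w (P.path k x (B t 0))) (fun x w => ?_) v
    by_cases hx : x = 0
    · rw [if_pos hx, hx, path_empty, map_zero]
      have := mul_nonneg (mul_nonneg P.lowBound_nonneg hα) (nsq_nonneg w)
      linarith
    · rw [if_neg hx]
      exact R.token_ge_lowBound hm j hx ht w
  have hsum := Finset.sum_le_sum fun y (_ : y ∈ Finset.univ) => hlow y
  rw [Finset.sum_const, Finset.card_univ, Fintype.card_fin, nsmul_eq_mul] at hsum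
  simp only [Finset.sum_sub_distrib, ← Finset.mul_sum] at hsum
  rw [Finset.sum_comm] at hsum
  have hprot : qf v (P.protocol (B t 0))
      = ∑ y, ∑ x, qf ((P.K (k + 1) x y)ᴴ *ᵥ v) (P.path k x (B t 0)) := by
    rw [protocol_apply, map_sum]
    refine Finset.sum_congr rfl fun y _ => ?_
    rw [congrArg P.path hk, path_succ_apply, map_sum]
    exact Finset.sum_congr rfl fun x _ => qf_conj _ _ _
  rw [map_sub, hprot]
  push_cast at hsum
  linarith

/-- The trace of the returns exceeds that of the image of the idle state at most by `O(α)`. -/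
theorem rtr_ret_sub_protocol_le {t : ℝ} (ht : (P.m : ℝ) / δ ≤ t) :
    rtr (P.ret δ lam (B t) - P.protocol (B t 0))
      ≤ (6 * P.m + 2 * (P.m * (1 + 6 * P.m))) * ((γ + δ) / Γ) := by
  have h1 := R.rtr_ret_le ht
  have h2 := R.one_sub_rtr_idle_le ht
  rw [map_sub, protocol_apply, map_sum, sum_rtr_path]
  linarith

end Run

variable (P) in
/-- The effective evolution of the main system under a pipeline, up to errors proportional to the
ratio of the slow rates `γ`, `δ` and the rate `Γ` of the channels. -/
theorem exists_effective_evolution (hm : 0 < P.m) :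
    ∃ C : ℝ, 0 < C ∧ ∀ (γ δ Γ : ℝ) (lam : ℕ → ℝ) (𝔏 : SuperOp M M)
      (B : ℝ → P.Conf → Matrix M M ℂ), P.Run γ δ Γ lam 𝔏 B → ∀ t, (2 * P.m : ℝ) / δ ≤ t →
      (P.errorTerm δ lam (B t)).IsHermitian ∧
      traceNorm (P.errorTerm δ lam (B t)) ≤ C * ((γ + δ) / Γ) ∧
      traceNorm (∑ ω, B t ω - B t 0) ≤ C * ((γ + δ) / Γ) ∧
      traceNorm (P.ret δ lam (B t) - P.protocol (B t 0)) ≤ C * ((γ + δ) / Γ) := by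
  set d : ℝ := 4 * (Fintype.card M) ^ 2 with hd
  have hd0 : 0 ≤ d := by positivity
  set c₁ := P.errorConst with hc₁
  set c₂ : ℝ := P.m * (1 + 6 * P.m) with hc₂
  set c₃ : ℝ := 6 * P.m + 2 * (P.m * (1 + 6 * P.m))
    + (Fintype.card M + 1) * ((P.n + 1) * (P.growth * P.lowBound)) with hc₃
  have h1 : 0 ≤ c₁ := errorConst_nonneg
  have h2 : 0 ≤ c₂ := by positivity
  have hgl : 0 ≤ (P.n + 1) * (P.growth * P.lowBound) :=
    mul_nonneg (by positivity) (mul_nonneg P.growth_nonneg P.lowBound_nonneg)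
  have h3 : 0 ≤ c₃ := by positivity
  refine ⟨d * (c₁ + c₂ + c₃) + 1, by positivity, fun γ δ Γ lam 𝔏 B R t ht => ?_⟩
  have ht' := R.le_of_two_mul_le ht
  have ht0 := R.nonneg_of_le ht'
  have hα := R.ratio_nonneg
  have fin : ∀ (X : Matrix M M ℂ) (c : ℝ), 0 ≤ c → c ≤ c₁ + c₂ + c₃ → X.IsHermitian →
      (∀ v, |qf v X| ≤ c * ((γ + δ) / Γ) * nsq v) →
      traceNorm X ≤ (d * (c₁ + c₂ + c₃) + 1) * ((γ + δ) / Γ) := by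
    intro X c hc hcc hX hq
    refine (traceNorm_le_of_abs_qf_le hX (mul_nonneg hc hα) hq).trans ?_
    rw [← hd, ← mul_assoc]
    refine mul_le_mul_of_nonneg_right ?_ hα
    have := mul_le_mul_of_nonneg_left hcc hd0
    linarith
  have hherm : (P.ret δ lam (B t) - P.protocol (B t 0)).IsHermitian := by
    refine (R.ret_posSemidef ht0).1.sub ?_
    rw [protocol_apply]
    exact isHermitian_sum _ fun y _ => path_isHermitian _ _ (R.pos ht0 0).1
  refine ⟨R.errorTerm_isHermitian ht0,
    fin _ c₁ h1 (by linarith) (R.errorTerm_isHermitian ht0) (R.abs_qf_errorTerm_le hm ht),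
    fin _ c₂ h2 (by linarith) (R.sum_sub_idle_posSemidef ht0).1 (R.abs_qf_sum_sub_idle_le ht'),
    fin _ c₃ h3 (by linarith) hherm fun v => ?_⟩
  refine (abs_qf_le_of_lower hherm (mul_nonneg hgl hα) (R.qf_ret_sub_protocol_ge hm ht)
    (R.rtr_ret_sub_protocol_le ht') v).trans (le_of_eq ?_)
  rw [hc₃]
  ring

end Pipeline

/-! ### LOCC maps as token protocols with alternating parties -/

section Rounds

variable {a b : Type*} [Fintype a] [Fintype b] [DecidableEq a] [DecidableEq b]

/-- `K` acts on Alice's (`p = true`) or on Bob's (`p = false`) system alone. -/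
def IsLocal (p : Bool) (K : Matrix (a × b) (a × b) ℂ) : Prop :=
  if p = true then ∃ A : Matrix a a ℂ, K = A ⊗ₖ (1 : Matrix b b ℂ)
  else ∃ A : Matrix b b ℂ, K = (1 : Matrix a a ℂ) ⊗ₖ A

omit [Fintype a] [Fintype b] in
theorem isLocal_one (p : Bool) : IsLocal p (1 : Matrix (a × b) (a × b) ℂ) := by
  cases p
  · exact ⟨1, by rw [Matrix.one_kronecker_one]⟩
  · exact ⟨1, by rw [Matrix.one_kronecker_one]⟩

omit [Fintype a] [Fintype b] in
theorem isLocal_zero (p : Bool) : IsLocal p (0 : Matrix (a × b) (a × b) ℂ) := by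
  cases p
  · exact ⟨0, by rw [Matrix.kronecker_zero]⟩
  · exact ⟨0, by rw [Matrix.zero_kronecker]⟩

theorem conjBy_one {n : Type*} [Fintype n] [DecidableEq n] :
    conjBy (1 : Matrix n n ℂ) = LinearMap.id := by
  ext1 X
  simp [conjBy]

theorem conjBy_zero {m n : Type*} [Fintype m] :
    conjBy (0 : Matrix n m ℂ) = 0 := by
  ext1 X
  simp [conjBy]

/-- LOCC maps with exactly `d` rounds, in which the parties take turns and `p` tells whether Alice
is first. -/
def IsRounds : ℕ → Bool → SuperOp (a × b) (a × b) → Prop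
  | 0, _, T => T = LinearMap.id
  | d + 1, p, T => ∃ (n : ℕ) (K : Fin n → Matrix (a × b) (a × b) ℂ)
      (S : Fin n → SuperOp (a × b) (a × b)), (∀ i, IsLocal p (K i)) ∧ ∑ i, (K i)ᴴ * K i = 1 ∧
        (∀ i, IsRounds d (!p) (S i)) ∧ T = ∑ i, S i ∘ₗ conjBy (K i)

theorem IsRounds.prepend {d : ℕ} {p : Bool} {T : SuperOp (a × b) (a × b)} (h : IsRounds d (!p) T) :
    IsRounds (d + 1) p T :=
  ⟨1, fun _ => 1, fun _ => T, fun _ => isLocal_one p, by simp, fun _ => h, by simp [conjBy_one]⟩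

theorem IsRounds.succ {d : ℕ} {p : Bool} {T : SuperOp (a × b) (a × b)} (h : IsRounds d p T) :
    IsRounds (d + 1) p T := by
  induction d generalizing p T with
  | zero => exact IsRounds.prepend h
  | succ d ih =>
    obtain ⟨n, K, S, hK, hsum, hS, rfl⟩ := h
    exact ⟨n, K, S, hK, hsum, fun i => ih (hS i), rfl⟩

theorem IsRounds.mono {d d' : ℕ} (hd : d ≤ d') {p : Bool} {T : SuperOp (a × b) (a × b)}
    (h : IsRounds d p T) : IsRounds d' p T := by
  induction hd with
  | refl => exact h
  | step _ ih => exact ih.succ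

theorem IsLOCC.exists_isRounds {T : SuperOp (a × b) (a × b)} (hT : IsLOCC T) (p : Bool) :
    ∃ d, IsRounds d p T := by
  -- if the wrong party is first, it is given a trivial first round
  have turn : ∀ (q : Bool) {T : SuperOp (a × b) (a × b)}, (∃ d, IsRounds d q T) →
      ∀ p, ∃ d, IsRounds d p T := by
    rintro q T ⟨d, hd⟩ p
    rcases Bool.eq_or_eq_not p q with rfl | rfl
    · exact ⟨d, hd⟩
    · exact ⟨d + 1, IsRounds.prepend (by simpa using hd)⟩
  induction hT generalizing p with
  | done => exact ⟨0, rfl⟩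
  | alice n K hK S hS ih =>
    refine turn true ?_ p
    choose d hd using fun i => ih i false
    refine ⟨Finset.univ.sup d + 1, n, fun i => K i ⊗ₖ 1, S, fun i => ⟨K i, rfl⟩, ?_,
      fun i => (hd i).mono (Finset.le_sup (Finset.mem_univ i)), rfl⟩
    simp only [Matrix.conjTranspose_kronecker, Matrix.conjTranspose_one, ← Matrix.mul_kronecker_mul,
      Matrix.one_mul]
    rw [← Matrix.one_kronecker_one, ← hK]
    ext i j
    simp [Matrix.sum_apply, Finset.sum_mul]
  | bob n K hK S hS ih =>
    refine turn false ?_ p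
    choose d hd using fun i => ih i true
    refine ⟨Finset.univ.sup d + 1, n, fun i => 1 ⊗ₖ K i, S, fun i => ⟨K i, rfl⟩, ?_,
      fun i => (hd i).mono (Finset.le_sup (Finset.mem_univ i)), rfl⟩
    simp only [Matrix.conjTranspose_kronecker, Matrix.conjTranspose_one, ← Matrix.mul_kronecker_mul,
      Matrix.one_mul]
    rw [← Matrix.one_kronecker_one, ← hK]
    ext i j
    simp [Matrix.sum_apply, Finset.mul_sum]

/-- The party whose turn it is in round `l` if `p` tells whether Alice is first. -/
def party : Bool → ℕ → Bool
  | p, 0 => p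
  | p, l + 1 => party (!p) l

theorem party_succ_eq_not (p : Bool) (l : ℕ) : party p (l + 1) = !party p l := by
  induction l generalizing p with
  | zero => rfl
  | succ l ih => rw [party, ih, party]

end Rounds

/-- The map implemented in `d` rounds from round `l` on by a token `x`, if in round `l'` the token
`x'` becomes `y` under the Kraus operator `K l' x' y`. -/
def tokenMap {M V : Type*} [Fintype M] [Fintype V] [DecidableEq M] (K : ℕ → V → V → Matrix M M ℂ) :
    ℕ → ℕ → V → SuperOp M M
  | 0, _, _ => LinearMap.id
  | d + 1, l, x => ∑ y, tokenMap K d (l + 1) y ∘ₗ conjBy (K l x y)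

section Tokens

variable {a b : Type*} [Fintype a] [Fintype b] [DecidableEq a] [DecidableEq b]

/-- The decision tree of an LOCC map, with its nodes as tokens. -/
theorem IsRounds.exists_tree {d : ℕ} {p : Bool} {T : SuperOp (a × b) (a × b)}
    (hT : IsRounds d p T) : ∃ (V : Type) (_ : Fintype V) (_ : DecidableEq V)
      (K : ℕ → V → V → Matrix (a × b) (a × b) ℂ) (root : V),
      (∀ l x y, IsLocal (party p l) (K l x y)) ∧ (∀ l x, ∑ y, (K l x y)ᴴ * K l x y = 1) ∧
      tokenMap K d 0 root = T := by
  induction d generalizing p T with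
  | zero =>
    exact ⟨Unit, inferInstance, inferInstance, fun _ _ _ => 1, (), fun _ _ _ => isLocal_one _,
      by simp, hT.symm⟩
  | succ d ih =>
    obtain ⟨n, K, S, hK, hsum, hS, rfl⟩ := hT
    choose V hV hV' L root hL hLsum hLT using fun i => ih (hS i)
    -- the new root is `none`, and the trees of the outcomes are placed side by side
    let L' : ℕ → Option (Σ i, V i) → Option (Σ i, V i) → Matrix (a × b) (a × b) ℂ :=
      fun l x y => match l, x, y with
        | 0, none, none => 0
        | 0, none, some s => if s.2 = root s.1 then K s.1 else 0
        | l + 1, none, none => 1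
        | l + 1, none, some _ => 0
        | 0, some s, t => if t = some s then 1 else 0
        | l + 1, some _, none => 0
        | l + 1, some s, some t => if h : t.1 = s.1 then L s.1 l s.2 (h ▸ t.2) else 0
    have hdep : ∀ {X : Type _} [AddCommMonoid X] (i : Fin n) (F : V i → X),
        ∑ t : Σ i, V i, (if h : t.1 = i then F (h ▸ t.2) else 0) = ∑ y, F y := by
      intro X _ i F
      rw [Fintype.sum_sigma, Finset.sum_eq_single i]
      · simp
      · intro j _ hj
        exact Finset.sum_eq_zero fun y _ => dif_neg hj
      · simp
    refine ⟨Option (Σ i, V i), inferInstance, inferInstance, L', none, ?_, ?_, ?_⟩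
    · intro l x y
      rcases l with _ | l <;> rcases x with _ | s <;> rcases y with _ | t
      · exact isLocal_zero _
      · simp only [L']
        split_ifs
        · exact hK _
        · exact isLocal_zero _
      · rw [show L' 0 (some s) none = 0 from if_neg (by simp)]
        exact isLocal_zero _
      · simp only [L']
        split_ifs
        · exact isLocal_one _
        · exact isLocal_zero _
      · exact isLocal_one _
      · exact isLocal_zero _
      · exact isLocal_zero _
      · simp only [L']
        split_ifs
        · exact hL _ _ _ _
        · exact isLocal_zero _
    · intro l x
      rcases l with _ | l <;> rcases x with _ | s
      · rw [Fintype.sum_option, Fintype.sum_sigma]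
        simp only [L', Matrix.conjTranspose_zero, Matrix.zero_mul, zero_add]
        rw [← hsum]
        refine Finset.sum_congr rfl fun i _ => ?_
        rw [Finset.sum_eq_single (root i)]
        · simp
        · intro y _ hy
          simp [hy]
        · simp
      · rw [Finset.sum_eq_single (some s)]
        · simp [L']
        · intro y _ hy
          simp [L', hy]
        · simp
      · rw [Fintype.sum_option]
        simp [L']
      · rw [Fintype.sum_option, ← hLsum s.1 l s.2, ← hdep s.1]
        simp only [L', Matrix.conjTranspose_zero, Matrix.zero_mul, zero_add]
        refine Finset.sum_congr rfl fun t _ => ?_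
        split_ifs <;> simp
    · have hsub : ∀ e l i (x : V i),
          tokenMap L' e (l + 1) (some ⟨i, x⟩) = tokenMap (L i) e l x := by
        intro e
        induction e with
        | zero => intro l i x; rfl
        | succ e ihe =>
          intro l i x
          rw [tokenMap, tokenMap, Fintype.sum_option, ← hdep i]
          simp only [L', conjBy_zero, LinearMap.comp_zero, zero_add]
          refine Finset.sum_congr rfl fun t _ => ?_
          obtain ⟨j, t⟩ := t
          split_ifs with h
          · simp only at h
            subst h
            rw [ihe]
          · rw [conjBy_zero, LinearMap.comp_zero]
      rw [tokenMap, Fintype.sum_option, Fintype.sum_sigma]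
      simp only [L', conjBy_zero, LinearMap.comp_zero, zero_add]
      refine Finset.sum_congr rfl fun i _ => ?_
      rw [Finset.sum_eq_single (root i), hsub, hLT]
      · simp
      · intro y _ hy
        simp [hy, conjBy_zero]
      · simp

/-- The tokens of an LOCC map as non-zero values of registers. -/
theorem IsRounds.exists_tokens {d : ℕ} {p : Bool} {T : SuperOp (a × b) (a × b)}
    (hT : IsRounds d p T) : ∃ (n : ℕ)
      (K : ℕ → Fin (n + 1) → Fin (n + 1) → Matrix (a × b) (a × b) ℂ) (root : Fin (n + 1)),
      root ≠ 0 ∧ (∀ l x y, IsLocal (party p l) (K l x y)) ∧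
      (∀ l x, ∑ y, (K l x y)ᴴ * K l x y = 1) ∧ (∀ l, K l 0 0 = 1) ∧
      (∀ l y, y ≠ 0 → K l 0 y = 0) ∧ (∀ l x, x ≠ 0 → K l x 0 = 0) ∧
      tokenMap K d 0 root = T := by
  obtain ⟨V, hV, hV', L, root, hL, hLsum, rfl⟩ := hT.exists_tree
  let e := Fintype.equivFin V
  let K : ℕ → Fin (Fintype.card V + 1) → Fin (Fintype.card V + 1) → Matrix (a × b) (a × b) ℂ :=
    fun l x y => Fin.cases (Fin.cases 1 (fun _ => 0) y)
      (fun x => Fin.cases 0 (fun y => L l (e.symm x) (e.symm y)) y) x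
  have h00 : ∀ l, K l 0 0 = 1 := fun l => rfl
  have h0s : ∀ l y, K l 0 (Fin.succ y) = 0 := fun l y => rfl
  have hs0 : ∀ l x, K l (Fin.succ x) 0 = 0 := fun l x => rfl
  have hss : ∀ l x y, K l (Fin.succ x) (Fin.succ y) = L l (e.symm x) (e.symm y) :=
    fun l x y => rfl
  refine ⟨Fintype.card V, K, (e root).succ, Fin.succ_ne_zero _, ?_, ?_, h00, ?_, ?_, ?_⟩
  · intro l x y
    refine Fin.cases ?_ (fun x => ?_) x <;> refine Fin.cases ?_ (fun y => ?_) y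
    · rw [h00]; exact isLocal_one _
    · rw [h0s]; exact isLocal_zero _
    · rw [hs0]; exact isLocal_zero _
    · rw [hss]; exact hL _ _ _
  · intro l x
    refine Fin.cases ?_ (fun x => ?_) x
    · rw [Fin.sum_univ_succ]
      simp [h00, h0s]
    · rw [Fin.sum_univ_succ]
      simp only [hs0, hss, Matrix.conjTranspose_zero, Matrix.zero_mul, zero_add]
      rw [Equiv.sum_comp e.symm fun y => (L l (e.symm x) y)ᴴ * L l (e.symm x) y]
      exact hLsum _ _
  · intro l y hy
    obtain ⟨y, rfl⟩ := Fin.exists_succ_eq.2 hy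
    exact h0s l y
  · intro l x hx
    obtain ⟨x, rfl⟩ := Fin.exists_succ_eq.2 hx
    exact hs0 l x
  · have : ∀ d l x, tokenMap K d l (Fin.succ x) = tokenMap L d l (e.symm x) := by
      intro d
      induction d with
      | zero => intro l x; rfl
      | succ d ih =>
        intro l x
        rw [tokenMap, tokenMap, Fin.sum_univ_succ]
        simp only [hs0, hss, conjBy_zero, LinearMap.comp_zero, zero_add, ih]
        exact Equiv.sum_comp e.symm fun y => tokenMap L d (l + 1) y ∘ₗ conjBy (L l (e.symm x) y)
    rw [this, Equiv.symm_apply_apply]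

end Tokens

namespace Pipeline

variable {M : Type*} [Fintype M] [DecidableEq M]

theorem protocol_eq_tokenMap (P : Pipeline M) :
    P.protocol = tokenMap P.K (P.m + 1) 0 P.root := by
  have : ∀ e j, ∑ y, P.path (j + e) y = ∑ y, tokenMap P.K e (j + 1) y ∘ₗ P.path j y := by
    intro e
    induction e with
    | zero => intro j; rfl
    | succ e ih =>
      intro j
      rw [show j + (e + 1) = (j + 1) + e by ring, ih]
      ext1 X
      simp only [path, tokenMap, LinearMap.sum_apply, LinearMap.comp_apply, map_sum]
      exact Finset.sum_comm
  have h := this P.m 0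
  rw [zero_add] at h
  rw [protocol, h]
  rfl

/-- The Kraus operators of a pipeline in which the sites are alternately the sender's and the
receiver's registers of a sequence of channels: the transfers from senders to receivers do not act
on the main system. -/
def interleave {V : Type*} [DecidableEq V] (K : ℕ → V → V → Matrix M M ℂ) (l : ℕ) (x y : V) :
    Matrix M M ℂ :=
  if l % 2 = 0 then K (l / 2) x y else if y = x then 1 else 0

omit [Fintype M] in
theorem interleave_even {V : Type*} [DecidableEq V] (K : ℕ → V → V → Matrix M M ℂ) (l : ℕ)
    (x y : V) : interleave K (2 * l) x y = K l x y := by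
  simp [interleave]

omit [Fintype M] in
theorem interleave_odd {V : Type*} [DecidableEq V] (K : ℕ → V → V → Matrix M M ℂ) (l : ℕ)
    (x y : V) : interleave K (2 * l + 1) x y = if y = x then 1 else 0 := by
  rw [interleave, if_neg (by omega)]

theorem tokenMap_interleave {V : Type*} [Fintype V] [DecidableEq V] (K : ℕ → V → V → Matrix M M ℂ)
    (d : ℕ) (x : V) :
    tokenMap (interleave K) (2 * d + 1) 0 x = tokenMap K (d + 1) 0 x := by
  have : ∀ d l x, tokenMap (interleave K) (2 * d) (2 * l + 1) x = tokenMap K d (l + 1) x := by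
    intro d
    induction d with
    | zero => intro l x; rfl
    | succ d ih =>
      intro l x
      rw [show 2 * (d + 1) = 2 * d + 1 + 1 by ring, tokenMap, Finset.sum_eq_single x]
      · rw [interleave_odd, if_pos rfl, conjBy_one, LinearMap.comp_id, tokenMap, tokenMap]
        refine Finset.sum_congr rfl fun y _ => ?_
        rw [show 2 * l + 1 + 1 = 2 * (l + 1) by ring, ih, interleave_even]
      · intro y _ hy
        rw [interleave_odd, if_neg hy, conjBy_zero, LinearMap.comp_zero]
      · simp
  rw [tokenMap, tokenMap]
  refine Finset.sum_congr rfl fun y _ => ?_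
  have h1 := this d 0 y
  have h2 := interleave_even K 0 x y
  simp only [mul_zero, zero_add] at h1 h2
  rw [zero_add, h1, h2]

end Pipeline

/-! ### Building Lindblad generators and completely positive maps -/

section Lindblad

variable {n : Type*} [Fintype n]

theorem isLindblad_zero : IsLindblad (0 : SuperOp n n) :=
  ⟨0, Matrix.isHermitian_zero, 0, Fin.elim0, fun X => by simp⟩

theorem IsLindblad.add {𝔏 𝔏' : SuperOp n n} (h : IsLindblad 𝔏) (h' : IsLindblad 𝔏') :
    IsLindblad (𝔏 + 𝔏') := by
  obtain ⟨H, hH, N, L, hL⟩ := h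
  obtain ⟨H', hH', N', L', hL'⟩ := h'
  refine ⟨H + H', hH.add hH', N + N', Fin.append L L', fun X => ?_⟩
  rw [LinearMap.add_apply, hL, hL', Fin.sum_univ_add]
  simp only [Fin.append_left, Fin.append_right]
  rw [Matrix.add_mul, Matrix.mul_add, add_add_add_comm, ← smul_add]
  congr 2
  abel

theorem isLindblad_sum {ι : Type*} (s : Finset ι) {𝔏 : ι → SuperOp n n}
    (h : ∀ i ∈ s, IsLindblad (𝔏 i)) : IsLindblad (∑ i ∈ s, 𝔏 i) :=
  Finset.sum_induction _ _ (fun _ _ => IsLindblad.add) isLindblad_zero h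

/-- Jumps at the rate `c` into the outcomes of an instrument form a Lindblad generator. -/
theorem isLindblad_jump {ι : Type*} [Fintype ι] [DecidableEq n] {K : ι → Matrix n n ℂ}
    (hK : ∑ i, (K i)ᴴ * K i = 1) {c : ℝ} (hc : 0 ≤ c) :
    IsLindblad ((c : ℂ) • (∑ i, conjBy (K i) - LinearMap.id)) := by
  refine ⟨0, Matrix.isHermitian_zero, Fintype.card ι,
    fun k => ((√c : ℝ) : ℂ) • K ((Fintype.equivFin ι).symm k), fun X => ?_⟩
  have hs : ((√c : ℝ) : ℂ) * ((√c : ℝ) : ℂ) = (c : ℂ) := by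
    rw [← Complex.ofReal_mul, Real.mul_self_sqrt hc]
  rw [Equiv.sum_comp (Fintype.equivFin ι).symm fun i =>
    ((√c : ℝ) : ℂ) • K i * X * (((√c : ℝ) : ℂ) • K i)ᴴ - (1 / 2 : ℂ) •
      ((((√c : ℝ) : ℂ) • K i)ᴴ * (((√c : ℝ) : ℂ) • K i) * X
        + X * ((((√c : ℝ) : ℂ) • K i)ᴴ * (((√c : ℝ) : ℂ) • K i)))]
  simp only [Matrix.conjTranspose_smul, Complex.star_def, Complex.conj_ofReal, Matrix.smul_mul,
    Matrix.mul_smul, smul_smul, hs, Matrix.zero_mul, Matrix.mul_zero, sub_self, smul_zero, zero_add,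
    Finset.sum_sub_distrib, ← smul_add, ← Finset.smul_sum, Finset.sum_add_distrib]
  rw [← Finset.sum_mul, ← Finset.mul_sum, hK, Matrix.one_mul, Matrix.mul_one]
  simp only [LinearMap.smul_apply, LinearMap.sub_apply, LinearMap.sum_apply, LinearMap.id_apply,
    smul_sub]
  congr 1
  rw [← two_smul ℂ X, smul_smul]
  congr 1
  ring

end Lindblad

section Ampliation

variable {l m n r : Type*}

theorem ampliate_conjBy [Fintype m] [Fintype r] [DecidableEq r] (A : Matrix n m ℂ) :
    ampliate r (conjBy A) = conjBy (A ⊗ₖ (1 : Matrix r r ℂ)) := by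
  ext1 X
  ext p q
  simp [ampliate, conjBy, Matrix.mul_apply, Fintype.sum_prod_type, Matrix.one_apply,
    Finset.sum_mul, apply_ite]

theorem isCompletelyPositive_conjBy [Fintype m] [Fintype n] (A : Matrix n m ℂ) :
    IsCompletelyPositive (conjBy A) := fun k X hX => by
  rw [ampliate_conjBy]
  exact hX.mul_mul_conjTranspose_same _

theorem IsCompletelyPositive.comp [Fintype l] [Fintype m] [Fintype n] {Φ : SuperOp m n}
    {Ψ : SuperOp l m} (hΦ : IsCompletelyPositive Φ) (hΨ : IsCompletelyPositive Ψ) :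
    IsCompletelyPositive (Φ ∘ₗ Ψ) := fun k X hX => hΦ k _ (hΨ k X hX)

theorem IsCompletelyPositive.smul [Fintype m] [Fintype n] {Φ : SuperOp m n}
    (hΦ : IsCompletelyPositive Φ) {c : ℝ} (hc : 0 ≤ c) :
    IsCompletelyPositive ((c : ℂ) • Φ) := fun k X hX => by
  have := (hΦ k X hX).smul (show (0 : ℂ) ≤ (c : ℂ) by exact_mod_cast hc)
  exact this

theorem isCompletelyPositive_sum [Fintype m] [Fintype n] {ι : Type*} (s : Finset ι)
    {Φ : ι → SuperOp m n} (h : ∀ i ∈ s, IsCompletelyPositive (Φ i)) :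
    IsCompletelyPositive (∑ i ∈ s, Φ i) := by
  refine Finset.sum_induction _ _ (fun Φ Ψ hΦ hΨ k X hX => ?_) (fun k X _ => ?_) h
  · exact (hΦ k X hX).add (hΨ k X hX)
  · exact Matrix.PosSemidef.zero

end Ampliation

/-! ### Diagonal blocks of the total state -/

section Controlled

variable {m R Y : Type*} [Fintype m] [Fintype R] [Fintype Y] [DecidableEq R]

/-- The instrument that, on a register in the basis state `r`, applies `A r y` to the main system
and sets the register to `f r y`; the register is decohered. -/
def controlled (A : R → Y → Matrix m m ℂ) (f : R → Y → R) : SuperOp (m × R) (m × R) :=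
  ∑ z : R × Y, conjBy (A z.1 z.2 ⊗ₖ Matrix.single (f z.1 z.2) z.1 (1 : ℂ))

theorem sum_controlled [DecidableEq m] {A : R → Y → Matrix m m ℂ}
    (hA : ∀ r, ∑ y, (A r y)ᴴ * A r y = 1) (f : R → Y → R) :
    ∑ z : R × Y, (A z.1 z.2 ⊗ₖ Matrix.single (f z.1 z.2) z.1 (1 : ℂ))ᴴ *
      (A z.1 z.2 ⊗ₖ Matrix.single (f z.1 z.2) z.1 (1 : ℂ)) = 1 := by
  simp only [Matrix.conjTranspose_kronecker, ← Matrix.mul_kronecker_mul,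
    Matrix.conjTranspose_single, Matrix.single_mul_single_same, star_one, mul_one,
    Fintype.sum_prod_type]
  ext ⟨i, r⟩ ⟨j, s⟩
  simp only [Matrix.sum_apply, Matrix.kroneckerMap_apply, ← Finset.sum_mul]
  have : ∀ q, ∑ y, ((A q y)ᴴ * A q y) i j = (1 : Matrix m m ℂ) i j := fun q => by
    rw [← hA q, Matrix.sum_apply]
  simp only [this, Matrix.single_apply, Matrix.one_apply, Prod.mk.injEq]
  by_cases hi : i = j <;> by_cases hr : r = s <;> simp [hi, hr]

theorem isLindblad_controlled [DecidableEq m] {A : R → Y → Matrix m m ℂ}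
    (hA : ∀ r, ∑ y, (A r y)ᴴ * A r y = 1) (f : R → Y → R) {c : ℝ} (hc : 0 ≤ c) :
    IsLindblad ((c : ℂ) • (controlled A f - LinearMap.id)) :=
  isLindblad_jump (sum_controlled hA f) hc

theorem controlled_apply (A : R → Y → Matrix m m ℂ) (f : R → Y → R)
    (X : Matrix (m × R) (m × R) ℂ) (i j : m) (s : R) :
    controlled A f X (i, s) (j, s) = ∑ r, ∑ y,
      if f r y = s then (A r y * (Matrix.of fun i j => X (i, r) (j, r)) * (A r y)ᴴ) i j else 0 := by
  simp only [controlled, LinearMap.sum_apply, Matrix.sum_apply, Fintype.sum_prod_type]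
  refine Finset.sum_congr rfl fun r _ => Finset.sum_congr rfl fun y _ => ?_
  split_ifs with h
  · simp [conjBy, Matrix.mul_apply, Fintype.sum_prod_type, Matrix.single_apply, h,
      Finset.sum_mul, apply_ite]
  · simp [conjBy, Matrix.mul_apply, h]

end Controlled

section Blocks

variable {a b : Type*} (N : ChannelFamily)

/-- The diagonal block of an operator at given basis states of all registers. -/
def blockAt (a b : Type*) (p : Registers N × Registers N) :
    SuperOp (Total a b N) (a × b) where
  toFun ρ := Matrix.of fun x y => ρ ((x.1, p.1), (x.2, p.2)) ((y.1, p.1), (y.2, p.2))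
  map_add' _ _ := rfl
  map_smul' _ _ := rfl

theorem blockAt_apply (p : Registers N × Registers N) (ρ : Matrix (Total a b N) (Total a b N) ℂ)
    (x y : a × b) : blockAt N a b p ρ x y = ρ ((x.1, p.1), (x.2, p.2)) ((y.1, p.1), (y.2, p.2)) :=
  rfl

theorem isCompletelyPositive_blockAt [Fintype a] [Fintype b] (p : Registers N × Registers N) :
    IsCompletelyPositive (blockAt N a b p) := fun k _ hX =>
  hX.submatrix fun z : (a × b) × Fin k => (((z.1.1, p.1), (z.1.2, p.2)), z.2)

theorem blockAt_posSemidef (p : Registers N × Registers N)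
    {ρ : Matrix (Total a b N) (Total a b N) ℂ}
    (hρ : ρ.PosSemidef) : (blockAt N a b p ρ).PosSemidef :=
  hρ.submatrix fun z : a × b => ((z.1, p.1), (z.2, p.2))

theorem sum_blockAt (ρ : Matrix (Total a b N) (Total a b N) ℂ) :
    ∑ p, blockAt N a b p ρ = reducedState N ρ := by
  ext x y
  simp [Matrix.sum_apply, blockAt_apply, reducedState, Fintype.sum_prod_type]

theorem sum_rtr_blockAt [Fintype a] [Fintype b] (ρ : Matrix (Total a b N) (Total a b N) ℂ) :
    ∑ p, rtr (blockAt N a b p ρ) = rtr ρ := by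
  rw [← map_sum, sum_blockAt, rtr_apply, rtr_apply]
  congr 1
  simp only [Matrix.trace, Matrix.diag_apply, reducedState, Matrix.of_apply, Fintype.sum_prod_type]
  refine Finset.sum_congr rfl fun x _ => ?_
  rw [Finset.sum_comm]

theorem blockAt_main (p : Registers N × Registers N) (𝔏 : SuperOp (a × b) (a × b))
    (ρ : Matrix (Total a b N) (Total a b N) ℂ) :
    blockAt N a b p (actOn (Equiv.prodProdProdComm a (Registers N) b (Registers N)) 𝔏 ρ)
      = 𝔏 (blockAt N a b p ρ) := rfl

variable {Y : Type*} [Fintype Y] [Fintype a] [Fintype b]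

theorem blockAt_alice [DecidableEq b] (A : Registers N → Y → Matrix a a ℂ)
    (f : Registers N → Y → Registers N)
    (ρ : Matrix (Total a b N) (Total a b N) ℂ) (p : Registers N × Registers N) :
    blockAt N a b p (actOn (Equiv.refl _) (controlled A f) ρ)
      = push (fun q y => A q.1 y ⊗ₖ (1 : Matrix b b ℂ)) (fun q y => (f q.1 y, q.2))
        (fun q => blockAt N a b q ρ) p := by
  obtain ⟨r, s⟩ := p
  ext ⟨x, x'⟩ ⟨y, y'⟩
  have := controlled_apply A f
    (Matrix.of fun i j => ρ (i, (x', s)) (j, (y', s))) x y r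
  refine Eq.trans this ?_
  rw [push_apply, Fintype.sum_prod_type]
  simp only [Matrix.sum_apply]
  refine Finset.sum_congr rfl fun r' _ => ?_
  rw [Finset.sum_eq_single s]
  · refine Finset.sum_congr rfl fun z _ => ?_
    simp only [Prod.mk.injEq, and_true]
    split_ifs
    · simp [blockAt_apply, Matrix.mul_apply, Fintype.sum_prod_type, Matrix.one_apply,
        Finset.sum_mul, apply_ite]
    · rfl
  · intro s' _ hs
    exact Finset.sum_eq_zero fun z _ => by simp [hs]
  · simp

theorem blockAt_bob [DecidableEq a] (A : Registers N → Y → Matrix b b ℂ)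
    (f : Registers N → Y → Registers N)
    (ρ : Matrix (Total a b N) (Total a b N) ℂ) (p : Registers N × Registers N) :
    blockAt N a b p (actOn (Equiv.prodComm _ _) (controlled A f) ρ)
      = push (fun q y => (1 : Matrix a a ℂ) ⊗ₖ A q.2 y) (fun q y => (q.1, f q.2 y))
        (fun q => blockAt N a b q ρ) p := by
  obtain ⟨r, s⟩ := p
  ext ⟨x, x'⟩ ⟨y, y'⟩
  have := controlled_apply A f
    (Matrix.of fun i j => ρ ((x, r), i) ((y, r), j)) x' y' s
  refine Eq.trans this ?_
  rw [push_apply, Fintype.sum_prod_type_right]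
  simp only [Matrix.sum_apply]
  refine Finset.sum_congr rfl fun s' _ => ?_
  rw [Finset.sum_eq_single r]
  · refine Finset.sum_congr rfl fun z _ => ?_
    simp only [Prod.mk.injEq, true_and]
    split_ifs
    · simp [blockAt_apply, Matrix.mul_apply, Fintype.sum_prod_type, Matrix.one_apply,
        Finset.sum_mul, apply_ite]
    · rfl
  · intro r' _ hr
    exact Finset.sum_eq_zero fun z _ => by simp [hr]
  · simp

theorem actOn_add {S m r : Type*} (e : S ≃ m × r) (Φ Ψ : SuperOp m m) :
    actOn e (Φ + Ψ) = actOn e Φ + actOn e Ψ := rfl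

theorem actOn_smul_sub_id {S m r : Type*} (e : S ≃ m × r) (c : ℂ) (Φ : SuperOp m m) :
    actOn e (c • (Φ - LinearMap.id)) = c • (actOn e Φ - LinearMap.id) := by
  ext1 X
  ext i j
  simp [actOn, ampliate, Matrix.reindexLinearEquiv]

theorem actOn_sum {S m r ι : Type*} (e : S ≃ m × r) (s : Finset ι) (Φ : ι → SuperOp m m) :
    actOn e (∑ i ∈ s, Φ i) = ∑ i ∈ s, actOn e (Φ i) := by
  let F : SuperOp m m →+ SuperOp S S :=
    { toFun := actOn e, map_zero' := rfl, map_add' := fun _ _ => rfl }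
  exact map_sum F _ _

/-- Each row of `regOp` has at most one non-zero entry, so that conjugation with it produces
diagonal blocks from diagonal blocks only. -/
theorem regOp_mul_star (c : Fin N.num) (i j : Fin (N.size c + 1)) (r r₁ r₂ : Registers N) :
    regOp N c i j r r₁ * star (regOp N c i j r r₂)
      = if r₁ = r₂ then regOp N c i j r r₁ else 0 := by
  simp only [regOp, Matrix.of_apply]
  by_cases h : r₁ = r₂
  · subst h
    rw [if_pos rfl]
    split_ifs <;> simp
  · rw [if_neg h]
    by_cases h1 : r₁ c = j ∧ r = Function.update r₁ c i
    · by_cases h2 : r₂ c = j ∧ r = Function.update r₂ c i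
      · refine absurd ?_ h
        have e1 : r₁ = Function.update r c j := by
          rw [h1.2, Function.update_idem, ← h1.1, Function.update_eq_self]
        have e2 : r₂ = Function.update r c j := by
          rw [h2.2, Function.update_idem, ← h2.1, Function.update_eq_self]
        rw [e1, e2]
      · rw [if_neg h2]; simp
    · rw [if_neg h1]; simp

theorem blockAt_onRegisters [DecidableEq a] [DecidableEq b]
    {X Y : Matrix (Registers N) (Registers N) ℂ}
    (hX : ∀ r r₁ r₂, X r r₁ * star (X r r₂) = if r₁ = r₂ then X r r₁ else 0)
    (hY : ∀ r r₁ r₂, Y r r₁ * star (Y r r₂) = if r₁ = r₂ then Y r r₁ else 0)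
    (ρ : Matrix (Total a b N) (Total a b N) ℂ) (p : Registers N × Registers N) :
    blockAt N a b p (conjBy (onRegisters a b N X Y) ρ)
      = ∑ q, (X p.1 q.1 * Y p.2 q.2) • blockAt N a b q ρ := by
  obtain ⟨r, s⟩ := p
  ext ⟨x, x'⟩ ⟨y, y'⟩
  have h : ∀ (r₁ r₂ s₁ s₂ : Registers N) (z : ℂ),
      X r r₁ * Y s s₁ * z * (star (X r r₂) * star (Y s s₂))
        = if r₁ = r₂ then (if s₁ = s₂ then X r r₁ * Y s s₁ * z else 0) else 0 := by
    intro r₁ r₂ s₁ s₂ z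
    rw [show X r r₁ * Y s s₁ * z * (star (X r r₂) * star (Y s s₂))
      = (X r r₁ * star (X r r₂)) * (Y s s₁ * star (Y s s₂)) * z by ring, hX, hY]
    split_ifs <;> simp
  have e : ∀ (u u' : a) (w w' : b) (r₁ s₁ : Registers N),
      onRegisters a b N X Y ((u, r), (w, s)) ((u', r₁), (w', s₁))
        = if u = u' then (if w = w' then X r r₁ * Y s s₁ else 0) else 0 := by
    intro u u' w w' r₁ s₁
    by_cases hu : u = u' <;> by_cases hw : w = w' <;> simp [onRegisters, hu, hw]
  simp only [blockAt_apply, conjBy, LinearMap.coe_mk, AddHom.coe_mk, Matrix.mul_apply,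
    Matrix.conjTranspose_apply, Fintype.sum_prod_type, e, Matrix.sum_apply, Matrix.smul_apply,
    smul_eq_mul]
  simp only [apply_ite star, star_zero, ite_mul, mul_ite, zero_mul, mul_zero, Finset.sum_ite_eq,
    Finset.sum_ite_irrel, Finset.sum_const_zero, Finset.mem_univ, if_true, star_mul',
    Finset.sum_mul, h]
  simp

end Blocks

/-! ### Channels and blocks -/

section ChannelBlocks

variable {a b : Type*} [Fintype a] [Fintype b] [DecidableEq a] [DecidableEq b] (N : ChannelFamily)

/-- The effect of one use of channel `c` on the basis states of the registers. -/
def transmit (c : Fin N.num) (q : Registers N × Registers N) : Registers N × Registers N :=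
  if N.aliceToBob c then (Function.update q.1 c 0, Function.update q.2 c (q.1 c))
  else (Function.update q.1 c (q.2 c), Function.update q.2 c 0)

theorem blockAt_channelMap (c : Fin N.num) (ρ : Matrix (Total a b N) (Total a b N) ℂ)
    (p : Registers N × Registers N) :
    blockAt N a b p (channelMap a b N c ρ)
      = ∑ q, if transmit N c q = p then blockAt N a b q ρ else 0 := by
  simp only [channelMap, LinearMap.sum_apply, map_sum]
  have h : ∀ i k, blockAt N a b p (conjBy (if N.aliceToBob c
      then onRegisters a b N (regOp N c 0 i) (regOp N c i k)
      else onRegisters a b N (regOp N c i k) (regOp N c 0 i)) ρ)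
      = ∑ q, if (if N.aliceToBob c then q.1 c = i ∧ q.2 c = k else q.1 c = k ∧ q.2 c = i) then
        (if transmit N c q = p then blockAt N a b q ρ else 0) else 0 := by
    intro i k
    by_cases hc : N.aliceToBob c = true
    · simp only [hc, if_true]
      rw [blockAt_onRegisters N (regOp_mul_star N c 0 i) (regOp_mul_star N c i k)]
      refine Finset.sum_congr rfl fun q _ => ?_
      by_cases h1 : q.1 c = i ∧ q.2 c = k
      · obtain ⟨rfl, rfl⟩ := h1
        simp only [regOp, Matrix.of_apply, transmit, hc, if_true, true_and, and_self,
          Prod.ext_iff (x := (_, _)), eq_comm (a := p.1), eq_comm (a := p.2)]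
        split_ifs <;> simp_all
      · rw [if_neg h1]
        simp only [regOp, Matrix.of_apply]
        split_ifs <;> simp_all
    · simp only [hc, if_false, Bool.false_eq_true]
      rw [blockAt_onRegisters N (regOp_mul_star N c i k) (regOp_mul_star N c 0 i)]
      refine Finset.sum_congr rfl fun q _ => ?_
      by_cases h1 : q.1 c = k ∧ q.2 c = i
      · obtain ⟨rfl, rfl⟩ := h1
        simp only [regOp, Matrix.of_apply, transmit, hc, if_false, if_true, Bool.false_eq_true,
          true_and, and_self, Prod.ext_iff (x := (_, _)), eq_comm (a := p.1),
          eq_comm (a := p.2)]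
        split_ifs <;> simp_all
      · rw [if_neg h1]
        simp only [regOp, Matrix.of_apply]
        split_ifs <;> simp_all
  simp only [h]
  rw [Finset.sum_congr rfl fun i _ => Finset.sum_comm, Finset.sum_comm]
  refine Finset.sum_congr rfl fun q _ => ?_
  by_cases hc : N.aliceToBob c = true
  · simp [hc, ite_and]
  · simp [hc, ite_and]

end ChannelBlocks

section PushLemmas

variable {Ω Ω' Y M : Type*} [Fintype Ω] [Fintype Ω'] [Fintype Y] [Fintype M] [DecidableEq Ω]
  [DecidableEq Ω']

/-- Relabelling the configurations of a classically controlled instrument. -/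
theorem push_relabel (σ : Ω' ≃ Ω) {K : Ω → Y → Matrix M M ℂ} {f : Ω → Y → Ω}
    {K' : Ω' → Y → Matrix M M ℂ} {f' : Ω' → Y → Ω'} (hK : ∀ q y, K (σ q) y = K' q y)
    (hf : ∀ q y, f (σ q) y = σ (f' q y)) (B : Ω' → Matrix M M ℂ) (ω : Ω) :
    push K f (fun ω => B (σ.symm ω)) ω = push K' f' B (σ.symm ω) := by
  rw [push_apply, push_apply, ← Equiv.sum_comp σ]
  refine Finset.sum_congr rfl fun q _ => Finset.sum_congr rfl fun y _ => ?_
  simp only [hK, hf, Equiv.symm_apply_apply, Equiv.eq_symm_apply]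

/-- An instrument with a single outcome that does not act on the main system. -/
theorem push_relabel_of_classical [DecidableEq M] [DecidableEq Y] (σ : Ω' ≃ Ω)
    {K : Ω → Y → Matrix M M ℂ} {f : Ω → Y → Ω} {g : Ω → Y} {f' : Ω' → Ω'}
    (hK : ∀ ω y, K ω y = if y = g ω then 1 else 0) (hf : ∀ q, f (σ q) (g (σ q)) = σ (f' q))
    (B : Ω' → Matrix M M ℂ) (ω : Ω) :
    push K f (fun ω => B (σ.symm ω)) ω = ∑ q, if f' q = σ.symm ω then B q else 0 := by
  rw [push_apply, ← Equiv.sum_comp σ]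
  refine Finset.sum_congr rfl fun q _ => ?_
  rw [Finset.sum_eq_single (g (σ q))]
  · simp only [hK, hf, Equiv.symm_apply_apply, Equiv.eq_symm_apply, if_true]
    split_ifs <;> simp
  · intro y _ hy
    simp [hK, hy]
  · simp

end PushLemmas

/-! ### Token protocols on a chain of channels -/

section LocalTokens

variable {a b : Type*} [Fintype a] [Fintype b] [DecidableEq a] [DecidableEq b]

/-- The Kraus operators of a protocol in which Alice applies `A l x y` in the even and Bob applies
`B l x y` in the odd rounds `l`. -/
def localKraus {V : Type*} (A : ℕ → V → V → Matrix a a ℂ) (B : ℕ → V → V → Matrix b b ℂ) (l : ℕ)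
    (x y : V) : Matrix (a × b) (a × b) ℂ :=
  if party true l = true then A l x y ⊗ₖ 1 else 1 ⊗ₖ B l x y

variable (a b) in
/-- A protocol of `d + 2` rounds in which the parties take turns and `Fin (n + 1)` labels the nodes
of the decision tree; `0` stands for the absence of a token. -/
structure TokenProtocol where
  d : ℕ
  n : ℕ
  root : Fin (n + 1)
  A : ℕ → Fin (n + 1) → Fin (n + 1) → Matrix a a ℂ
  B : ℕ → Fin (n + 1) → Fin (n + 1) → Matrix b b ℂ
  root_ne : root ≠ 0
  sum_A : ∀ l x, ∑ y, (A l x y)ᴴ * A l x y = 1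
  sum_B : ∀ l x, ∑ y, (B l x y)ᴴ * B l x y = 1
  K_zero_zero : ∀ l, localKraus A B l 0 0 = 1
  K_zero : ∀ l y, y ≠ 0 → localKraus A B l 0 y = 0
  K_empty : ∀ l x, x ≠ 0 → localKraus A B l x 0 = 0

theorem sum_localKraus {V : Type*} [Fintype V] {A : ℕ → V → V → Matrix a a ℂ}
    {B : ℕ → V → V → Matrix b b ℂ} (hA : ∀ l x, ∑ y, (A l x y)ᴴ * A l x y = 1)
    (hB : ∀ l x, ∑ y, (B l x y)ᴴ * B l x y = 1) (l : ℕ) (x : V) :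
    ∑ y, (localKraus A B l x y)ᴴ * localKraus A B l x y = 1 := by
  unfold localKraus
  split_ifs
  · simp only [Matrix.conjTranspose_kronecker, Matrix.conjTranspose_one,
      ← Matrix.mul_kronecker_mul, Matrix.one_mul]
    rw [← Matrix.one_kronecker_one, ← hA l x]
    ext i j
    simp [Matrix.sum_apply, Finset.sum_mul]
  · simp only [Matrix.conjTranspose_kronecker, Matrix.conjTranspose_one,
      ← Matrix.mul_kronecker_mul, Matrix.one_mul]
    rw [← Matrix.one_kronecker_one, ← hB l x]
    ext i j
    simp [Matrix.sum_apply, Finset.mul_sum]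

theorem sum_trivialKraus {m V : Type*} [Fintype m] [DecidableEq m] [Fintype V] [DecidableEq V]
    (x : V) :
    ∑ y, (if y = x then (1 : Matrix m m ℂ) else 0)ᴴ * (if y = x then 1 else 0) = 1 := by
  rw [Finset.sum_eq_single x]
  · simp
  · intro y _ hy
    simp [hy]
  · simp

/-- Every LOCC map has a protocol in which Alice is first and the parties take turns; idle rounds
are appended, so that there is at least one channel. -/
theorem IsLOCC.exists_tokenProtocol [Nonempty a] [Nonempty b] {T : SuperOp (a × b) (a × b)}
    (hT : IsLOCC T) :
    ∃ P : TokenProtocol a b, tokenMap (localKraus P.A P.B) (P.d + 2) 0 P.root = T := by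
  obtain ⟨d, hd⟩ := hT.exists_isRounds true
  obtain ⟨n, K, root, hroot, hloc, hsum, h00, h0, hempty, rfl⟩ :=
    (hd.mono (Nat.le_add_right d 2)).exists_tokens
  have hA : ∀ l x y, ∃ A : Matrix a a ℂ, party true l = true → K l x y = A ⊗ₖ 1 := by
    intro l x y
    by_cases h : party true l = true
    · have := hloc l x y
      rw [IsLocal, if_pos h] at this
      exact ⟨this.choose, fun _ => this.choose_spec⟩
    · exact ⟨0, fun h' => absurd h' h⟩
  have hB : ∀ l x y, ∃ B : Matrix b b ℂ, party true l = false → K l x y = 1 ⊗ₖ B := by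
    intro l x y
    by_cases h : party true l = true
    · exact ⟨0, fun h' => by simp [h] at h'⟩
    · have := hloc l x y
      rw [IsLocal, if_neg h] at this
      exact ⟨this.choose, fun _ => this.choose_spec⟩
  choose A hA using hA
  choose B hB using hB
  let A' : ℕ → Fin (n + 1) → Fin (n + 1) → Matrix a a ℂ := fun l x y =>
    if party true l = true then A l x y else if y = x then 1 else 0
  let B' : ℕ → Fin (n + 1) → Fin (n + 1) → Matrix b b ℂ := fun l x y =>
    if party true l = true then if y = x then 1 else 0 else B l x y
  have hK : localKraus A' B' = K := by
    funext l x y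
    by_cases h : party true l = true
    · simp [localKraus, A', h, hA l x y h]
    · have h' : party true l = false := by simpa using h
      simp [localKraus, B', h', hB l x y h']
  refine ⟨⟨d, n, root, A', B', hroot, ?_, ?_, ?_, ?_, ?_⟩, ?_⟩
  · intro l x
    by_cases h : party true l = true
    · simp only [A', h, if_true]
      obtain ⟨w⟩ := ‹Nonempty b›
      ext i j
      have := congrFun (congrFun (hsum l x) (i, w)) (j, w)
      simp only [hA l x _ h, Matrix.conjTranspose_kronecker, Matrix.conjTranspose_one,
        ← Matrix.mul_kronecker_mul, Matrix.one_mul, Matrix.sum_apply] at this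
      simpa [Matrix.sum_apply, Matrix.one_apply] using this
    · simp only [A', h, if_false, Bool.false_eq_true]
      exact sum_trivialKraus x
  · intro l x
    by_cases h : party true l = true
    · simp only [B', h, if_true]
      exact sum_trivialKraus x
    · have h' : party true l = false := by simpa using h
      simp only [B', h, if_false, Bool.false_eq_true]
      obtain ⟨w⟩ := ‹Nonempty a›
      ext i j
      have := congrFun (congrFun (hsum l x) (w, i)) (w, j)
      simp only [hB l x _ h', Matrix.conjTranspose_kronecker, Matrix.conjTranspose_one,
        ← Matrix.mul_kronecker_mul, Matrix.one_mul, Matrix.sum_apply] at this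
      simpa [Matrix.sum_apply, Matrix.one_apply] using this
  · simpa only [hK] using h00
  · simpa only [hK] using h0
  · simpa only [hK] using hempty
  · simp only [hK]

end LocalTokens

namespace TokenProtocol

variable {a b : Type*} [Fintype a] [Fintype b] [DecidableEq a] [DecidableEq b]
  (P : TokenProtocol a b)

/-- The channels of a token protocol: channel `c` announces the outcome of round `c`, so that the
directions alternate. -/
abbrev channels : ChannelFamily := ⟨P.d + 1, fun c => party true c, fun _ => P.n⟩

/-- The sender's and the receiver's registers of all channels form a pipeline; the sender's register
of channel `c` is the site `2 * c` and the receiver's register is the site `2 * c + 1`. -/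
abbrev pipeline : Pipeline (a × b) where
  m := 2 * (P.d + 1)
  n := P.n
  K := Pipeline.interleave (localKraus P.A P.B)
  root := P.root
  ow j := decide (j % 2 = 0)
  root_ne := P.root_ne
  sum_K l x := by
    unfold Pipeline.interleave
    split_ifs
    · exact sum_localKraus P.sum_A P.sum_B _ _
    · exact sum_trivialKraus x
  K_zero_zero l := by simp [Pipeline.interleave, P.K_zero_zero]
  K_zero l y hy := by
    unfold Pipeline.interleave
    split_ifs
    · exact P.K_zero _ _ hy
    · rfl
  K_empty l x hx := by
    unfold Pipeline.interleave
    split_ifs with h1 h2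
    · exact P.K_empty _ _ hx
    · exact absurd h2.symm hx
    · rfl

theorem protocol_pipeline :
    P.pipeline.protocol = tokenMap (localKraus P.A P.B) (P.d + 2) 0 P.root := by
  rw [Pipeline.protocol_eq_tokenMap]
  exact Pipeline.tokenMap_interleave _ (P.d + 1) P.root

/-- The site of the sender's (`false`) or the receiver's (`true`) register of a channel. -/
def site : Fin (P.d + 1) × Bool ≃ Fin P.pipeline.m :=
  Equiv.ofBijective (fun x => ⟨2 * x.1 + x.2.toNat, by
    have := x.1.2
    have := Bool.toNat_le x.2
    change _ < 2 * (P.d + 1)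
    omega⟩) <| by
  rw [Fintype.bijective_iff_injective_and_card]
  constructor
  · rintro ⟨c, u⟩ ⟨c', u'⟩ h
    rw [Fin.mk.injEq] at h
    have h1 := Bool.toNat_le u
    have h2 := Bool.toNat_le u'
    ext
    · simp only at h ⊢; omega
    · cases u <;> cases u' <;> simp at h ⊢ <;> omega
  · simp [mul_comm]

theorem site_val (c : Fin (P.d + 1)) (u : Bool) :
    (P.site (c, u) : ℕ) = 2 * c + u.toNat := rfl

/-- Basis states of one party's registers. -/
abbrev Reg := Fin (P.d + 1) → Fin (P.n + 1)

/-- The content of Alice's (`true`) or Bob's (`false`) register of a channel. -/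
def content (q : P.Reg × P.Reg) (o : Bool) (c : Fin (P.d + 1)) :
    Fin (P.n + 1) :=
  if o then q.1 c else q.2 c

/-- Basis states of the registers are configurations of the pipeline. -/
def conf : P.Reg × P.Reg ≃ P.pipeline.Conf where
  toFun q j := P.content q (party true (P.site.symm j).1 != (P.site.symm j).2) (P.site.symm j).1
  invFun ω := (fun c => ω (P.site (c, !party true c)), fun c => ω (P.site (c, party true c)))
  left_inv q := by
    refine Prod.ext ?_ ?_ <;> funext c <;> simp only [Equiv.symm_apply_apply] <;> simp [content]
  right_inv ω := by
    funext j
    obtain ⟨⟨c, u⟩, rfl⟩ := P.site.surjective j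
    simp only [Equiv.symm_apply_apply, content]
    cases u <;> cases party true c <;> rfl

theorem conf_site (q : P.Reg × P.Reg) (c : Fin (P.d + 1))
    (u : Bool) : P.conf q (P.site (c, u)) = P.content q (party true c != u) c := by
  change P.content q _ _ = _
  rw [Equiv.symm_apply_apply]

theorem conf_zero : P.conf 0 = 0 := by
  funext j
  change P.content 0 _ _ = 0
  unfold content
  split_ifs <;> rfl

theorem conf_update_alice (r s : P.Reg) {c : Fin (P.d + 1)} {u : Bool}
    (h : (party true c != u) = true) (x : Fin (P.n + 1)) :
    P.conf (Function.update r c x, s) = Function.update (P.conf (r, s)) (P.site (c, u)) x := by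
  funext j
  obtain ⟨⟨c', u'⟩, rfl⟩ := P.site.surjective j
  rw [conf_site]
  by_cases hc : c' = c
  · subst hc
    by_cases hu : u' = u
    · subst hu
      simp [content, h]
    · have hu' : (party true c' != u') = false := by
        revert h hu
        cases party true c' <;> cases u <;> cases u' <;> simp
      rw [Function.update_of_ne (by simpa using hu), conf_site]
      simp [content, hu']
  · rw [Function.update_of_ne (by simp [hc]), conf_site]
    simp [content, Function.update_of_ne hc]

theorem conf_update_bob (r s : P.Reg) {c : Fin (P.d + 1)} {u : Bool}
    (h : (party true c != u) = false) (x : Fin (P.n + 1)) :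
    P.conf (r, Function.update s c x) = Function.update (P.conf (r, s)) (P.site (c, u)) x := by
  funext j
  obtain ⟨⟨c', u'⟩, rfl⟩ := P.site.surjective j
  rw [conf_site]
  by_cases hc : c' = c
  · subst hc
    by_cases hu : u' = u
    · subst hu
      simp [content, h]
    · have hu' : (party true c' != u') = true := by
        revert h hu
        cases party true c' <;> cases u <;> cases u' <;> simp
      rw [Function.update_of_ne (by simpa using hu), conf_site]
      simp [content, hu']
  · rw [Function.update_of_ne (by simp [hc]), conf_site]
    simp [content, Function.update_of_ne hc]

/-- Write `y` into a party's register of channel `l`, if there is such a channel. -/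
def write (l : ℕ) (y : Fin (P.n + 1)) (r : P.Reg) : P.Reg :=
  if h : l < P.d + 1 then Function.update r (⟨l, h⟩ : Fin (P.d + 1)) y else r

theorem conf_write_alice (r s : P.Reg) {l : ℕ} (h : party true l = true)
    (y : Fin (P.n + 1)) : P.conf (P.write l y r, s) = P.pipeline.put (2 * l) y (P.conf (r, s)) := by
  unfold write Pipeline.put
  by_cases hl : l < P.d + 1
  · rw [dif_pos hl, dif_pos (show 2 * l < 2 * (P.d + 1) by omega),
      P.conf_update_alice (u := false) r s (by simpa using h)]
    rfl
  · rw [dif_neg hl, dif_neg (show ¬ 2 * l < 2 * (P.d + 1) by omega)]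

theorem conf_write_bob (r s : P.Reg) {l : ℕ} (h : party true l = false)
    (y : Fin (P.n + 1)) : P.conf (r, P.write l y s) = P.pipeline.put (2 * l) y (P.conf (r, s)) := by
  unfold write Pipeline.put
  by_cases hl : l < P.d + 1
  · rw [dif_pos hl, dif_pos (show 2 * l < 2 * (P.d + 1) by omega),
      P.conf_update_bob (u := false) r s (by simpa using h)]
    rfl
  · rw [dif_neg hl, dif_neg (show ¬ 2 * l < 2 * (P.d + 1) by omega)]

/-- The register contents after a party, holding the announcement of round `c`, has performed the
next round with outcome `y`; nothing happens if there is no announcement. -/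
def reply (c : Fin (P.d + 1)) (r : P.Reg) (y : Fin (P.n + 1)) : P.Reg :=
  if r c = 0 then r else P.write (c + 1) y (Function.update r c 0)

/-- The start of a new run of the protocol by Alice, at the rate `δ`. -/
def start (δ : ℝ) : SuperOp (a × Registers P.channels) (a × Registers P.channels) :=
  (δ : ℂ) • (controlled (fun _ y => P.A 0 P.root y) (fun r y => P.write 0 y r) - LinearMap.id)

/-- Alice's reply on channel `c`, at the rate `k`. -/
def replyAlice (k : ℝ) (c : Fin (P.d + 1)) :
    SuperOp (a × Registers P.channels) (a × Registers P.channels) :=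
  (k : ℂ) • (controlled (fun r y => P.A (c + 1) (r c) y) (P.reply c) - LinearMap.id)

/-- Bob's reply on channel `c`, at the rate `k`. -/
def replyBob (k : ℝ) (c : Fin (P.d + 1)) :
    SuperOp (b × Registers P.channels) (b × Registers P.channels) :=
  (k : ℂ) • (controlled (fun r y => P.B (c + 1) (r c) y) (P.reply c) - LinearMap.id)

/-- Alice's generator: she starts the protocol and replies to the announcements she receives. -/
def alice (δ k : ℝ) : SuperOp (a × Registers P.channels) (a × Registers P.channels) :=
  P.start δ + ∑ c : Fin (P.d + 1), if party true (c + 1) = true then P.replyAlice k c else 0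

/-- Bob's generator: he replies to the announcements he receives. -/
def bob (k : ℝ) : SuperOp (b × Registers P.channels) (b × Registers P.channels) :=
  ∑ c : Fin (P.d + 1), if party true (c + 1) = true then 0 else P.replyBob k c

theorem isLindblad_alice {δ k : ℝ} (hδ : 0 ≤ δ) (hk : 0 ≤ k) : IsLindblad (P.alice δ k) := by
  refine (isLindblad_controlled (fun _ => P.sum_A _ _) _ hδ).add
    (isLindblad_sum _ fun c _ => ?_)
  split_ifs
  · exact isLindblad_controlled (fun _ => P.sum_A _ _) _ hk
  · exact isLindblad_zero

theorem isLindblad_bob {k : ℝ} (hk : 0 ≤ k) : IsLindblad (P.bob k) := by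
  refine isLindblad_sum _ fun c _ => ?_
  split_ifs
  · exact isLindblad_zero
  · exact isLindblad_controlled (fun _ => P.sum_B _ _) _ hk

/-- The diagonal blocks of the total state, labelled by configurations of the pipeline. -/
def blocks (ω : P.pipeline.Conf) : SuperOp (Total a b P.channels) (a × b) :=
  blockAt P.channels a b (P.conf.symm ω)

theorem interleave_site_true (c : Fin (P.d + 1)) (x y : Fin (P.n + 1)) :
    P.pipeline.K (P.site (c, true) + 1) x y = localKraus P.A P.B (c + 1) x y := by
  rw [site_val, show 2 * (c : ℕ) + true.toNat + 1 = 2 * (c + 1) by simp; ring]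
  exact Pipeline.interleave_even _ _ _ _

theorem next_site_true (c : Fin (P.d + 1)) (ω : P.pipeline.Conf) (y : Fin (P.n + 1)) :
    P.pipeline.next (some (P.site (c, true))) ω y = if ω (P.site (c, true)) = 0 then ω
      else P.pipeline.put (2 * (c + 1)) y (Function.update ω (P.site (c, true)) 0) := by
  have how : P.pipeline.ow (P.site (c, true)) = false := by
    rw [site_val]
    simp
  rw [Pipeline.next, how, site_val, show 2 * (c : ℕ) + true.toNat + 1 = 2 * (c + 1) by simp; ring]
  simp

theorem blocks_alice (ρ : Matrix (Total a b P.channels) (Total a b P.channels) ℂ)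
    (c : Fin (P.d + 1)) (hc : party true (c + 1) = true) (k : ℝ) (ω : P.pipeline.Conf) :
    P.blocks ω (actOn (Equiv.refl _) (P.replyAlice k c) ρ)
      = (k : ℂ) • (push (P.pipeline.kraus (some (P.site (c, true))))
        (P.pipeline.next (some (P.site (c, true)))) (fun ω => P.blocks ω ρ) ω - P.blocks ω ρ) := by
  have hp : party true c = false := by
    rw [party_succ_eq_not] at hc
    simpa using hc
  rw [replyAlice, actOn_smul_sub_id, LinearMap.smul_apply, map_smul, LinearMap.sub_apply, map_sub,
    LinearMap.id_apply]
  congr 2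
  refine (blockAt_alice _ _ _ _ _).trans (push_relabel P.conf (fun q y => ?_) (fun q y => ?_)
    (fun q => blockAt P.channels a b q ρ) ω).symm
  · rw [Pipeline.kraus, interleave_site_true, localKraus, if_pos hc, conf_site, content]
    simp [hp]
  · obtain ⟨r, s⟩ := q
    have ho : P.conf (r, s) (P.site (c, true)) = r c := by
      rw [conf_site, hp]
      rfl
    rw [next_site_true, ho]
    change _ = P.conf (P.reply c r y, s)
    rw [reply]
    split_ifs
    · rfl
    · rw [P.conf_write_alice _ _ hc, P.conf_update_alice (u := true) r s (by simp [hp])]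

theorem blocks_bob (ρ : Matrix (Total a b P.channels) (Total a b P.channels) ℂ)
    (c : Fin (P.d + 1)) (hc : party true (c + 1) = false) (k : ℝ) (ω : P.pipeline.Conf) :
    P.blocks ω (actOn (Equiv.prodComm _ _) (P.replyBob k c) ρ)
      = (k : ℂ) • (push (P.pipeline.kraus (some (P.site (c, true))))
        (P.pipeline.next (some (P.site (c, true)))) (fun ω => P.blocks ω ρ) ω - P.blocks ω ρ) := by
  have hp : party true c = true := by
    rw [party_succ_eq_not] at hc
    simpa using hc
  rw [replyBob, actOn_smul_sub_id, LinearMap.smul_apply, map_smul, LinearMap.sub_apply, map_sub,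
    LinearMap.id_apply]
  congr 2
  refine (blockAt_bob _ _ _ _ _).trans (push_relabel P.conf (fun q y => ?_) (fun q y => ?_)
    (fun q => blockAt P.channels a b q ρ) ω).symm
  · rw [Pipeline.kraus, interleave_site_true, localKraus, if_neg (by simp [hc]), conf_site, content]
    simp [hp]
  · obtain ⟨r, s⟩ := q
    have ho : P.conf (r, s) (P.site (c, true)) = s c := by
      rw [conf_site, hp]
      rfl
    rw [next_site_true, ho]
    change _ = P.conf (r, P.reply c s y)
    rw [reply]
    split_ifs
    · rfl
    · rw [P.conf_write_bob _ _ hc, P.conf_update_bob (u := true) r s (by simp [hp])]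

theorem blocks_start (ρ : Matrix (Total a b P.channels) (Total a b P.channels) ℂ)
    (δ : ℝ) (ω : P.pipeline.Conf) :
    P.blocks ω (actOn (Equiv.refl _) (P.start δ) ρ)
      = (δ : ℂ) • (push (P.pipeline.kraus none)
        (P.pipeline.next none) (fun ω => P.blocks ω ρ) ω - P.blocks ω ρ) := by
  rw [start, actOn_smul_sub_id, LinearMap.smul_apply, map_smul, LinearMap.sub_apply, map_sub,
    LinearMap.id_apply]
  congr 2
  refine (blockAt_alice _ _ _ _ _).trans (push_relabel P.conf (fun q y => ?_) (fun q y => ?_)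
    (fun q => blockAt P.channels a b q ρ) ω).symm
  · exact Pipeline.interleave_even (localKraus P.A P.B) 0 P.root y
  · exact (P.conf_write_alice q.1 q.2 (l := 0) rfl y).symm

/-- A channel moves the content of its sender's register to its receiver's register. It does so even
if the sender's register is empty, which erases the receiver's register. -/
theorem blocks_channelMap (ρ : Matrix (Total a b P.channels) (Total a b P.channels) ℂ)
    (c : Fin (P.d + 1)) (ω : P.pipeline.Conf) :
    P.blocks ω (channelMap a b P.channels c ρ)
      = push (P.pipeline.kraus (some (P.site (c, false))))
        (P.pipeline.next (some (P.site (c, false)))) (fun ω => P.blocks ω ρ) ω := by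
  have hput : ∀ y ω, P.pipeline.put (P.site (c, false) + 1) y ω
      = Function.update ω (P.site (c, true)) y := fun y ω =>
    dif_pos (show 2 * (c : ℕ) + 0 + 1 < 2 * (P.d + 1) by omega)
  refine (blockAt_channelMap _ _ _ _).trans (push_relabel_of_classical P.conf
    (g := fun ω => ω (P.site (c, false))) (fun ω y => ?_) (fun q => ?_)
    (fun q => blockAt P.channels a b q ρ) ω).symm
  · exact Pipeline.interleave_odd _ _ _ _
  · obtain ⟨r, s⟩ := q
    have how : P.pipeline.ow (P.site (c, false)) = true := by
      rw [site_val]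
      simp
    rw [Pipeline.next_some_of_move fun h => Bool.noConfusion (how.symm.trans h.2), hput, conf_site,
      content, transmit]
    cases hp : party true c
    · simp only [hp]
      rw [if_neg (by simp), if_neg (by simp), P.conf_update_alice (u := true) _ _ (by simp [hp]),
        P.conf_update_bob (u := false) _ _ (by simp [hp])]
    · simp only [hp]
      rw [if_pos (by simp), if_pos (by simp), P.conf_update_alice (u := false) _ _ (by simp [hp]),
        P.conf_update_bob (u := true) _ _ (by simp [hp]),
        Function.update_comm (by simp)]

/-- The transfer rates: the channels act at the rate `Γ` and the replies are given at the
rate `k`. -/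
def transferRate (Γ k : ℝ) (j : ℕ) : ℝ := if j % 2 = 0 then Γ else k

/-- The diagonal blocks of the total state evolve autonomously, namely like a pipeline: the channels
are the transfers from the even sites, and the replies are the transfers from the odd sites. -/
theorem blocks_totalGenerator (γ Γ δ k : ℝ) (𝔏 : SuperOp (a × b) (a × b))
    (ρ : Matrix (Total a b P.channels) (Total a b P.channels) ℂ) (ω : P.pipeline.Conf) :
    P.blocks ω (totalGenerator P.channels γ Γ 𝔏 (P.alice δ k) (P.bob k) ρ)
      = P.pipeline.gen γ 𝔏 δ (transferRate Γ k) (fun ω => P.blocks ω ρ) ω := by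
  have hodd : ∀ c : Fin (P.d + 1), transferRate Γ k (P.site (c, true)) = k := fun c => by
    rw [site_val, transferRate, if_neg (by simp)]
  have heven : ∀ c : Fin (P.d + 1), transferRate Γ k (P.site (c, false)) = Γ := fun c => by
    rw [site_val, transferRate, if_pos (by simp)]
  rw [Pipeline.gen, hybridGen_apply, Fintype.sum_option, ← Equiv.sum_comp P.site,
    Fintype.sum_prod_type]
  simp only [Fintype.sum_bool, Pipeline.rates, hodd, heven, Finset.sum_add_distrib]
  rw [totalGenerator, alice, bob, actOn_add, actOn_sum, actOn_sum]
  simp only [LinearMap.add_apply, LinearMap.smul_apply, LinearMap.sum_apply, map_add, map_smul,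
    map_sum, LinearMap.sub_apply, map_sub, LinearMap.id_apply]
  have hA : ∀ c : Fin (P.d + 1),
      P.blocks ω (actOn (Equiv.refl _)
        (if party true (c + 1) = true then P.replyAlice k c else 0) ρ)
      + P.blocks ω (actOn (Equiv.prodComm _ _)
        (if party true (c + 1) = true then 0 else P.replyBob k c) ρ)
      = (k : ℂ) • (push (P.pipeline.kraus (some (P.site (c, true))))
        (P.pipeline.next (some (P.site (c, true)))) (fun ω => P.blocks ω ρ) ω
          - P.blocks ω ρ) := by
    intro c
    by_cases hc : party true (c + 1) = true
    · rw [if_pos hc, if_pos hc, P.blocks_alice ρ c hc]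
      exact add_eq_left.2 rfl
    · rw [if_neg hc, if_neg hc, P.blocks_bob ρ c (by simpa using hc)]
      exact add_eq_right.2 rfl
  rw [← Finset.sum_congr rfl fun c _ => hA c, Finset.sum_add_distrib, blocks_start, Finset.smul_sum]
  simp only [P.blocks_channelMap]
  rw [show P.blocks ω (actOn (Equiv.prodProdProdComm a (Registers P.channels) b
    (Registers P.channels)) 𝔏 ρ) = 𝔏 (P.blocks ω ρ) from blockAt_main _ _ _ _]
  abel

end TokenProtocol

/-! ### The master equation of the total system -/

namespace TokenProtocol

variable {a b : Type*} [Fintype a] [Fintype b] [DecidableEq a] [DecidableEq b]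
  (P : TokenProtocol a b)

theorem sum_blocks (ρ : Matrix (Total a b P.channels) (Total a b P.channels) ℂ) :
    ∑ ω, P.blocks ω ρ = reducedState P.channels ρ := by
  rw [← sum_blockAt]
  exact Equiv.sum_comp P.conf.symm fun q => blockAt P.channels a b q ρ

theorem blocks_zero (ρ : Matrix (Total a b P.channels) (Total a b P.channels) ℂ) :
    P.blocks 0 ρ = idleState P.channels ρ := by
  rw [blocks, ← P.conf_zero, Equiv.symm_apply_apply]
  rfl

/-- The completely positive map that returns the main system at the end of the protocol. -/
def output (δ Γ : ℝ) : SuperOp (Total a b P.channels) (a × b) :=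
  P.pipeline.ret δ (transferRate Γ (Γ ^ 2 / δ)) ∘ₗ LinearMap.pi P.blocks

theorem output_apply (δ Γ : ℝ) (ρ : Matrix (Total a b P.channels) (Total a b P.channels) ℂ) :
    P.output δ Γ ρ = P.pipeline.ret δ (transferRate Γ (Γ ^ 2 / δ)) fun ω => P.blocks ω ρ := rfl

theorem isCompletelyPositive_output {δ Γ : ℝ} (hδ : 0 < δ) (hΓ : 0 < Γ) :
    IsCompletelyPositive (P.output δ Γ) := by
  have h : P.output δ Γ = ∑ j : Fin P.pipeline.m,
      ((transferRate Γ (Γ ^ 2 / δ) j / δ : ℝ) : ℂ) • ∑ ω, ∑ y,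
        if ω ≠ 0 ∧ P.pipeline.next (some j) ω y = 0
          then conjBy (P.pipeline.kraus (some j) ω y) ∘ₗ P.blocks ω else 0 := by
    ext1 ρ
    rw [output_apply, Pipeline.ret_apply]
    simp only [LinearMap.sum_apply, LinearMap.smul_apply]
    refine Finset.sum_congr rfl fun j _ => ?_
    congr 1
    refine Finset.sum_congr rfl fun ω _ => Finset.sum_congr rfl fun y _ => ?_
    split_ifs <;> rfl
  rw [h]
  refine isCompletelyPositive_sum _ fun j _ => IsCompletelyPositive.smul
    (isCompletelyPositive_sum _ fun ω _ => isCompletelyPositive_sum _ fun y _ => ?_) ?_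
  · split_ifs
    · exact (isCompletelyPositive_conjBy _).comp (isCompletelyPositive_blockAt _ _)
    · exact fun k X _ => Matrix.PosSemidef.zero
  · unfold transferRate
    split_ifs <;> positivity

/-- The replies are given at the rate `Γ ^ 2 / δ`, so that a receiver's register is emptied much
faster than it is erased by uses of its channel with an empty sender's register. -/
theorem run {γ δ Γ : ℝ} {𝔏 : SuperOp (a × b) (a × b)} (hγ : 0 ≤ γ) (hδ : 0 < δ) (hΓ : 0 < Γ)
    (h𝔏 : IsLindblad 𝔏) (hbound : ∀ σ, IsDensity σ → traceNorm (𝔏 σ) ≤ 1)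
    (hα : (γ + δ) / Γ ≤ 1) {ρ : ℝ → Matrix (Total a b P.channels) (Total a b P.channels) ℂ}
    (hρ : IsEvolution
      (totalGenerator P.channels γ Γ 𝔏 (P.alice δ (Γ ^ 2 / δ)) (P.bob (Γ ^ 2 / δ))) ρ) :
    P.pipeline.Run γ δ Γ (transferRate Γ (Γ ^ 2 / δ)) 𝔏 fun t ω => P.blocks ω (ρ t) := by
  have hsmall : γ + δ ≤ Γ := (div_le_one hΓ).1 hα
  have hk : Γ ≤ Γ ^ 2 / δ := by
    rw [le_div_iff₀ hδ, sq]
    exact mul_le_mul_of_nonneg_left (by linarith) hΓ.le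
  refine
    { γ_nonneg := hγ
      δ_pos := hδ
      small := hsmall
      le_lam := fun j => ?_
      lam_le := fun j => ?_
      lam_ow := fun j hj => ?_
      lindblad := h𝔏
      bounded := fun X hX v => abs_qf_map_le hbound hX v
      evol := fun t ht ω i j => ?_
      init_pos := fun ω => blockAt_posSemidef _ _ hρ.1.1
      init_trace := ?_ }
  · unfold transferRate
    split_ifs
    · exact le_rfl
    · exact hk
  · unfold transferRate
    split_ifs
    · exact hk
    · exact le_rfl
  · have h0 : j % 2 = 0 := by simpa using hj
    rw [transferRate, transferRate, if_pos h0, if_neg (by omega)]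
    refine le_of_eq ?_
    field_simp
  · rw [← blocks_totalGenerator]
    exact hρ.2 t ht _ _
  · rw [← map_sum, sum_blocks, ← sum_blockAt, map_sum, sum_rtr_blockAt, rtr_apply, hρ.1.2]
    simp

end TokenProtocol

end DissipativeLOCC

end

open DissipativeLOCC in
theorem mainTheorem1 {a b : Type*} [Fintype a] [Fintype b] [DecidableEq a] [DecidableEq b]
    [Nonempty a] [Nonempty b] (T : SuperOp (a × b) (a × b)) (hT : IsLOCC T) :
    ∃ (N : ChannelFamily) (C τ α₀ : ℝ), 0 < C ∧ 0 < τ ∧ 0 < α₀ ∧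
      ∀ δ Γ : ℝ, 0 < δ → 0 < Γ →
        ∃ (LA : SuperOp (a × Registers N) (a × Registers N))
          (LB : SuperOp (b × Registers N) (b × Registers N))
          (Φ : SuperOp (Total a b N) (a × b)),
          IsLindblad LA ∧ IsLindblad LB ∧ IsCompletelyPositive Φ ∧
          ∀ (γ : ℝ) (𝔏 : SuperOp (a × b) (a × b)), 0 ≤ γ → IsLindblad 𝔏 →
            (∀ σ, IsDensity σ → traceNorm (𝔏 σ) ≤ 1) → (γ + δ) / Γ ≤ α₀ →
            ∀ ρ : ℝ → Matrix (Total a b N) (Total a b N) ℂ,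
              IsEvolution (totalGenerator N γ Γ 𝔏 LA LB) ρ →
              ∀ t : ℝ, τ / δ ≤ t →
                -- the reduced state of the main system
                (∃ E : Matrix (a × b) (a × b) ℂ,
                  E.IsHermitian ∧ traceNorm E ≤ C * √((γ + δ) / Γ) ∧
                  MatHasDerivAt (fun s => reducedState N (ρ s))
                    ((γ : ℂ) • 𝔏 (reducedState N (ρ t))
                      + (δ : ℂ) • ((T (reducedState N (ρ t)) + E) - reducedState N (ρ t))) t) ∧
                -- its dominant part, for which `T'` is completely positive
                traceNorm (reducedState N (ρ t) - idleState N (ρ t)) ≤ C * ((γ + δ) / Γ) ∧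
                traceNorm (Φ (ρ t) - T (idleState N (ρ t))) ≤ C * √((γ + δ) / Γ) ∧
                MatHasDerivAt (fun s => idleState N (ρ s))
                  ((γ : ℂ) • 𝔏 (idleState N (ρ t))
                    + (δ : ℂ) • (Φ (ρ t) - idleState N (ρ t))) t := by
  obtain ⟨P, hP⟩ := hT.exists_tokenProtocol
  rw [← P.protocol_pipeline] at hP
  subst hP
  have hm : 0 < P.pipeline.m := by
    change 0 < 2 * (P.d + 1)
    omega
  obtain ⟨C, hC, hmain⟩ := Pipeline.exists_effective_evolution P.pipeline hm
  -- after `m / δ` the occupations of the `m` sites are bounded from above, and after `2 * m / δ`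
  -- also from below
  refine ⟨P.channels, C, 2 * P.pipeline.m, 1, hC, by positivity, one_pos, fun δ Γ hδ hΓ =>
    ⟨P.alice δ (Γ ^ 2 / δ), P.bob (Γ ^ 2 / δ), P.output δ Γ,
      P.isLindblad_alice hδ.le (by positivity), P.isLindblad_bob (by positivity),
      P.isCompletelyPositive_output hδ hΓ, ?_⟩⟩
  intro γ 𝔏 hγ h𝔏 hbound hα ρ hρ t ht
  have R := P.run hγ hδ hΓ h𝔏 hbound hα hρ
  obtain ⟨hE, hE', hM, hret⟩ := hmain _ _ _ _ _ _ R t ht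
  rw [P.sum_blocks] at hM
  rw [P.blocks_zero] at hM hret
  have ht0 : 0 < t := lt_of_lt_of_le (by positivity) ht
  have hd : ∀ ω i j, HasDerivAt (fun s => P.blocks ω (ρ s) i j)
      (P.pipeline.gen γ 𝔏 δ (TokenProtocol.transferRate Γ (Γ ^ 2 / δ))
        (fun ω => P.blocks ω (ρ t)) ω i j) t := fun ω i j =>
    (R.evol t ht0.le ω i j).hasDerivAt (Ici_mem_nhds ht0)
  have hα0 : 0 ≤ (γ + δ) / Γ := by positivity
  have hsqrt : C * ((γ + δ) / Γ) ≤ C * √((γ + δ) / Γ) := by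
    refine mul_le_mul_of_nonneg_left (Real.le_sqrt_of_sq_le ?_) hC.le
    rw [sq]
    exact mul_le_of_le_one_left hα0 hα
  refine ⟨⟨_, hE, hE'.trans hsqrt, fun i j => ?_⟩, hM, hret.trans hsqrt, fun i j => ?_⟩
  · have h := HasDerivAt.fun_sum (u := Finset.univ) fun ω _ => hd ω i j
    simp only [← Matrix.sum_apply, P.sum_blocks] at h
    rw [Pipeline.sum_gen_eq hδ, P.sum_blocks] at h
    exact h
  · have h := hd 0 i j
    rw [Pipeline.gen_zero hm hδ] at h
    simp only [P.blocks_zero] at h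
    exact h
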